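/- Let $Nil_3$ be $\mathbb R^3$ with the Heisenberg product $$(x_1,y_1,z_1)\star(x_2,y_2,z_2)=\Big(x_1+x_2,\;y_1+y_2,\;z_1+z_2+\tfrac{x_1y_2-x_2y_1}{2}\Big),$$ let $X=\partial_x-\frac y2\partial_z$, $Y=\partial_y+\frac x2\partial_z$, $Z=\partial_z$, and for $\lambda>0$ let $\bar g_\lambda$ be the metric for which $(X,Y,\lambda^{-1/2}Z)$ is orthonormal. Write $L_p$ for the left translation $q\mapsto p\star q$ and $\rho_u$ for the rotation of angle $u$ of the $(x,y)$-coordinates. Surfaces are non-empty, smooth and immersed. A surface $\mathcal M$ is a translator along $V=a_1X+a_2Y+(a_3+a_1y-a_2x)Z$ (the Killing field generating the group $t\mapsto L_{t(a_1,a_2,a_3)}$) if $t\mapsto L_{t(a_1,a_2,a_3)}(\mathcal M)$ is an evolution by mean curvature flow in $(Nil_3,\bar g_\lambda)$, up to tangential motions, that is, $H=\bar g_\lambda(\vec\nu,V)$. It is a vertical translator of constant speed $s$ if $V=s\,\lambda^{-1/2}Z$ (the speed $s$ may be negative or zero). Fix $\lambda>0$ and $(a_1,a_2,a_3)\in\mathbb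 R^3$ with $(a_1,a_2)\ne(0,0)$, and let $V$ be as above. 1) Let $\mathcal M$ be connected and invariant under the vertical translations $L_{(0,0,u)}$, $u\in\mathbb R$. Then $\mathcal M$ is a translator along $V$ if and only if $\mathcal M\subseteq\gamma\times\mathbb R$, where $\gamma$ is either a grim reaper of the Euclidean plane translating in the direction $(a_1,a_2)$ with constant speed $\sqrt{a_1^2+a_2^2}$, i.e. for some $(w_1,w_2)\in\mathbb R^2$ the curve $$a_1(x-w_1)+a_2(y-w_2)=-\log\cos\big(a_1(y-w_2)-a_2(x-w_1)\big),\qquad |a_1(y-w_2)-a_2(x-w_1)|<\tfrac\pi2,$$ or a straight line parallel to $(a_1,a_2)$ (the trivial case in which $V$ is tangent to $\mathcal M$). If moreover $\mathcal M$ is complete, then $\mathcal M=\gamma\times\mathbb R$. Each such grim reaper cylinder is a complete embedded translator along $V$ for every $\lambda>0$: the solutions do not depend on $\lambda$. 2) Let $(x_0,y_0)\neq(0,0)$, $z_0\in\mathbb R$ and $G=\{L_{(ux_0,uy_0,uz_0)}\mid u\in\mathbb R\}$. A $G$-invariant translator along $V$ exists if and only if there is $c\in\mathbb R$ with $(a_1,a_2)=c(x_0,y_0)$.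 In this case put $s=(a_3-cz_0)\sqrt\lambda$. A $G$-invariant surface is a translator along $V$ if and only if it is a vertical translator of constant speed $s$. If $s\ne0$, let $T_s(x,y,z)=(|s|x,\,sy,\,|s|sz)$; then there is $\theta$ such that a surface $\mathcal M$ is a $G$-invariant translator along $V$ for $\bar g_\lambda$ if and only if $\rho_\theta(T_s(\mathcal M))$ is a vertical translator of unit speed for $\bar g_{\lambda/s^2}$, invariant under $\{L_{(u,0,ku)}\mid u\in\mathbb R\}$ with $k=|s||z_0|/\sqrt{x_0^2+y_0^2}\ge0$. Moreover, if $s\neq0$, there is a complete connected $G$-invariant translator along $V$ that is a horizontal graph $z=h(x,y)$ over an open strip of the $(x,y)$-plane parallel to $(x_0,y_0)$ of width $$\frac{2}{\sqrt\lambda}\sqrt{1+\frac{\lambda z_0^2}{x_0^2+y_0^2}}\;\sinh\Big(\frac{\pi\sqrt\lambda}{2|s|}\Big).$$ 3) No translator along $V$ is invariant under the horizontal rotations $\rho_u$, $u\in\mathbb R$. 4) No translator along $V$ is helicoidal: for every $(a,b,c)\in\mathbb R^3$ no translator along $V$ is invariant under the motions $L_{(au,bu,cu)}\circ\rho_u$,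 $u\in\mathbb R$, and, for every $q\in Nil_3$ and $c\in\mathbb R$, none is invariant under the group of the motions $L_q\circ L_{(0,0,cu)}\circ\rho_u\circ L_q^{-1}$, $u\in\mathbb R$, around the vertical axis through $q$. -/

import Mathlib

open scoped Manifold ContDiff Topology

noncomputable section

namespace Nil3

/-! The Heisenberg group and its metrics -/

/-- The underlying space `ℝ³` of the Heisenberg group; a point is `(x, y, z)`. -/
abbrev Nil : Type := ℝ × ℝ × ℝ

/-- The group operation of the Heisenberg group. -/
def mul (p q : Nil) : Nil :=
  (p.1 + q.1, p.2.1 + q.2.1, p.2.2 + q.2.2 + (p.1 * q.2.1 - q.1 * p.2.1) / 2)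

/-- The left translation by `p`. -/
def leftTrans (p : Nil) : Nil → Nil := fun q => mul p q

/-- The inverse of `p` for the operation `mul`. -/
def inv (p : Nil) : Nil := (-p.1, -p.2.1, -p.2.2)

/-- The horizontal rotation of angle `u` (around the `z`-axis). -/
def rot (u : ℝ) : Nil → Nil := fun q =>
  (q.1 * Real.cos u - q.2.1 * Real.sin u, q.1 * Real.sin u + q.2.1 * Real.cos u, q.2.2)

theorem mul_inv (p : Nil) : mul p (inv p) = (0, 0, 0) := by
  refine Prod.ext ?_ (Prod.ext ?_ ?_) <;> simp only [mul, inv] <;> ring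

/-- The vector field `A.1 X + A.2.1 Y + A.2.2 Z` at `p` in the coordinates `∂x, ∂y, ∂z`, where
`X = ∂x - (y/2) ∂z`, `Y = ∂y + (x/2) ∂z`, `Z = ∂z`. -/
def ofFrame (A : ℝ × ℝ × ℝ) (p : Nil) : ℝ × ℝ × ℝ :=
  (A.1, A.2.1, A.2.2 + (p.1 * A.2.1 - p.2.1 * A.1) / 2)

/-- The components, in the frame `X, Y, Z`, of a vector `w` at `p` that is given in the
coordinates `∂x, ∂y, ∂z`. -/
def frameComp (p : Nil) (w : ℝ × ℝ × ℝ) : ℝ × ℝ × ℝ :=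
  (w.1, w.2.1, w.2.2 + (p.2.1 * w.1 - p.1 * w.2.1) / 2)

theorem frameComp_ofFrame (A : ℝ × ℝ × ℝ) (p : Nil) : frameComp p (ofFrame A p) = A := by
  refine Prod.ext rfl (Prod.ext rfl ?_)
  simp only [frameComp, ofFrame]
  ring

/-- The metric `g_lam`, on components in the frame `X, Y, Z`: the basis `X, Y, lam^(-1/2) Z`
is orthonormal. -/
def metric (lam : ℝ) (A B : ℝ × ℝ × ℝ) : ℝ :=
  A.1 * B.1 + A.2.1 * B.2.1 + lam * (A.2.2 * B.2.2)

/-- The Levi-Civita connection of `g_lam` on the frame: the components of `∇_A B` for two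
vector fields `A`, `B` with constant components in the frame `X, Y, Z`. -/
def conn (lam : ℝ) (A B : ℝ × ℝ × ℝ) : ℝ × ℝ × ℝ :=
  (lam / 2 * (A.2.2 * B.2.1 + A.2.1 * B.2.2),
   -(lam / 2) * (A.2.2 * B.1 + A.1 * B.2.2),
   (A.1 * B.2.1 - A.2.1 * B.1) / 2)

/-- `conn` is compatible with the metric. -/
theorem conn_metric (lam : ℝ) (A B C : ℝ × ℝ × ℝ) :
    metric lam (conn lam A B) C + metric lam B (conn lam A C) = 0 := by
  simp only [metric, conn]
  ring

/-- `conn` has no torsion. -/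
theorem conn_torsion (lam : ℝ) (A B : ℝ × ℝ × ℝ) (p : Nil) :
    VectorField.lieBracket ℝ (ofFrame A) (ofFrame B) p
      = ofFrame (conn lam A B - conn lam B A) p := by
  have key : ∀ C : ℝ × ℝ × ℝ, ∀ w : ℝ × ℝ × ℝ,
      fderiv ℝ (ofFrame C) p w = (0, 0, (w.1 * C.2.1 - w.2.1 * C.1) / 2) := by
    intro C w
    let D : (ℝ × ℝ × ℝ) →ₗ[ℝ] (ℝ × ℝ × ℝ) :=
      { toFun := fun w => (0, 0, (w.1 * C.2.1 - w.2.1 * C.1) / 2)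
        map_add' := fun a b => by
          refine Prod.ext ?_ (Prod.ext ?_ ?_) <;> simp
          ring
        map_smul' := fun r a => by
          refine Prod.ext ?_ (Prod.ext ?_ ?_) <;> simp
          ring }
    have hD : ofFrame C = fun q => C + LinearMap.toContinuousLinearMap D q := by
      funext q
      refine Prod.ext ?_ (Prod.ext ?_ ?_) <;> simp [ofFrame, D]
    rw [hD, fderiv_const_add, ContinuousLinearMap.fderiv]
    rfl
  rw [VectorField.lieBracket, key, key]
  refine Prod.ext ?_ (Prod.ext ?_ ?_) <;> simp [ofFrame, conn] <;> ring

/-- The Killing field `V = a₁ X + a₂ Y + (a₃ + a₁ y - a₂ x) Z` is the velocity of the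
one-parameter group `t ↦ L_{ta}`. -/
theorem hasDerivAt_leftTrans (a p : Nil) (t : ℝ) :
    HasDerivAt (fun τ : ℝ => leftTrans (τ • a) p)
      (ofFrame (a.1, a.2.1, a.2.2 + a.1 * (leftTrans (t • a) p).2.1
        - a.2.1 * (leftTrans (t • a) p).1) (leftTrans (t • a) p)) t := by
  have h : (fun τ : ℝ => leftTrans (τ • a) p) = fun τ : ℝ =>
      p + τ • (a.1, a.2.1, a.2.2 + (a.1 * p.2.1 - p.1 * a.2.1) / 2) := by
    funext τ
    refine Prod.ext ?_ (Prod.ext ?_ ?_) <;> simp [leftTrans, mul] <;> ring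
  rw [h]
  have := ((hasDerivAt_id t).smul_const
    ((a.1, a.2.1, a.2.2 + (a.1 * p.2.1 - p.1 * a.2.1) / 2) : ℝ × ℝ × ℝ)).const_add p
  refine this.congr_deriv ?_
  refine Prod.ext ?_ (Prod.ext ?_ ?_) <;> simp [ofFrame, leftTrans, mul]
  ring

/-! Local geometry of a parametrized surface -/

/-- The parameter plane. -/
abbrev Plane : Type := EuclideanSpace ℝ (Fin 2)

/-- The coordinate tangent vector `V_i = ∂f/∂v_i`, in the frame `X, Y, Z`. -/
def tangentVec (f : Plane → Nil) (i : Fin 2) (v : Plane) : ℝ × ℝ × ℝ :=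
  frameComp (f v) (fderiv ℝ f v (EuclideanSpace.single i 1))

/-- The covariant derivative `∇_{V_i} V_j` along `f`, in the frame `X, Y, Z`. -/
def covDeriv (lam : ℝ) (f : Plane → Nil) (i j : Fin 2) (v : Plane) : ℝ × ℝ × ℝ :=
  fderiv ℝ (tangentVec f j) v (EuclideanSpace.single i 1)
    + conn lam (tangentVec f i v) (tangentVec f j v)

/-- The first fundamental form. -/
def firstForm (lam : ℝ) (f : Plane → Nil) (v : Plane) : Matrix (Fin 2) (Fin 2) ℝ :=
  Matrix.of fun i j => metric lam (tangentVec f i v) (tangentVec f j v)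

/-- `n` (in the frame `X, Y, Z`) is a unit normal vector at the parameter `v`. -/
def IsUnitNormal (lam : ℝ) (f : Plane → Nil) (v : Plane) (n : ℝ × ℝ × ℝ) : Prop :=
  (∀ i, metric lam n (tangentVec f i v) = 0) ∧ metric lam n n = 1

/-- The second fundamental form with respect to `n`. -/
def secondForm (lam : ℝ) (f : Plane → Nil) (v : Plane) (n : ℝ × ℝ × ℝ) :
    Matrix (Fin 2) (Fin 2) ℝ :=
  Matrix.of fun i j => metric lam (covDeriv lam f i j v) n

/-- The mean curvature with respect to `n`: the trace `g^{ij} h_{ij}`. -/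
def meanCurv (lam : ℝ) (f : Plane → Nil) (v : Plane) (n : ℝ × ℝ × ℝ) : ℝ :=
  ∑ i, ∑ j, (firstForm lam f v)⁻¹ i j * secondForm lam f v n i j

/-! Immersed surfaces, mean curvature flow, translators -/

/-- A (nonempty) smooth surface immersed in the Heisenberg group. -/
structure ImmersedSurface where
  carrier : Type
  [top : TopologicalSpace carrier]
  [t2 : T2Space carrier]
  [sc : SecondCountableTopology carrier]
  [nonempty : Nonempty carrier]
  [charted : ChartedSpace Plane carrier]
  [mfd : IsManifold (𝓡 2) ∞ carrier]
  toFun : carrier → Nil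
  smooth : ContMDiff (𝓡 2) 𝓘(ℝ, Nil) ∞ toFun
  immersion : ∀ q, Function.Injective (mfderiv (𝓡 2) 𝓘(ℝ, Nil) toFun q)

attribute [instance] ImmersedSurface.top ImmersedSurface.t2 ImmersedSurface.sc
  ImmersedSurface.nonempty ImmersedSurface.charted ImmersedSurface.mfd

section
variable {M : Type} [TopologicalSpace M] [ChartedSpace Plane M]

/-- The local parametrization of `F` given by the preferred chart at `q`. -/
def localRep (F : M → Nil) (q : M) : Plane → Nil := F ∘ (chartAt Plane q).symm

/-- The family of immersions `F t` moves by mean curvature flow for `g_lam` (up to tangential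
motions, which do not change the evolving surface): at each time, the normal component of the
velocity is the mean curvature. The condition does not depend on the sign of the normal. -/
def IsMeanCurvatureFlow (lam : ℝ) (F : ℝ → M → Nil) : Prop :=
  ∀ (t : ℝ) (q : M) (n : ℝ × ℝ × ℝ),
    IsUnitNormal lam (localRep (F t) q) (chartAt Plane q q) n →
      meanCurv lam (localRep (F t) q) (chartAt Plane q q) n
        = metric lam n (frameComp (F t q) (deriv (fun τ => F τ q) t))

/-- The surface `F` is a translator with direction `a`, that is, along the Killing field
`V = a₁ X + a₂ Y + (a₃ + a₁ y - a₂ x) Z`: the left translates `L_{ta} ∘ F` move by mean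
curvature flow. -/
def IsTranslator (lam : ℝ) (F : M → Nil) (a : Nil) : Prop :=
  IsMeanCurvatureFlow lam fun t => leftTrans (t • a) ∘ F

/-- A vertical translator of constant speed `s`, the unit vertical vector being
`lam^(-1/2) Z`. -/
def IsVerticalTranslator (lam : ℝ) (F : M → Nil) (s : ℝ) : Prop :=
  IsTranslator lam F (0, 0, s / √lam)

/-- The immersed surface `F` is invariant under the family of isometries `φ u`: these lift to
maps of the parameter surface, continuously in `u` and starting at the identity. (If `φ` is
a one-parameter group, the lift is automatically an action of `ℝ`; if `F` is an embedding, the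
condition says that each `φ u` maps the image of `F` into itself.) -/
def InvariantUnder (F : M → Nil) (φ : ℝ → Nil → Nil) : Prop :=
  ∃ ψ : ℝ → M → M, Continuous (fun x : ℝ × M => ψ x.1 x.2) ∧ (∀ q, ψ 0 q = q) ∧
    ∀ u q, F (ψ u q) = φ u (F q)

/-- Completeness of the metric induced by `g_lam`: every half-open `C¹` curve of finite length
converges in the surface. -/
def IsCompleteSurface (lam : ℝ) (F : M → Nil) : Prop :=
  ∀ c : ℝ → M, ContMDiffOn 𝓘(ℝ, ℝ) (𝓡 2) 1 c (Set.Ico 0 1) →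
    (∫⁻ t in Set.Ioo (0 : ℝ) 1, ENNReal.ofReal
      (√(metric lam (frameComp (F (c t)) (deriv (F ∘ c) t))
          (frameComp (F (c t)) (deriv (F ∘ c) t))))) < ⊤ →
    ∃ q, Filter.Tendsto c (𝓝[<] 1) (𝓝 q)

end

/-- The one-parameter group of left translations `u ↦ L_{up}`. -/
def transGroup (p : Nil) : ℝ → Nil → Nil := fun u => leftTrans (u • p)

/-- The helicoidal motions `u ↦ L_{up} ∘ ρ_u`. -/
def helicoidalMotion (p : Nil) : ℝ → Nil → Nil := fun u => leftTrans (u • p) ∘ rot u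

/-- The one-parameter group of helicoidal motions of pitch `c` around the vertical axis through
`q`: the conjugate by `L_q` of `u ↦ L_{(0,0,cu)} ∘ ρ_u`. -/
def screwGroup (q : Nil) (c : ℝ) : ℝ → Nil → Nil := fun u =>
  leftTrans q ∘ helicoidalMotion (0, 0, c) u ∘ leftTrans (inv q)

/-- The grim reaper of the Euclidean plane translating with velocity `(a₁, a₂) ≠ 0`, with vertex
`w`. For `(a₁, a₂) = (0, 1)`, `w = 0`, this is `y = - log (cos x)`, `|x| < π / 2`. -/
def grimReaper (a₁ a₂ : ℝ) (w : ℝ × ℝ) : Set (ℝ × ℝ) :=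
  {P | |a₁ * (P.2 - w.2) - a₂ * (P.1 - w.1)| < Real.pi / 2 ∧
    a₁ * (P.1 - w.1) + a₂ * (P.2 - w.2)
      = -Real.log (Real.cos (a₁ * (P.2 - w.2) - a₂ * (P.1 - w.1)))}

/-- The straight line through `w` parallel to `(a₁, a₂) ≠ 0`. -/
def parallelLine (a₁ a₂ : ℝ) (w : ℝ × ℝ) : Set (ℝ × ℝ) :=
  {P | a₁ * (P.2 - w.2) - a₂ * (P.1 - w.1) = 0}

/-- The vertical cylinder `C × ℝ`. -/
def cylinder (C : Set (ℝ × ℝ)) : Set Nil := {p | (p.1, p.2.1) ∈ C}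

/-- The graph `z = h(x, y)`, `(x, y) ∈ U`. -/
def horizontalGraph (U : Set (ℝ × ℝ)) (h : ℝ × ℝ → ℝ) : Set Nil :=
  {p | (p.1, p.2.1) ∈ U ∧ p.2.2 = h (p.1, p.2.1)}

/-- The open strip of the plane parallel to `(x₀, y₀)`, bounded by the lines at signed distances
`α` and `β` from the origin. -/
def strip (x₀ y₀ α β : ℝ) : Set (ℝ × ℝ) :=
  {P | α < (x₀ * P.2 - y₀ * P.1) / √(x₀ ^ 2 + y₀ ^ 2) ∧
    (x₀ * P.2 - y₀ * P.1) / √(x₀ ^ 2 + y₀ ^ 2) < β}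

/-- The rescaling `(x, y, z) ↦ (|s| x, s y, |s| s z)`: the Heisenberg dilation of factor `|s|`,
composed for `s < 0` with the isometry `(x, y, z) ↦ (x, -y, -z)`. -/
def rescale (s : ℝ) : Nil → Nil := fun p => (|s| * p.1, s * p.2.1, |s| * s * p.2.2)

end Nil3

end

open Nil3
open scoped Manifold ContDiff

namespace Nil3

noncomputable section

open MeasureTheory
open scoped Topology ComplexConjugate

/-! ### Algebra of the mean curvature -/

/-! Everything rests on the pointwise equation H = g(n, V), recorded as `TranslatorAt`. It may be
tested on any two independent tangent vectors and on normals of any length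
(`translatorAt_iff_along`), it does not depend on the parametrization (`translatorAt_comp`), and its
behaviour under left translations, rotations and dilations is known
(`FrameMap.translatorAt_comp_iff`). Since mean curvature is preserved by isometries, on a translator
that is invariant under an isometry the function g(n, V) must be invariant too
(`metric_killingField_of_invariant`).

Rotational and helicoidal motions. Along an orbit, g(n, V) is a trigonometric polynomial of degree
one in the angle plus an affine term. Invariance kills its coefficients, and since (a₁, a₂) ≠ 0 this
fixes the normal direction at every point: the surface would be an integral surface of a contact
plane field, and there is none (`not_tangent_contact`).

Vertical invariance. The vertical direction is tangent, and the equation becomes the Euclidean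
translator equation of the horizontal section, in which `lam` cancels (`translatorAt_vertical_iff`).
In the complex coordinate ζ = (a₁ - i a₂)(x + i y) that equation says exactly that the curve exp ζ
is straight (`eventually_line`). A local line is determined by any germ of the surface, so
connectedness makes it global. In real terms e^ξ sin(η - β) = C, where ζ = ξ + iη: C = 0 is a line
parallel to (a₁, a₂), and C ≠ 0 is a grim reaper. A complete piece of such a cylinder is all of it,
because segments in global coordinates of the cylinder lift to the surface
(`range_eq_of_isCompleteSurface`).

Invariance under non-vertical translations. Comparing g(n, V) at a point and at its translate shows
that, if (a₁, a₂) is not parallel to (x₀, y₀), all normals are horizontal. The surface is then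
vertical and ruled by one direction, hence flat in the plane picture, and this contradicts the
planar equation (`parallel_of_invariant`). In the parallel case V differs from a vertical field by a
multiple of the generator of the group, which is tangent to the surface, so only the vertical speed
s matters (`isTranslator_add_smul_iff`). Heisenberg dilations are homotheties between the metrics
and normalize s to 1. For a surface ruled by the orbits the equation is an ordinary differential
equation for the slope of the profile; the substitution √lam (k + y) = sinh φ solves it with φ
affine in arctan t (`strip_equation`). The height grows at least like log(1 + t²), so the solution
is properly embedded and therefore complete, and the range of sinh φ gives the width of the strip.
-/

/-- The components in the frame `X, Y, Z` of the Killing field with direction `a`, at `p`. -/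
def killingField (a p : Nil) : ℝ × ℝ × ℝ := (a.1, a.2.1, a.2.2 + a.1 * p.2.1 - a.2.1 * p.1)

/-- The translator equation for a parametrization `f` at the parameter `v`. -/
def TranslatorAt (lam : ℝ) (a : Nil) (f : Plane → Nil) (v : Plane) : Prop :=
  ∀ n, IsUnitNormal lam f v n → meanCurv lam f v n = metric lam n (killingField a (f v))

/-- The Gram determinant of two vectors. -/
def gram (lam : ℝ) (A B : ℝ × ℝ × ℝ) : ℝ :=
  metric lam A A * metric lam B B - metric lam A B ^ 2

theorem metric_comm (lam : ℝ) (A B : ℝ × ℝ × ℝ) : metric lam A B = metric lam B A := by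
  simp only [metric]; ring

theorem metric_add_left (lam : ℝ) (A B C : ℝ × ℝ × ℝ) :
    metric lam (A + B) C = metric lam A C + metric lam B C := by
  simp only [metric, Prod.fst_add, Prod.snd_add]; ring

theorem metric_smul_left (lam r : ℝ) (A C : ℝ × ℝ × ℝ) :
    metric lam (r • A) C = r * metric lam A C := by
  simp only [metric, Prod.smul_fst, Prod.smul_snd, smul_eq_mul]; ring

theorem metric_add_right (lam : ℝ) (A B C : ℝ × ℝ × ℝ) :
    metric lam C (A + B) = metric lam C A + metric lam C B := by
  simp only [metric, Prod.fst_add, Prod.snd_add]; ring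

theorem metric_smul_right (lam r : ℝ) (A C : ℝ × ℝ × ℝ) :
    metric lam C (r • A) = r * metric lam C A := by
  simp only [metric, Prod.smul_fst, Prod.smul_snd, smul_eq_mul]; ring

theorem metric_self_pos {lam : ℝ} (hlam : 0 < lam) {A : ℝ × ℝ × ℝ} (hA : A ≠ 0) :
    0 < metric lam A A := by
  obtain ⟨x, y, z⟩ := A
  simp only [metric]
  by_contra! h
  have hx := mul_self_nonneg x
  have hy := mul_self_nonneg y
  have hz := mul_nonneg hlam.le (mul_self_nonneg z)
  have h1 : x * x = 0 := by linarith
  have h2 : y * y = 0 := by linarith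
  have h3 : lam * (z * z) = 0 := by linarith
  apply hA
  simp only [mul_eq_zero, or_self, hlam.ne', false_or] at h1 h2 h3
  simp [h1, h2, h3]

/-- Lagrange's identity: the Gram determinant is a weighted sum of squares of the 2×2 minors, so for
`lam > 0` it vanishes only if all of them do. -/
theorem gram_eq (lam : ℝ) (A B : ℝ × ℝ × ℝ) :
    gram lam A B = (A.1 * B.2.1 - A.2.1 * B.1) ^ 2
      + lam * ((A.1 * B.2.2 - A.2.2 * B.1) ^ 2 + (A.2.1 * B.2.2 - A.2.2 * B.2.1) ^ 2) := by
  simp only [gram, metric]; ring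

theorem gram_pos {lam : ℝ} (hlam : 0 < lam) {A B : ℝ × ℝ × ℝ}
    (h : ∀ r t : ℝ, r • A + t • B = 0 → r = 0 ∧ t = 0) : 0 < gram lam A B := by
  rw [gram_eq]
  by_contra! h0
  have h1 := sq_nonneg (A.1 * B.2.1 - A.2.1 * B.1)
  have h2 := sq_nonneg (A.1 * B.2.2 - A.2.2 * B.1)
  have h3 := sq_nonneg (A.2.1 * B.2.2 - A.2.2 * B.2.1)
  have h23 := mul_nonneg hlam.le (add_nonneg h2 h3)
  have e1 : (A.1 * B.2.1 - A.2.1 * B.1) ^ 2 = 0 := by linarith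
  have e23 : lam * ((A.1 * B.2.2 - A.2.2 * B.1) ^ 2
    + (A.2.1 * B.2.2 - A.2.2 * B.2.1) ^ 2) = 0 := by linarith
  have e23' := (mul_eq_zero.1 e23).resolve_left hlam.ne'
  have e2 : (A.1 * B.2.2 - A.2.2 * B.1) ^ 2 = 0 := by linarith
  have e3 : (A.2.1 * B.2.2 - A.2.2 * B.2.1) ^ 2 = 0 := by linarith
  rw [sq_eq_zero_iff] at e1 e2 e3
  -- With all minors zero, each combination `B.i • A - A.i • B` vanishes; independence then makes
  -- every component of `A` zero, which is absurd.
  have c1 := (h B.1 (-A.1) (by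
    refine Prod.ext ?_ (Prod.ext ?_ ?_) <;> simp <;> linarith)).2
  have c2 := (h B.2.1 (-A.2.1) (by
    refine Prod.ext ?_ (Prod.ext ?_ ?_) <;> simp <;> linarith)).2
  have c3 := (h B.2.2 (-A.2.2) (by
    refine Prod.ext ?_ (Prod.ext ?_ ?_) <;> simp <;> linarith)).2
  have hA : A = 0 := by
    refine Prod.ext ?_ (Prod.ext ?_ ?_) <;> simp <;> linarith
  exact one_ne_zero (h 1 0 (by simp [hA])).1

theorem exists_normal (lam : ℝ) {A B : ℝ × ℝ × ℝ} (hlam : 0 < lam) (h : gram lam A B ≠ 0) :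
    ∃ m : ℝ × ℝ × ℝ, m ≠ 0 ∧ metric lam m A = 0 ∧ metric lam m B = 0 := by
  -- The cross product of `A` and `B`, with weights that make it orthogonal for diag(1, 1, lam).
  refine ⟨(lam * (A.2.1 * B.2.2 - A.2.2 * B.2.1), lam * (A.2.2 * B.1 - A.1 * B.2.2),
    A.1 * B.2.1 - A.2.1 * B.1), fun h0 => h ?_, ?_, ?_⟩
  · have e1 := congrArg Prod.fst h0
    have e2 := congrArg (fun x => x.2.1) h0
    have e3 := congrArg (fun x => x.2.2) h0
    simp only [Prod.fst_zero, Prod.snd_zero, mul_eq_zero, hlam.ne', false_or] at e1 e2 e3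
    rw [gram_eq, e3, e1, show A.1 * B.2.2 - A.2.2 * B.1 = 0 by linarith]
    ring
  all_goals simp only [metric]; ring

/-- The inverse of the first fundamental form is its adjugate over the Gram determinant. Clearing
that denominator leaves an expression that is linear in the normal, so unit length can be dropped
later. -/
theorem meanCurv_mul_gram (lam : ℝ) (f : Plane → Nil) (v : Plane) (n : ℝ × ℝ × ℝ)
    (h : gram lam (tangentVec f 0 v) (tangentVec f 1 v) ≠ 0) :
    meanCurv lam f v n * gram lam (tangentVec f 0 v) (tangentVec f 1 v)
      = metric lam (tangentVec f 1 v) (tangentVec f 1 v) * secondForm lam f v n 0 0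
        - metric lam (tangentVec f 0 v) (tangentVec f 1 v)
          * (secondForm lam f v n 0 1 + secondForm lam f v n 1 0)
        + metric lam (tangentVec f 0 v) (tangentVec f 0 v) * secondForm lam f v n 1 1 := by
  have hd : (firstForm lam f v).det = gram lam (tangentVec f 0 v) (tangentVec f 1 v) := by
    rw [Matrix.det_fin_two]
    simp only [firstForm, Matrix.of_apply, gram]
    rw [metric_comm lam (tangentVec f 1 v) (tangentVec f 0 v)]
    ring
  simp only [meanCurv, Fin.sum_univ_two, Matrix.inv_def, hd, Ring.inverse_eq_inv',
    Matrix.adjugate_fin_two, Matrix.smul_apply, smul_eq_mul]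
  simp only [firstForm, Matrix.of_apply, Matrix.cons_val', Matrix.cons_val_zero,
    Matrix.cons_val_one, Matrix.cons_val_fin_one]
  rw [metric_comm lam (tangentVec f 1 v) (tangentVec f 0 v)]
  field_simp
  ring

theorem secondForm_smul (lam : ℝ) (f : Plane → Nil) (v : Plane) (r : ℝ) (n : ℝ × ℝ × ℝ)
    (i j : Fin 2) : secondForm lam f v (r • n) i j = r * secondForm lam f v n i j := by
  simp only [secondForm, Matrix.of_apply, metric_smul_right]

/-- The translator equation, without normalization of the normal vector. -/
theorem translatorAt_iff_forall_normal {lam : ℝ} (hlam : 0 < lam) (a : Nil) {f : Plane → Nil}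
    {v : Plane} (h : gram lam (tangentVec f 0 v) (tangentVec f 1 v) ≠ 0) :
    TranslatorAt lam a f v ↔ ∀ m : ℝ × ℝ × ℝ, metric lam m (tangentVec f 0 v) = 0 →
      metric lam m (tangentVec f 1 v) = 0 →
      metric lam (tangentVec f 1 v) (tangentVec f 1 v) * secondForm lam f v m 0 0
        - metric lam (tangentVec f 0 v) (tangentVec f 1 v)
          * (secondForm lam f v m 0 1 + secondForm lam f v m 1 0)
        + metric lam (tangentVec f 0 v) (tangentVec f 0 v) * secondForm lam f v m 1 1
      = gram lam (tangentVec f 0 v) (tangentVec f 1 v) * metric lam m (killingField a (f v)) := by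
  constructor
  · intro hT m h0 h1
    by_cases hm : m = 0
    · subst hm
      simp [secondForm, metric]
    have hpos := metric_self_pos hlam hm
    set r := √(metric lam m m) with hr
    have hr0 : 0 < r := Real.sqrt_pos.2 hpos
    have hrr : r * r = metric lam m m := Real.mul_self_sqrt hpos.le
    have hn : IsUnitNormal lam f v (r⁻¹ • m) := by
      refine ⟨fun i => ?_, ?_⟩
      · fin_cases i
        · simp [metric_smul_left, h0]
        · simp [metric_smul_left, h1]
      · rw [metric_smul_left, metric_smul_right, ← hrr]
        field_simp
    have key := meanCurv_mul_gram lam f v (r⁻¹ • m) h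
    rw [hT _ hn] at key
    simp only [metric_smul_left, secondForm_smul] at key
    have hr1 : r * r⁻¹ = 1 := mul_inv_cancel₀ hr0.ne'
    linear_combination (-r) * key + (
      - (metric lam (tangentVec f 1 v) (tangentVec f 1 v) * secondForm lam f v m 0 0
        - metric lam (tangentVec f 0 v) (tangentVec f 1 v)
          * (secondForm lam f v m 0 1 + secondForm lam f v m 1 0)
        + metric lam (tangentVec f 0 v) (tangentVec f 0 v) * secondForm lam f v m 1 1)
      + gram lam (tangentVec f 0 v) (tangentVec f 1 v) * metric lam m (killingField a (f v)))
      * hr1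
  · intro H n hn
    apply mul_right_cancel₀ h
    rw [meanCurv_mul_gram lam f v n h, H n (hn.1 0) (hn.1 1)]
    ring

/-! ### The second fundamental form by second derivatives -/

/-- The derivative of `f` in the direction `X`, in the frame `X, Y, Z`. -/
def tangentAlong (f : Plane → Nil) (v : Plane) (X : Plane) : ℝ × ℝ × ℝ :=
  frameComp (f v) (fderiv ℝ f v X)

/-- The symmetric part of the Levi-Civita connection on the frame. -/
def symmConn (lam : ℝ) (A B : ℝ × ℝ × ℝ) : ℝ × ℝ × ℝ :=
  (lam / 2 * (A.2.2 * B.2.1 + A.2.1 * B.2.2), -(lam / 2) * (A.2.2 * B.1 + A.1 * B.2.2), 0)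

/-- The second fundamental form with respect to `m`, as a bilinear form on the parameter plane. -/
def secondAlong (lam : ℝ) (f : Plane → Nil) (v : Plane) (m : ℝ × ℝ × ℝ) (X Y : Plane) : ℝ :=
  metric lam (frameComp (f v) (fderiv ℝ (fderiv ℝ f) v X Y)
    + symmConn lam (tangentAlong f v X) (tangentAlong f v Y)) m

theorem frameComp_add (p : Nil) (w w' : ℝ × ℝ × ℝ) :
    frameComp p (w + w') = frameComp p w + frameComp p w' := by
  refine Prod.ext rfl (Prod.ext rfl ?_)
  simp only [frameComp, Prod.fst_add, Prod.snd_add]; ring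

theorem frameComp_smul (p : Nil) (r : ℝ) (w : ℝ × ℝ × ℝ) :
    frameComp p (r • w) = r • frameComp p w := by
  refine Prod.ext rfl (Prod.ext rfl ?_)
  simp only [frameComp, Prod.smul_fst, Prod.smul_snd, smul_eq_mul]; ring

theorem frameComp_injective (p : Nil) : Function.Injective (frameComp p) := by
  rintro ⟨x, y, z⟩ ⟨x', y', z'⟩ h
  simp only [frameComp, Prod.mk.injEq] at h
  obtain ⟨rfl, rfl, h⟩ := h
  simp only [Prod.mk.injEq, true_and]
  linarith

theorem frameComp_zero (p : Nil) : frameComp p 0 = 0 := by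
  refine Prod.ext rfl (Prod.ext rfl ?_)
  simp [frameComp]

theorem tangentAlong_add (f : Plane → Nil) (v X Y : Plane) :
    tangentAlong f v (X + Y) = tangentAlong f v X + tangentAlong f v Y := by
  simp only [tangentAlong, map_add, frameComp_add]

theorem tangentAlong_smul (f : Plane → Nil) (v X : Plane) (r : ℝ) :
    tangentAlong f v (r • X) = r • tangentAlong f v X := by
  simp only [tangentAlong, map_smul, frameComp_smul]

theorem symmConn_add_left (lam : ℝ) (A B C : ℝ × ℝ × ℝ) :
    symmConn lam (A + B) C = symmConn lam A C + symmConn lam B C := by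
  refine Prod.ext ?_ (Prod.ext ?_ ?_) <;>
    simp only [symmConn, Prod.fst_add, Prod.snd_add] <;> ring

theorem symmConn_smul_left (lam r : ℝ) (A C : ℝ × ℝ × ℝ) :
    symmConn lam (r • A) C = r • symmConn lam A C := by
  refine Prod.ext ?_ (Prod.ext ?_ ?_) <;>
    simp only [symmConn, Prod.smul_fst, Prod.smul_snd, smul_eq_mul] <;> ring

theorem symmConn_comm (lam : ℝ) (A B : ℝ × ℝ × ℝ) : symmConn lam A B = symmConn lam B A := by
  refine Prod.ext ?_ (Prod.ext ?_ ?_) <;> simp only [symmConn] <;> ring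

theorem secondAlong_add_left (lam : ℝ) (f : Plane → Nil) (v : Plane) (m : ℝ × ℝ × ℝ)
    (X Y W : Plane) : secondAlong lam f v m (X + Y) W
      = secondAlong lam f v m X W + secondAlong lam f v m Y W := by
  simp only [secondAlong, map_add, add_apply, frameComp_add,
    tangentAlong_add, symmConn_add_left, metric_add_left]
  ring

theorem secondAlong_smul_left (lam : ℝ) (f : Plane → Nil) (v : Plane) (m : ℝ × ℝ × ℝ)
    (r : ℝ) (X W : Plane) : secondAlong lam f v m (r • X) W = r * secondAlong lam f v m X W := by
  simp only [secondAlong, map_smul, smul_apply, frameComp_smul,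
    tangentAlong_smul, symmConn_smul_left, metric_add_left, metric_smul_left]
  ring

theorem secondAlong_comm (lam : ℝ) {f : Plane → Nil} {v : Plane} (hf : ContDiffAt ℝ ∞ f v)
    (m : ℝ × ℝ × ℝ) (X Y : Plane) :
    secondAlong lam f v m X Y = secondAlong lam f v m Y X := by
  have hs : IsSymmSndFDerivAt ℝ f v := hf.isSymmSndFDerivAt (by
    simp only [minSmoothness_of_isRCLikeNormedField]; exact WithTop.coe_le_coe.2 le_top)
  simp only [secondAlong, hs X Y, symmConn_comm lam (tangentAlong f v X)]

/-- Differentiating `frameComp (f v)` in its base point produces a term antisymmetric in the two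
directions, and it cancels the antisymmetric (torsion) part of `conn`. What remains is visibly
symmetric and bilinear, hence usable in every tangent basis. -/
theorem secondForm_eq_secondAlong (lam : ℝ) {f : Plane → Nil} {v : Plane}
    (hf : ContDiffAt ℝ ∞ f v) (m : ℝ × ℝ × ℝ) (i j : Fin 2) :
    secondForm lam f v m i j
      = secondAlong lam f v m (EuclideanSpace.single i 1) (EuclideanSpace.single j 1) := by
  have hfd : HasFDerivAt f (fderiv ℝ f v) v := (hf.differentiableAt (by simp)).hasFDerivAt
  have hf2 : DifferentiableAt ℝ (fderiv ℝ f) v :=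
    (hf.fderiv_right (m := ∞) (by simp)).differentiableAt (by simp)
  set ei : Plane := EuclideanSpace.single i 1
  set ej : Plane := EuclideanSpace.single j 1
  have hG : HasFDerivAt (fun w => fderiv ℝ f w ej)
      ((ContinuousLinearMap.apply ℝ Nil ej).comp (fderiv ℝ (fderiv ℝ f) v)) v :=
    (ContinuousLinearMap.apply ℝ Nil ej).hasFDerivAt.comp v hf2.hasFDerivAt
  have key : fderiv ℝ (tangentVec f j) v ei
      = frameComp (f v) (fderiv ℝ (fderiv ℝ f) v ei ej)
        + (0, 0, ((fderiv ℝ f v ei).2.1 * (fderiv ℝ f v ej).1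
          - (fderiv ℝ f v ei).1 * (fderiv ℝ f v ej).2.1) / 2) := by
    have h3 := (hG.snd.snd).add (((hfd.snd.fst.mul hG.fst).sub
      (hfd.fst.mul hG.snd.fst)).mul_const (1 / 2 : ℝ))
    have hT : HasFDerivAt (tangentVec f j) _ v :=
      (hG.fst.prodMk (hG.snd.fst.prodMk h3)).congr_of_eventuallyEq
        (Filter.Eventually.of_forall fun w => by
          refine Prod.ext rfl (Prod.ext rfl ?_)
          simp only [tangentVec, frameComp, Pi.add_apply, Pi.mul_apply, Pi.sub_apply, ej]
          ring)
    rw [hT.fderiv]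
    refine Prod.ext ?_ (Prod.ext ?_ ?_)
    · simp [frameComp]
    · simp [frameComp]
    · simp [frameComp]
      ring
  have hc : ∀ A B : ℝ × ℝ × ℝ, conn lam A B
      = symmConn lam A B + (0, 0, (A.1 * B.2.1 - A.2.1 * B.1) / 2) := by
    intro A B
    refine Prod.ext ?_ (Prod.ext ?_ ?_) <;> simp [conn, symmConn]
  simp only [secondForm, Matrix.of_apply, covDeriv, secondAlong]
  congr 1
  rw [key, hc, add_assoc, add_right_inj, add_left_comm]
  refine add_eq_left.2 ?_
  refine Prod.ext (by simp) (Prod.ext (by simp) ?_)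
  simp only [tangentVec, frameComp, Prod.snd_add, Prod.snd_zero, ei, ej]
  ring

theorem plane_eq (X : Plane) :
    X = X 0 • EuclideanSpace.single 0 (1 : ℝ) + X 1 • EuclideanSpace.single 1 (1 : ℝ) := by
  ext i
  fin_cases i <;> simp

/-- The translator equation in terms of two arbitrary independent tangent vectors. -/
theorem translatorAt_iff_along {lam : ℝ} (hlam : 0 < lam) (a : Nil) {f : Plane → Nil}
    {v : Plane} (hf : ContDiffAt ℝ ∞ f v) {X Y : Plane}
    (h : gram lam (tangentAlong f v X) (tangentAlong f v Y) ≠ 0) :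
    TranslatorAt lam a f v ↔ ∀ m : ℝ × ℝ × ℝ, metric lam m (tangentAlong f v X) = 0 →
      metric lam m (tangentAlong f v Y) = 0 →
      metric lam (tangentAlong f v Y) (tangentAlong f v Y) * secondAlong lam f v m X X
        - 2 * metric lam (tangentAlong f v X) (tangentAlong f v Y) * secondAlong lam f v m X Y
        + metric lam (tangentAlong f v X) (tangentAlong f v X) * secondAlong lam f v m Y Y
      = gram lam (tangentAlong f v X) (tangentAlong f v Y)
          * metric lam m (killingField a (f v)) := by
  set e0 : Plane := EuclideanSpace.single 0 1 with he0
  set e1 : Plane := EuclideanSpace.single 1 1 with he1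
  have hX : tangentAlong f v X = X 0 • tangentVec f 0 v + X 1 • tangentVec f 1 v := by
    conv_lhs => rw [plane_eq X]
    simp only [tangentAlong_add, tangentAlong_smul]
    rfl
  have hY : tangentAlong f v Y = Y 0 • tangentVec f 0 v + Y 1 • tangentVec f 1 v := by
    conv_lhs => rw [plane_eq Y]
    simp only [tangentAlong_add, tangentAlong_smul]
    rfl
  -- Numerator of the mean curvature and Gram determinant both scale by the squared determinant of
  -- the change of basis, so the equation does not see the basis.
  have hg : gram lam (tangentAlong f v X) (tangentAlong f v Y)
      = (X 0 * Y 1 - X 1 * Y 0) ^ 2 * gram lam (tangentVec f 0 v) (tangentVec f 1 v) := by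
    rw [hX, hY]
    simp only [gram, metric, Prod.fst_add, Prod.snd_add, Prod.smul_fst, Prod.smul_snd, smul_eq_mul]
    ring
  have hd : X 0 * Y 1 - X 1 * Y 0 ≠ 0 := by
    intro h0; apply h; rw [hg, h0]; ring
  have hg0 : gram lam (tangentVec f 0 v) (tangentVec f 1 v) ≠ 0 := by
    intro h0; apply h; rw [hg, h0]; ring
  rw [translatorAt_iff_forall_normal hlam a hg0]
  refine forall_congr' fun m => ?_
  have hn : (metric lam m (tangentAlong f v X) = 0 ∧ metric lam m (tangentAlong f v Y) = 0)
      ↔ (metric lam m (tangentVec f 0 v) = 0 ∧ metric lam m (tangentVec f 1 v) = 0) := by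
    rw [hX, hY]
    simp only [metric_add_right, metric_smul_right]
    constructor
    · rintro ⟨h1, h2⟩
      constructor <;> apply mul_left_cancel₀ hd
      · linear_combination Y 1 * h1 - X 1 * h2
      · linear_combination X 0 * h2 - Y 0 * h1
    · rintro ⟨h1, h2⟩
      simp [h1, h2]
  rw [← and_imp, ← and_imp, ← hn]
  refine imp_congr_right fun _ => ?_
  simp only [secondForm_eq_secondAlong lam hf]
  rw [hg]
  have hs : secondAlong lam f v m e1 e0 = secondAlong lam f v m e0 e1 :=
    secondAlong_comm lam hf m _ _
  have hexp : ∀ U W : Plane, secondAlong lam f v m U W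
      = U 0 * W 0 * secondAlong lam f v m e0 e0
        + (U 0 * W 1 + U 1 * W 0) * secondAlong lam f v m e0 e1
        + U 1 * W 1 * secondAlong lam f v m e1 e1 := by
    intro U W
    conv_lhs => rw [plane_eq U]
    rw [secondAlong_add_left, secondAlong_smul_left, secondAlong_smul_left,
      secondAlong_comm lam hf m _ W, secondAlong_comm lam hf m _ W, plane_eq W]
    simp only [secondAlong_add_left, secondAlong_smul_left]
    rw [← he0, ← he1, hs, ← plane_eq W]
    ring
  rw [hexp X X, hexp X Y, hexp Y Y, ← he0, ← he1, hs, hX, hY]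
  simp only [metric_add_right, metric_smul_right, metric_add_left, metric_smul_left]
  rw [metric_comm lam (tangentVec f 1 v) (tangentVec f 0 v)]
  have hd2 : (X 0 * Y 1 - X 1 * Y 0) ^ 2 ≠ 0 := pow_ne_zero 2 hd
  constructor
  · intro H
    linear_combination (X 0 * Y 1 - X 1 * Y 0) ^ 2 * H
  · intro H
    apply mul_left_cancel₀ hd2
    linear_combination H

theorem gram_tangentAlong_pos {lam : ℝ} (hlam : 0 < lam) {f : Plane → Nil} {v : Plane}
    (hf : Function.Injective (fderiv ℝ f v)) {X Y : Plane}
    (h : ∀ r t : ℝ, r • X + t • Y = 0 → r = 0 ∧ t = 0) :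
    0 < gram lam (tangentAlong f v X) (tangentAlong f v Y) := by
  refine gram_pos hlam fun r t hrt => h r t ?_
  rw [← tangentAlong_smul, ← tangentAlong_smul, ← tangentAlong_add] at hrt
  apply hf
  rw [map_zero]
  apply frameComp_injective (f v)
  rw [frameComp_zero]
  exact hrt

theorem single_independent (r t : ℝ) (h : r • EuclideanSpace.single (0 : Fin 2) (1 : ℝ)
    + t • EuclideanSpace.single (1 : Fin 2) (1 : ℝ) = 0) : r = 0 ∧ t = 0 := by
  have h0 := congrArg (fun X : Plane => X 0) h
  have h1 := congrArg (fun X : Plane => X 1) h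
  simp at h0 h1
  exact ⟨h0, h1⟩

theorem gram_tangentVec_pos {lam : ℝ} (hlam : 0 < lam) {f : Plane → Nil} {v : Plane}
    (hf : Function.Injective (fderiv ℝ f v)) :
    0 < gram lam (tangentVec f 0 v) (tangentVec f 1 v) :=
  gram_tangentAlong_pos hlam hf single_independent

/-! ### Invariance under reparametrizations and isometries -/

/-- Cramer's rule: a nonzero Gram determinant forces `X` and `Y` to span the parameter plane. It is
used to discard tangential terms. -/
theorem metric_tangentAlong_eq_zero {lam : ℝ} {f : Plane → Nil} {v X Y : Plane}
    (h : gram lam (tangentAlong f v X) (tangentAlong f v Y) ≠ 0) {m : ℝ × ℝ × ℝ}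
    (hX : metric lam m (tangentAlong f v X) = 0) (hY : metric lam m (tangentAlong f v Y) = 0)
    (W : Plane) : metric lam m (tangentAlong f v W) = 0 := by
  have hd : X 0 * Y 1 - X 1 * Y 0 ≠ 0 := by
    intro h0
    apply h
    have e : ∀ U : Plane, tangentAlong f v U
        = U 0 • tangentVec f 0 v + U 1 • tangentVec f 1 v := by
      intro U
      conv_lhs => rw [plane_eq U]
      simp only [tangentAlong_add, tangentAlong_smul]
      rfl
    have : gram lam (tangentAlong f v X) (tangentAlong f v Y)
        = (X 0 * Y 1 - X 1 * Y 0) ^ 2 * gram lam (tangentVec f 0 v) (tangentVec f 1 v) := by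
      rw [e X, e Y]
      simp only [gram, metric, Prod.fst_add, Prod.snd_add, Prod.smul_fst, Prod.smul_snd,
        smul_eq_mul]
      ring
    rw [this, h0]
    ring
  have hW : (X 0 * Y 1 - X 1 * Y 0) • W
      = (W 0 * Y 1 - W 1 * Y 0) • X + (X 0 * W 1 - X 1 * W 0) • Y := by
    ext i
    fin_cases i <;> simp <;> ring
  have := congrArg (fun U => metric lam m (tangentAlong f v U)) hW
  simp only [tangentAlong_add, tangentAlong_smul, metric_add_right, metric_smul_right, hX, hY]
    at this
  simpa [hd] using this

/-- The chain rule for first and second derivatives. -/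
theorem fderiv_comp_second {E F G : Type*} [NormedAddCommGroup E] [NormedSpace ℝ E]
    [NormedAddCommGroup F] [NormedSpace ℝ F] [NormedAddCommGroup G] [NormedSpace ℝ G]
    {f : F → G} {g : E → G} {κ : E → F} {v : E} (hf : ContDiffAt ℝ ∞ f (κ v))
    (hκ : ContDiffAt ℝ ∞ κ v) (h : g =ᶠ[𝓝 v] f ∘ κ) :
    (∀ X, fderiv ℝ g v X = fderiv ℝ f (κ v) (fderiv ℝ κ v X)) ∧
    ∀ X Y, fderiv ℝ (fderiv ℝ g) v X Y
      = fderiv ℝ (fderiv ℝ f) (κ v) (fderiv ℝ κ v X) (fderiv ℝ κ v Y)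
        + fderiv ℝ f (κ v) (fderiv ℝ (fderiv ℝ κ) v X Y) := by
  have h1 : fderiv ℝ g =ᶠ[𝓝 v] fun w => (fderiv ℝ f (κ w)).comp (fderiv ℝ κ w) := by
    have hf' : ∀ᶠ w in 𝓝 v, ContDiffAt ℝ 1 f (κ w) :=
      hκ.continuousAt.eventually ((hf.of_le (by simp)).eventually (by simp))
    have hκ' : ∀ᶠ w in 𝓝 v, ContDiffAt ℝ 1 κ w := (hκ.of_le (by simp)).eventually (by simp)
    filter_upwards [h.eventuallyEq_nhds, hf', hκ'] with w hw hfw hκw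
    rw [hw.fderiv_eq]
    exact fderiv_comp w (hfw.differentiableAt (by simp)) (hκw.differentiableAt (by simp))
  have hf2 : DifferentiableAt ℝ (fderiv ℝ f) (κ v) :=
    (hf.fderiv_right (m := ∞) (by simp)).differentiableAt (by simp)
  have hκ2 : DifferentiableAt ℝ (fderiv ℝ κ) v :=
    (hκ.fderiv_right (m := ∞) (by simp)).differentiableAt (by simp)
  have hκ1 : DifferentiableAt ℝ κ v := hκ.differentiableAt (by simp)
  refine ⟨fun X => by rw [h1.eq_of_nhds]; rfl, fun X Y => ?_⟩
  rw [h1.fderiv_eq]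
  have := (hf2.hasFDerivAt.comp v hκ1.hasFDerivAt).clm_comp hκ2.hasFDerivAt
  change fderiv ℝ (fun y => (fderiv ℝ f ∘ κ) y ∘SL fderiv ℝ κ y) v X Y = _
  rw [this.fderiv]
  simp [add_comm]

/-- The translator equation does not depend on the parametrization. -/
theorem translatorAt_comp {lam : ℝ} (hlam : 0 < lam) (a : Nil) {f g : Plane → Nil}
    {κ : Plane → Plane} {v : Plane} (hf : ContDiffAt ℝ ∞ f (κ v)) (hκ : ContDiffAt ℝ ∞ κ v)
    (hg : Function.Injective (fderiv ℝ g v)) (h : g =ᶠ[𝓝 v] f ∘ κ) :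
    TranslatorAt lam a g v ↔ TranslatorAt lam a f (κ v) := by
  have hgs : ContDiffAt ℝ ∞ g v := (hf.comp v hκ).congr_of_eventuallyEq h
  obtain ⟨c1, c2⟩ := fderiv_comp_second hf hκ h
  set e0 : Plane := EuclideanSpace.single 0 1
  set e1 : Plane := EuclideanSpace.single 1 1
  have hv : g v = f (κ v) := h.eq_of_nhds
  have ht : ∀ X, tangentAlong g v X = tangentAlong f (κ v) (fderiv ℝ κ v X) := by
    intro X; rw [tangentAlong, tangentAlong, hv, c1]
  have hgram := (gram_tangentAlong_pos hlam hg single_independent).ne'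
  have hgram' := hgram
  rw [ht, ht] at hgram'
  rw [translatorAt_iff_along hlam a hgs hgram, translatorAt_iff_along hlam a hf hgram']
  simp only [ht, hv]
  refine forall_congr' fun m => forall_congr' fun h0 => forall_congr' fun h1 => ?_
  -- The second derivative of `κ` enters only through a tangent vector, which the normal `m`
  -- annihilates.
  have hs : ∀ X Y, secondAlong lam g v m X Y
      = secondAlong lam f (κ v) m (fderiv ℝ κ v X) (fderiv ℝ κ v Y) := by
    intro X Y
    have := metric_tangentAlong_eq_zero hgram' h0 h1 (fderiv ℝ (fderiv ℝ κ) v X Y)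
    rw [metric_comm, tangentAlong] at this
    simp only [secondAlong, ht, hv, c2, frameComp_add, metric_add_left, this, add_zero]
  simp only [hs]

/-- An affine map of the Heisenberg group that acts on the frame `X, Y, Z` by the constant linear
map `Λ` and multiplies the metric by `μ ^ 2`. -/
structure FrameMap (lam lam' μ : ℝ) (Φ : Nil → Nil) (Λ : (ℝ × ℝ × ℝ) →ₗ[ℝ] (ℝ × ℝ × ℝ)) :
    Prop where
  affine : ∃ (D : Nil →ₗ[ℝ] Nil) (b : Nil), (∀ p, Φ p = b + D p) ∧
    ∀ p w, frameComp (Φ p) (D w) = Λ (frameComp p w)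
  conn_map : ∀ A B, conn lam' (Λ A) (Λ B) = Λ (conn lam A B)
  metric_map : ∀ A B, metric lam' (Λ A) (Λ B) = μ ^ 2 * metric lam A B
  surj : Function.Surjective Λ
  pos : 0 < μ

namespace FrameMap

variable {lam lam' μ : ℝ} {Φ : Nil → Nil} {Λ : (ℝ × ℝ × ℝ) →ₗ[ℝ] (ℝ × ℝ × ℝ)}

theorem contDiff (hΦ : FrameMap lam lam' μ Φ Λ) : ContDiff ℝ ∞ Φ := by
  obtain ⟨D, b, hD, -⟩ := hΦ.affine
  have : Φ = fun p => b + LinearMap.toContinuousLinearMap D p := funext hD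
  rw [this]
  exact contDiff_const.add (ContinuousLinearMap.contDiff _)

theorem frameComp_fderiv (hΦ : FrameMap lam lam' μ Φ Λ) (p : Nil) (w : ℝ × ℝ × ℝ) :
    frameComp (Φ p) (fderiv ℝ Φ p w) = Λ (frameComp p w) := by
  obtain ⟨D, b, hD, h⟩ := hΦ.affine
  have e : Φ = fun p => b + LinearMap.toContinuousLinearMap D p := funext hD
  rw [← h]
  congr 1
  rw [e, fderiv_const_add, ContinuousLinearMap.fderiv]
  rfl

theorem injective (hΦ : FrameMap lam lam' μ Φ Λ) : Function.Injective Λ :=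
  LinearMap.injective_iff_surjective.2 hΦ.surj

theorem tangentVec_comp (hΦ : FrameMap lam lam' μ Φ Λ) {f : Plane → Nil} {v : Plane}
    (hf : DifferentiableAt ℝ f v) (i : Fin 2) :
    tangentVec (Φ ∘ f) i v = Λ (tangentVec f i v) := by
  rw [tangentVec, fderiv_comp v (hΦ.contDiff.differentiable (by simp) _) hf]
  exact hΦ.frameComp_fderiv _ _

theorem injective_fderiv (hΦ : FrameMap lam lam' μ Φ Λ) (p : Nil) :
    Function.Injective (fderiv ℝ Φ p) := by
  intro w w' h
  apply frameComp_injective p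
  apply hΦ.injective
  rw [← hΦ.frameComp_fderiv, ← hΦ.frameComp_fderiv, h]

theorem injective_fderiv_comp (hΦ : FrameMap lam lam' μ Φ Λ) {f : Plane → Nil} {v : Plane}
    (hf : DifferentiableAt ℝ f v) (hfi : Function.Injective (fderiv ℝ f v)) :
    Function.Injective (fderiv ℝ (Φ ∘ f) v) := by
  rw [fderiv_comp v (hΦ.contDiff.differentiable (by simp) _) hf]
  exact (hΦ.injective_fderiv _).comp hfi

/-- The translator equation of the image of a surface under a `FrameMap`. -/
theorem translatorAt_comp_iff (hΦ : FrameMap lam lam' μ Φ Λ) (hlam : 0 < lam) (a : Nil)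
    {f : Plane → Nil} {v : Plane} (hf : ContDiffAt ℝ ∞ f v)
    (hfi : Function.Injective (fderiv ℝ f v)) :
    TranslatorAt lam' a (Φ ∘ f) v ↔ ∀ n, IsUnitNormal lam f v n →
      meanCurv lam f v n = metric lam' (Λ n) (killingField a (Φ (f v))) := by
  have hμ := hΦ.pos
  have hgram : gram lam (tangentVec f 0 v) (tangentVec f 1 v) ≠ 0 :=
    (gram_tangentVec_pos hlam hfi).ne'
  have hd : ∀ᶠ w in 𝓝 v, DifferentiableAt ℝ f w := by
    have := (hf.of_le (m := 1) (by simp)).eventually (by simp)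
    filter_upwards [this] with w hw using hw.differentiableAt (by simp)
  have ht : ∀ i, tangentVec (Φ ∘ f) i =ᶠ[𝓝 v] fun w => Λ (tangentVec f i w) := by
    intro i
    filter_upwards [hd] with w hw using hΦ.tangentVec_comp hw i
  have ht' : ∀ i, tangentVec (Φ ∘ f) i v = Λ (tangentVec f i v) := fun i => (ht i).eq_of_nhds
  have htd : ∀ i, DifferentiableAt ℝ (tangentVec f i) v := by
    intro i
    have h1 : DifferentiableAt ℝ (fun w => fderiv ℝ f w (EuclideanSpace.single i 1)) v :=
      ((hf.fderiv_right (m := ∞) (by simp)).differentiableAt (by simp)).clm_apply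
        (differentiableAt_const _)
    have h0 : DifferentiableAt ℝ f v := hf.differentiableAt (by simp)
    unfold tangentVec frameComp
    fun_prop
  have hcov : ∀ i j, covDeriv lam' (Φ ∘ f) i j v = Λ (covDeriv lam f i j v) := by
    intro i j
    rw [covDeriv, covDeriv, map_add, ht' i, ht' j, hΦ.conn_map, (ht j).fderiv_eq]
    congr 1
    have := ((LinearMap.toContinuousLinearMap Λ).hasFDerivAt.comp v (htd j).hasFDerivAt).fderiv
    change fderiv ℝ (fun w => Λ (tangentVec f j w)) v = _ at this
    rw [this]
    rfl
  -- A homothety of ratio `μ` takes unit normals to unit normals after division by `μ`, and it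
  -- divides the mean curvature by `μ` as well; the two factors cancel in the equation.
  have hn : ∀ n, IsUnitNormal lam' (Φ ∘ f) v (μ⁻¹ • Λ n) ↔ IsUnitNormal lam f v n := by
    intro n
    simp only [IsUnitNormal, ht', ← map_smul, hΦ.metric_map, metric_smul_left, metric_smul_right]
    refine and_congr (forall_congr' fun i => ?_) ?_
    · simp [hμ.ne']
    · field_simp
  have hH : ∀ n, IsUnitNormal lam f v n →
      meanCurv lam' (Φ ∘ f) v (μ⁻¹ • Λ n) = μ⁻¹ * meanCurv lam f v n := by
    intro n _
    have hg' : gram lam' (tangentVec (Φ ∘ f) 0 v) (tangentVec (Φ ∘ f) 1 v)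
        = μ ^ 4 * gram lam (tangentVec f 0 v) (tangentVec f 1 v) := by
      simp only [gram, ht', hΦ.metric_map]; ring
    have h1 := meanCurv_mul_gram lam f v n hgram
    have h2 := meanCurv_mul_gram lam' (Φ ∘ f) v (μ⁻¹ • Λ n)
      (by rw [hg']; exact mul_ne_zero (by positivity) hgram)
    rw [hg'] at h2
    simp only [secondForm, Matrix.of_apply, hcov, ht', metric_smul_right, hΦ.metric_map] at h1 h2
    apply mul_right_cancel₀ hgram
    apply mul_left_cancel₀ (pow_ne_zero 4 hμ.ne')
    linear_combination h2 - μ ^ 4 * μ⁻¹ * h1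
  constructor
  · intro H n hun
    have := H _ ((hn n).2 hun)
    rw [hH n hun, metric_smul_left] at this
    exact mul_left_cancel₀ (inv_ne_zero hμ.ne') this
  · intro H n' hn'
    obtain ⟨n, hn0⟩ := hΦ.surj (μ • n')
    have e : n' = μ⁻¹ • Λ n := by rw [hn0, smul_smul, inv_mul_cancel₀ hμ.ne', one_smul]
    rw [e] at hn' ⊢
    have hun := (hn n).1 hn'
    rw [hH n hun, metric_smul_left, H n hun]
    rfl

end FrameMap

/-! ### Local parametrizations of an immersed surface -/

namespace ImmersedSurface

variable (S : ImmersedSurface)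

theorem contDiffAt_localRep (q : S.carrier) {v : Plane} (hv : v ∈ (chartAt Plane q).target) :
    ContDiffAt ℝ ∞ (localRep S.toFun q) v := by
  have h : ContMDiffOn (𝓡 2) 𝓘(ℝ, Nil) ∞ (localRep S.toFun q) (chartAt Plane q).target :=
    S.smooth.comp_contMDiffOn (contMDiffOn_chart_symm (I := 𝓡 2) (n := ∞) (x := q))
  rw [contMDiffOn_iff_contDiffOn] at h
  exact h.contDiffAt ((chartAt Plane q).open_target.mem_nhds hv)

theorem injective_fderiv_localRep (q : S.carrier) {v : Plane}
    (hv : v ∈ (chartAt Plane q).target) :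
    Function.Injective (fderiv ℝ (localRep S.toFun q) v) := by
  have hc := (mdifferentiable_chart (I := 𝓡 2) q).symm
  have h1 := hc.mfderiv_injective (x := v) hv
  have h2 : MDifferentiableAt (𝓡 2) (𝓡 2) (chartAt Plane q).symm v := hc.mdifferentiableAt hv
  have h3 := S.immersion ((chartAt Plane q).symm v)
  rw [← mfderiv_eq_fderiv, localRep, mfderiv_comp v
    ((S.smooth.mdifferentiable (by simp)) _) h2]
  exact h3.comp h1

theorem localRep_chartAt (q : S.carrier) :
    localRep S.toFun q (chartAt Plane q q) = S.toFun q := by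
  simp [localRep]

/-- An immersed surface has local smooth retractions. -/
theorem exists_retraction (q : S.carrier) : ∃ r : Nil → Plane, ContDiffAt ℝ ∞ r (S.toFun q) ∧
    ∀ᶠ q' in 𝓝 q, r (S.toFun q') = chartAt Plane q q' := by
  set c := chartAt Plane q with hc
  have hq : q ∈ c.source := mem_chart_source Plane q
  have hv : c q ∈ c.target := c.map_source hq
  have hf := S.contDiffAt_localRep q hv
  have hi := S.injective_fderiv_localRep q hv
  set f := localRep S.toFun q with hfdef
  -- `L` is a linear left inverse of the derivative, so `L ∘ f` has the identity as derivative at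
  -- this point; its local inverse composed with `L` is the retraction.
  obtain ⟨L, hL⟩ := (fderiv ℝ f (c q)).toLinearMap.exists_leftInverse_of_injective
    (LinearMap.ker_eq_bot.2 hi)
  let L' : Nil →L[ℝ] Plane := LinearMap.toContinuousLinearMap L
  have hLf : ContDiffAt ℝ ∞ (L' ∘ f) (c q) := L'.contDiff.contDiffAt.comp _ hf
  have hd : HasFDerivAt (L' ∘ f) ((ContinuousLinearEquiv.refl ℝ Plane : Plane ≃L[ℝ] Plane) :
      Plane →L[ℝ] Plane) (c q) := by
    have := L'.hasFDerivAt.comp (c q) (hf.differentiableAt (by simp)).hasFDerivAt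
    refine this.congr_fderiv ?_
    ext1 w
    exact LinearMap.congr_fun hL w
  let e := hLf.toOpenPartialHomeomorph (L' ∘ f) hd (by simp)
  have he : (e : Plane → Plane) = L' ∘ f := rfl
  have hmem : c q ∈ e.source := hLf.mem_toOpenPartialHomeomorph_source hd (by simp)
  refine ⟨e.symm ∘ L', ?_, ?_⟩
  · refine ContDiffAt.comp _ ?_ L'.contDiff.contDiffAt
    have hs := hLf.to_localInverse hd (by simp)
    have hp : (L' ∘ f) (c q) = L' (S.toFun q) := by
      simp only [Function.comp, hfdef, hc, localRep_chartAt]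
    rw [← hp]
    exact hs
  · have h1 : ∀ᶠ q' in 𝓝 q, c q' ∈ e.source :=
      (c.continuousAt hq).eventually (e.open_source.mem_nhds hmem)
    filter_upwards [h1, c.open_source.mem_nhds hq] with q' h1 h2
    have h3 : f (c q') = S.toFun q' := by
      simp only [hfdef, localRep, Function.comp]
      rw [c.left_inv h2]
    have := e.left_inv h1
    rw [he] at this
    simp only [Function.comp] at this ⊢
    rw [← h3, this]

/-- A continuous lift to the surface of a smooth map is smooth. -/
theorem contDiffWithinAt_lift {E : Type*} [NormedAddCommGroup E] [NormedSpace ℝ E]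
    {ι : E → S.carrier} {g : E → Nil} {x : E} {s : Set E} (hx : x ∈ s)
    (hι : ContinuousWithinAt ι s x) (hg : ContDiffWithinAt ℝ ∞ g s x)
    (h : ∀ᶠ w in 𝓝[s] x, S.toFun (ι w) = g w) :
    ContDiffWithinAt ℝ ∞ (chartAt Plane (ι x) ∘ ι) s x := by
  obtain ⟨r, hr, hr'⟩ := S.exists_retraction (ι x)
  have hgx : S.toFun (ι x) = g x := h.self_of_nhdsWithin hx
  rw [hgx] at hr
  refine (hr.comp_contDiffWithinAt x hg).congr_of_eventuallyEq_of_mem ?_ hx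
  filter_upwards [hι.eventually hr', h] with w h1 h2
  simp only [Function.comp]
  rw [← h1, h2]

theorem contDiffAt_lift {E : Type*} [NormedAddCommGroup E] [NormedSpace ℝ E]
    {ι : E → S.carrier} {g : E → Nil} {x : E} (hι : ContinuousAt ι x) (hg : ContDiffAt ℝ ∞ g x)
    (h : ∀ᶠ w in 𝓝 x, S.toFun (ι w) = g w) :
    ContDiffAt ℝ ∞ (chartAt Plane (ι x) ∘ ι) x := by
  rw [← contDiffWithinAt_univ] at hg ⊢
  rw [← continuousWithinAt_univ] at hι
  rw [← nhdsWithin_univ] at h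
  exact S.contDiffWithinAt_lift (Set.mem_univ _) hι hg h

theorem eventuallyEq_localRep_lift {E : Type*} [TopologicalSpace E]
    {ι : E → S.carrier} {g : E → Nil} {x : E} (hι : ContinuousAt ι x)
    (h : ∀ᶠ w in 𝓝 x, S.toFun (ι w) = g w) :
    g =ᶠ[𝓝 x] localRep S.toFun (ι x) ∘ (chartAt Plane (ι x) ∘ ι) := by
  filter_upwards [h, hι.eventually ((chartAt Plane (ι x)).open_source.mem_nhds
    (mem_chart_source Plane (ι x)))] with w h1 h2
  simp only [localRep, Function.comp]
  rw [(chartAt Plane (ι x)).left_inv h2, h1]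

/-- The image of an immersed surface under a `FrameMap`. -/
def image {lam lam' μ : ℝ} {Φ : Nil → Nil} {Λ : (ℝ × ℝ × ℝ) →ₗ[ℝ] (ℝ × ℝ × ℝ)}
    (hΦ : FrameMap lam lam' μ Φ Λ) : ImmersedSurface where
  carrier := S.carrier
  toFun := Φ ∘ S.toFun
  smooth := hΦ.contDiff.contMDiff.comp S.smooth
  immersion q := by
    rw [mfderiv_comp q (hΦ.contDiff.contMDiff.mdifferentiable (by simp) _)
      (S.smooth.mdifferentiable (by simp) _), mfderiv_eq_fderiv]
    exact (hΦ.injective_fderiv _).comp (S.immersion q)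

end ImmersedSurface

/-! ### The isometries and homotheties in question -/

theorem frameMap_leftTrans (lam : ℝ) (p : Nil) :
    FrameMap lam lam 1 (leftTrans p) LinearMap.id where
  affine := by
    refine ⟨{ toFun := fun q => (q.1, q.2.1, q.2.2 + (p.1 * q.2.1 - q.1 * p.2.1) / 2)
              map_add' := fun a b => ?_
              map_smul' := fun r a => ?_ }, p, fun q => ?_, fun q w => ?_⟩
    all_goals refine Prod.ext ?_ (Prod.ext ?_ ?_) <;> simp [leftTrans, mul, frameComp] <;> ring
  conn_map _ _ := rfl
  metric_map _ _ := by simp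
  surj := Function.surjective_id
  pos := one_pos

/-- The rotation `rot u` as a linear map. -/
def rotLinear (u : ℝ) : (ℝ × ℝ × ℝ) →ₗ[ℝ] (ℝ × ℝ × ℝ) where
  toFun := rot u
  map_add' a b := by refine Prod.ext ?_ (Prod.ext ?_ ?_) <;> simp [rot] <;> ring
  map_smul' r a := by refine Prod.ext ?_ (Prod.ext ?_ ?_) <;> simp [rot] <;> ring

theorem rot_rot (u t : ℝ) (p : Nil) : rot u (rot t p) = rot (u + t) p := by
  refine Prod.ext ?_ (Prod.ext ?_ ?_) <;> simp [rot, Real.cos_add, Real.sin_add] <;> ring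

theorem rot_zero (p : Nil) : rot 0 p = p := by simp [rot]

theorem rot_mul (u : ℝ) (p q : Nil) : rot u (mul p q) = mul (rot u p) (rot u q) := by
  have h := Real.sin_sq_add_cos_sq u
  refine Prod.ext ?_ (Prod.ext ?_ ?_) <;> simp only [rot, mul]
  · ring
  · ring
  · linear_combination (-(p.1 * q.2.1 - q.1 * p.2.1) / 2) * h

theorem frameMap_rot (lam u : ℝ) : FrameMap lam lam 1 (rot u) (rotLinear u) where
  affine := by
    refine ⟨rotLinear u, 0, fun q => by simp [rotLinear], fun q w => ?_⟩
    have h := Real.sin_sq_add_cos_sq u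
    refine Prod.ext rfl (Prod.ext rfl ?_)
    simp only [frameComp, rotLinear, rot, LinearMap.coe_mk, AddHom.coe_mk]
    linear_combination ((q.2.1 * w.1 - q.1 * w.2.1) / 2) * h
  conn_map A B := by
    have h := Real.sin_sq_add_cos_sq u
    refine Prod.ext ?_ (Prod.ext ?_ ?_) <;>
      simp only [conn, rotLinear, rot, LinearMap.coe_mk, AddHom.coe_mk]
    · ring
    · ring
    · linear_combination ((A.1 * B.2.1 - A.2.1 * B.1) / 2) * h
  metric_map A B := by
    have h := Real.sin_sq_add_cos_sq u
    simp only [metric, rotLinear, rot, LinearMap.coe_mk, AddHom.coe_mk]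
    linear_combination (A.1 * B.1 + A.2.1 * B.2.1) * h
  surj A := ⟨rot (-u) A, by
    change rot u (rot (-u) A) = A
    rw [rot_rot, add_neg_cancel, rot_zero]⟩
  pos := one_pos

/-- The rescaling `rescale s` as a linear map. -/
def rescaleLinear (s : ℝ) : (ℝ × ℝ × ℝ) →ₗ[ℝ] (ℝ × ℝ × ℝ) where
  toFun := rescale s
  map_add' a b := by refine Prod.ext ?_ (Prod.ext ?_ ?_) <;> simp [rescale] <;> ring
  map_smul' r a := by refine Prod.ext ?_ (Prod.ext ?_ ?_) <;> simp [rescale] <;> ring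

/-- Horizontal lengths are multiplied by |s| and vertical components by ±s². Dividing `lam` by s²
turns the factor s⁴ of the vertical square into s², which makes the dilation a homothety. -/
theorem frameMap_rescale (lam : ℝ) {s : ℝ} (hs : s ≠ 0) :
    FrameMap lam (lam / s ^ 2) |s| (rescale s) (rescaleLinear s) where
  affine := by
    refine ⟨rescaleLinear s, 0, fun q => by simp [rescaleLinear], fun q w => ?_⟩
    refine Prod.ext rfl (Prod.ext rfl ?_)
    simp only [frameComp, rescaleLinear, rescale, LinearMap.coe_mk, AddHom.coe_mk]
    ring
  conn_map A B := by
    have h := sq_abs s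
    refine Prod.ext ?_ (Prod.ext ?_ ?_) <;>
      simp only [conn, rescaleLinear, rescale, LinearMap.coe_mk, AddHom.coe_mk]
    · field_simp
    · field_simp
      rw [h]
    · ring
  metric_map A B := by
    have h := sq_abs s
    simp only [metric, rescaleLinear, rescale, LinearMap.coe_mk, AddHom.coe_mk]
    field_simp
    rw [h]
    ring
  surj A := ⟨(A.1 / |s|, A.2.1 / s, A.2.2 / (|s| * s)), by
    refine Prod.ext ?_ (Prod.ext ?_ ?_) <;>
      (simp [rescaleLinear, rescale]; field_simp)⟩
  pos := abs_pos.2 hs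

theorem FrameMap.comp {lam lam' lam'' μ ν : ℝ} {Φ Ψ : Nil → Nil}
    {Λ Γ : (ℝ × ℝ × ℝ) →ₗ[ℝ] (ℝ × ℝ × ℝ)} (hΨ : FrameMap lam' lam'' ν Ψ Γ)
    (hΦ : FrameMap lam lam' μ Φ Λ) : FrameMap lam lam'' (ν * μ) (Ψ ∘ Φ) (Γ ∘ₗ Λ) where
  affine := by
    obtain ⟨D, b, h1, h2⟩ := hΦ.affine
    obtain ⟨D', b', h1', h2'⟩ := hΨ.affine
    refine ⟨D' ∘ₗ D, b' + D' b, fun p => ?_, fun p w => ?_⟩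
    · simp [h1', h1, add_assoc]
    · simp only [Function.comp, LinearMap.comp_apply, h2', h2]
  conn_map A B := by simp only [LinearMap.comp_apply, hΨ.conn_map, hΦ.conn_map]
  metric_map A B := by simp only [LinearMap.comp_apply, hΨ.metric_map, hΦ.metric_map]; ring
  surj := hΨ.surj.comp hΦ.surj
  pos := mul_pos hΨ.pos hΦ.pos

/-! ### The translator equation on an immersed surface -/

/-- The moving surfaces differ by left translations of the group generated by `V`. These are
isometries that fix the frame and preserve `V`, so the flow equation at every time is the one at
time zero. -/
theorem isTranslator_iff {lam : ℝ} (hlam : 0 < lam) (S : ImmersedSurface) (a : Nil) :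
    IsTranslator lam S.toFun a ↔
      ∀ q, TranslatorAt lam a (localRep S.toFun q) (chartAt Plane q q) := by
  have key : ∀ (t : ℝ) (q : S.carrier), (∀ n : ℝ × ℝ × ℝ,
      IsUnitNormal lam (localRep (leftTrans (t • a) ∘ S.toFun) q) (chartAt Plane q q) n →
      meanCurv lam (localRep (leftTrans (t • a) ∘ S.toFun) q) (chartAt Plane q q) n
        = metric lam n (frameComp ((leftTrans (t • a) ∘ S.toFun) q)
          (deriv (fun τ => (leftTrans (τ • a) ∘ S.toFun) q) t))) ↔
      TranslatorAt lam a (localRep S.toFun q) (chartAt Plane q q) := by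
    intro t q
    have hv : chartAt Plane q q ∈ (chartAt Plane q).target :=
      (chartAt Plane q).map_source (mem_chart_source Plane q)
    have hV : frameComp ((leftTrans (t • a) ∘ S.toFun) q)
        (deriv (fun τ => (leftTrans (τ • a) ∘ S.toFun) q) t)
        = killingField a (leftTrans (t • a) (S.toFun q)) := by
      have := (hasDerivAt_leftTrans a (S.toFun q) t).deriv
      simp only [Function.comp]
      rw [this, frameComp_ofFrame]
      rfl
    have hK : killingField a (leftTrans (t • a) (S.toFun q)) = killingField a (S.toFun q) := by
      simp only [killingField, leftTrans, mul, Prod.smul_fst, Prod.smul_snd, smul_eq_mul]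
      refine Prod.ext rfl (Prod.ext rfl ?_)
      simp only
      ring
    have h1 := (frameMap_leftTrans lam (t • a)).translatorAt_comp_iff hlam a
      (S.contDiffAt_localRep q hv) (S.injective_fderiv_localRep q hv)
    simp only [S.localRep_chartAt, LinearMap.id_apply] at h1
    rw [hV]
    unfold TranslatorAt at h1
    simp only [Function.comp_apply, S.localRep_chartAt] at h1
    refine Iff.trans h1 ?_
    rw [hK]
    simp only [TranslatorAt, S.localRep_chartAt]
  constructor
  · intro h q
    exact (key 0 q).1 (h 0 q)
  · intro h t q
    exact (key t q).2 (h q)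

/-- The translator equation holds in every local parametrization of a translator. -/
theorem IsTranslator.translatorAt {lam : ℝ} (hlam : 0 < lam) {S : ImmersedSurface} {a : Nil}
    (hS : IsTranslator lam S.toFun a) {ι : Plane → S.carrier} {f : Plane → Nil} {v : Plane}
    (hι : ContinuousAt ι v) (hf : ContDiffAt ℝ ∞ f v) (hfi : Function.Injective (fderiv ℝ f v))
    (h : ∀ᶠ w in 𝓝 v, S.toFun (ι w) = f w) : TranslatorAt lam a f v := by
  have hv : chartAt Plane (ι v) (ι v) ∈ (chartAt Plane (ι v)).target :=
    (chartAt Plane (ι v)).map_source (mem_chart_source Plane (ι v))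
  rw [translatorAt_comp hlam a (f := localRep S.toFun (ι v)) (κ := chartAt Plane (ι v) ∘ ι)
    (S.contDiffAt_localRep (ι v) hv) (S.contDiffAt_lift hι hf h) hfi
    (S.eventuallyEq_localRep_lift hι h)]
  exact (isTranslator_iff hlam S a).1 hS (ι v)

theorem IsTranslator.translatorAt_localRep {lam : ℝ} (hlam : 0 < lam) {S : ImmersedSurface}
    {a : Nil} (hS : IsTranslator lam S.toFun a) (q : S.carrier) {v : Plane}
    (hv : v ∈ (chartAt Plane q).target) : TranslatorAt lam a (localRep S.toFun q) v :=
  hS.translatorAt hlam ((chartAt Plane q).symm.continuousAt hv) (S.contDiffAt_localRep q hv)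
    (S.injective_fderiv_localRep q hv) (Filter.Eventually.of_forall fun _ => rfl)

/-- The velocity of a smooth curve in the surface is tangent to it. -/
theorem exists_fderiv_eq_of_lift {S : ImmersedSurface} (q : S.carrier) {v : Plane}
    (hv : v ∈ (chartAt Plane q).target) {ι : ℝ → S.carrier} {g : ℝ → Nil} {w : Nil}
    (h0 : ι 0 = (chartAt Plane q).symm v) (hι : ContinuousAt ι 0) (hg : ContDiffAt ℝ ∞ g 0)
    (h : ∀ᶠ u in 𝓝 0, S.toFun (ι u) = g u) (hw : HasDerivAt g w 0) :
    ∃ ζ : Plane, fderiv ℝ (localRep S.toFun q) v ζ = w := by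
  set c := chartAt Plane q
  set κ : ℝ → Plane := c ∘ ι
  have hsrc : ι 0 ∈ c.source := by rw [h0]; exact c.map_target hv
  have hκ0 : κ 0 = v := by simp only [κ, Function.comp, h0, c.right_inv hv]
  -- The lift is smooth when read in the chart at its own starting point; a transition map carries
  -- this to the chart at `q`.
  have hκ : DifferentiableAt ℝ κ 0 := by
    have h1 := (S.contDiffAt_lift hι hg h).differentiableAt (by simp)
    set c' := chartAt Plane (ι 0)
    have hv' : c' (ι 0) ∈ c'.target := c'.map_source (mem_chart_source Plane (ι 0))
    have h2 : ContMDiffAt (𝓡 2) (𝓡 2) ∞ (c ∘ c'.symm) (c' (ι 0)) := by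
      refine ContMDiffAt.comp (g := c) (f := c'.symm) (I' := 𝓡 2) (c' (ι 0)) ?_
        ((contMDiffOn_chart_symm (I := 𝓡 2) (n := ∞) (x := ι 0)).contMDiffAt
          (c'.open_target.mem_nhds hv'))
      rw [c'.left_inv (mem_chart_source Plane (ι 0))]
      exact (contMDiffOn_chart (I := 𝓡 2) (n := ∞) (x := q)).contMDiffAt
        (c.open_source.mem_nhds hsrc)
    rw [contMDiffAt_iff_contDiffAt] at h2
    refine ((h2.differentiableAt (by simp)).comp 0 h1).congr_of_eventuallyEq ?_
    filter_upwards [hι.eventually (c'.open_source.mem_nhds (mem_chart_source Plane (ι 0)))]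
      with u hu
    simp only [κ, Function.comp]
    rw [c'.left_inv hu]
  have hfd := (S.contDiffAt_localRep q hv).differentiableAt (by simp)
  rw [← hκ0] at hfd
  have := hfd.hasFDerivAt.comp_hasDerivAt 0 hκ.hasDerivAt
  rw [hκ0] at this
  refine ⟨_, HasDerivAt.unique (this.congr_of_eventuallyEq ?_) hw⟩
  filter_upwards [h, hι.eventually (c.open_source.mem_nhds hsrc)] with u h1 h2
  simp only [κ, localRep, Function.comp]
  change _ = S.toFun (c.symm (c (ι u)))
  rw [c.left_inv h2, h1]

theorem hasFDerivAt_fderiv_apply {E F : Type*} [NormedAddCommGroup E] [NormedSpace ℝ E]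
    [NormedAddCommGroup F] [NormedSpace ℝ F] {f : E → F} {v : E} (hf : ContDiffAt ℝ ∞ f v)
    (X : E) : HasFDerivAt (fun w => fderiv ℝ f w X)
      ((ContinuousLinearMap.apply ℝ F X).comp (fderiv ℝ (fderiv ℝ f) v)) v :=
  (ContinuousLinearMap.apply ℝ F X).hasFDerivAt.comp v
    ((hf.fderiv_right (m := ∞) (by simp)).differentiableAt (by simp)).hasFDerivAt

theorem fderiv_fderiv_comm {E F : Type*} [NormedAddCommGroup E] [NormedSpace ℝ E]
    [NormedAddCommGroup F] [NormedSpace ℝ F] {f : E → F} {v : E} (hf : ContDiffAt ℝ ∞ f v)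
    (X Y : E) : fderiv ℝ (fderiv ℝ f) v X Y = fderiv ℝ (fderiv ℝ f) v Y X :=
  hf.isSymmSndFDerivAt (by
    simp only [minSmoothness_of_isRCLikeNormedField]; exact WithTop.coe_le_coe.2 le_top) X Y

theorem exists_unitNormal {lam : ℝ} (hlam : 0 < lam) {f : Plane → Nil} {v : Plane}
    (hfi : Function.Injective (fderiv ℝ f v)) : ∃ n, IsUnitNormal lam f v n := by
  obtain ⟨m, hm, h0, h1⟩ := exists_normal lam hlam (gram_tangentVec_pos hlam hfi).ne'
  have hpos := metric_self_pos hlam hm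
  have hrr : √(metric lam m m) * √(metric lam m m) = metric lam m m :=
    Real.mul_self_sqrt hpos.le
  have hr0 : 0 < √(metric lam m m) := Real.sqrt_pos.2 hpos
  refine ⟨(√(metric lam m m))⁻¹ • m, fun i => ?_, ?_⟩
  · fin_cases i
    · simp [metric_smul_left, h0]
    · simp [metric_smul_left, h1]
  · rw [metric_smul_left, metric_smul_right]
    nth_rewrite 3 [← hrr]
    field_simp

theorem IsUnitNormal.metric_tangentAlong {lam : ℝ} {f : Plane → Nil} {v : Plane}
    {n : ℝ × ℝ × ℝ} (hn : IsUnitNormal lam f v n) (X : Plane) :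
    metric lam n (tangentAlong f v X) = 0 := by
  rw [plane_eq X, tangentAlong_add, tangentAlong_smul, tangentAlong_smul, metric_add_right,
    metric_smul_right, metric_smul_right]
  have h0 := hn.1 0
  have h1 := hn.1 1
  change metric lam n (tangentAlong f v _) = 0 at h0 h1
  rw [h0, h1]
  ring

/-! ### Invariance of g(n, V), and the obstruction for motions that rotate the frame -/

/-- On an invariant translator, the function `g(n, V)` is invariant. -/
theorem metric_killingField_of_invariant {lam : ℝ} (hlam : 0 < lam) {S : ImmersedSurface}
    {a : Nil} (hS : IsTranslator lam S.toFun a) {Φ : Nil → Nil}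
    {Λ : (ℝ × ℝ × ℝ) →ₗ[ℝ] (ℝ × ℝ × ℝ)} {μ : ℝ} (hΦ : FrameMap lam lam μ Φ Λ)
    {ψ : S.carrier → S.carrier} (hψ : Continuous ψ)
    (h : ∀ q, S.toFun (ψ q) = Φ (S.toFun q)) (q : S.carrier) {v : Plane}
    (hv : v ∈ (chartAt Plane q).target) {n : ℝ × ℝ × ℝ}
    (hn : IsUnitNormal lam (localRep S.toFun q) v n) :
    metric lam (Λ n) (killingField a (Φ (localRep S.toFun q v)))
      = metric lam n (killingField a (localRep S.toFun q v)) := by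
  have hf := S.contDiffAt_localRep q hv
  have hfi := S.injective_fderiv_localRep q hv
  -- Through `ψ`, the map `Φ ∘ f` is another local parametrization of the same translator.
  have h1 : TranslatorAt lam a (Φ ∘ localRep S.toFun q) v :=
    hS.translatorAt hlam (ι := ψ ∘ (chartAt Plane q).symm)
      (hψ.continuousAt.comp ((chartAt Plane q).symm.continuousAt hv))
      (hΦ.contDiff.contDiffAt.comp v hf)
      (hΦ.injective_fderiv_comp (hf.differentiableAt (by simp)) hfi)
      (Filter.Eventually.of_forall fun w => h _)
  rw [← (hΦ.translatorAt_comp_iff hlam a hf hfi).1 h1 n hn]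
  exact hS.translatorAt_localRep hlam q hv n hn

/-- A field of contact planes has no integral surface. -/
theorem not_tangent_contact {lam : ℝ} (hlam : 0 < lam) {f : Plane → Nil} {v : Plane}
    (hf : ContDiffAt ℝ ∞ f v) (hfi : ∀ᶠ w in 𝓝 v, Function.Injective (fderiv ℝ f w)) (c d : ℝ)
    (h : ∀ᶠ w in 𝓝 v, ∀ n, IsUnitNormal lam f w n →
      n.1 + lam * n.2.2 * ((f w).2.1 - d) = 0 ∧ n.2.1 - lam * n.2.2 * ((f w).1 - c) = 0) :
    False := by
  -- The hypothesis on the normals says that the form dz - (y/2 - d) dx + (x/2 - c) dy vanishes on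
  -- the surface.
  have key : ∀ᶠ w in 𝓝 v, ∀ X, (fderiv ℝ f w X).2.2
      = ((f w).2.1 / 2 - d) * (fderiv ℝ f w X).1
        - ((f w).1 / 2 - c) * (fderiv ℝ f w X).2.1 := by
    filter_upwards [hfi, h] with w hw hn X
    obtain ⟨n, hun⟩ := exists_unitNormal hlam hw
    obtain ⟨h1, h2⟩ := hn n hun
    have hn3 : n.2.2 ≠ 0 := by
      intro h3
      have := hun.2
      rw [h3] at h1 h2
      simp only [mul_zero, zero_mul, add_zero, sub_zero] at h1 h2
      simp [metric, h1, h2, h3] at this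
    have hX := hun.metric_tangentAlong X
    simp only [metric, tangentAlong, frameComp] at hX
    apply mul_left_cancel₀ (mul_ne_zero hlam.ne' hn3)
    linear_combination hX - (fderiv ℝ f w X).1 * h1 - (fderiv ℝ f w X).2.1 * h2
  have hfd := (hf.differentiableAt (by simp)).hasFDerivAt
  have hD : ∀ X Y, (fderiv ℝ (fderiv ℝ f) v Y X).2.2
      = ((f v).2.1 / 2 - d) * (fderiv ℝ (fderiv ℝ f) v Y X).1
        + (fderiv ℝ f v Y).2.1 / 2 * (fderiv ℝ f v X).1
        - (((f v).1 / 2 - c) * (fderiv ℝ (fderiv ℝ f) v Y X).2.1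
        + (fderiv ℝ f v Y).1 / 2 * (fderiv ℝ f v X).2.1) := by
    intro X Y
    have hG := hasFDerivAt_fderiv_apply hf X
    have hr := (((hfd.snd.fst.mul_const (1 / 2 : ℝ)).sub_const d).mul hG.fst).sub
      (((hfd.fst.mul_const (1 / 2 : ℝ)).sub_const c).mul hG.snd.fst)
    have he := hr.congr_of_eventuallyEq (f₁ := fun w => (fderiv ℝ f w X).2.2) (by
      filter_upwards [key] with w hw
      simp only [hw X, Pi.sub_apply, Pi.mul_apply]
      ring)
    have := congrArg (fun L => L Y) (hG.snd.snd.unique he)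
    simp at this
    rw [this]
    ring
  set e0 : Plane := EuclideanSpace.single 0 1
  set e1 : Plane := EuclideanSpace.single 1 1
  have h01 := hD e0 e1
  have h10 := hD e1 e0
  rw [fderiv_fderiv_comm hf e1 e0] at h01
  -- Symmetry of second derivatives, that is, d of the contact form restricted to the surface: dx ∧
  -- dy vanishes on the tangent plane. As dz is a combination of dx and dy there, the Gram
  -- determinant is zero.
  have hz : (fderiv ℝ f v e0).1 * (fderiv ℝ f v e1).2.1
      - (fderiv ℝ f v e0).2.1 * (fderiv ℝ f v e1).1 = 0 := by linarith
  refine (gram_tangentAlong_pos hlam hfi.self_of_nhds single_independent).ne' ?_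
  have k0 := key.self_of_nhds e0
  have k1 := key.self_of_nhds e1
  rw [gram_eq]
  simp only [tangentAlong, frameComp]
  change ((fderiv ℝ f v e0).1 * (fderiv ℝ f v e1).2.1
      - (fderiv ℝ f v e0).2.1 * (fderiv ℝ f v e1).1) ^ 2 + lam *
      (((fderiv ℝ f v e0).1 * ((fderiv ℝ f v e1).2.2 + _) - _) ^ 2 + _) = 0
  rw [k0, k1]
  set x0 := (fderiv ℝ f v e0).1
  set y0 := (fderiv ℝ f v e0).2.1
  set x1 := (fderiv ℝ f v e1).1
  set y1 := (fderiv ℝ f v e1).2.1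
  set x := (f v).1
  set y := (f v).2.1
  linear_combination (x0 * y1 - y0 * x1) * hz + lam * ((x - c) ^ 2 + (y - d) ^ 2)
    * (x0 * y1 - y0 * x1) * hz

/-- The values at 2π, π and π/2 suffice: the first kills `C`, the second `A`, the third `B`. -/
theorem eq_zero_of_affine_trigonometric {A B C : ℝ}
    (h : ∀ u : ℝ, A * Real.cos u + B * Real.sin u + C * u = A) : A = 0 ∧ B = 0 := by
  have h1 := h (2 * Real.pi)
  have h2 := h Real.pi
  have h3 := h (Real.pi / 2)
  simp at h1 h2 h3
  have hC : C = 0 := h1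
  subst hC
  simp at h2 h3
  have hA : A = 0 := by linarith
  exact ⟨hA, by linarith⟩

/-- A translator is not invariant under motions that rotate the frame. -/
theorem not_invariant_of_rotating {lam : ℝ} (hlam : 0 < lam) {a : Nil}
    (ha : (a.1, a.2.1) ≠ (0, 0)) {S : ImmersedSurface} (hS : IsTranslator lam S.toFun a)
    {φ : ℝ → Nil → Nil} (hφ : ∀ u, FrameMap lam lam 1 (φ u) (rotLinear u)) (b c d : ℝ)
    (hp : ∀ u p, a.1 * (φ u p).2.1 - a.2.1 * (φ u p).1 = b * u
      + a.1 * (d + (p.1 - c) * Real.sin u + (p.2.1 - d) * Real.cos u)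
      - a.2.1 * (c + (p.1 - c) * Real.cos u - (p.2.1 - d) * Real.sin u)) :
    ¬ InvariantUnder S.toFun φ := by
  rintro ⟨ψ, hψ, -, hψF⟩
  obtain ⟨q⟩ := S.nonempty
  have hq : chartAt Plane q q ∈ (chartAt Plane q).target :=
    (chartAt Plane q).map_source (mem_chart_source Plane q)
  have hnhds := (chartAt Plane q).open_target.mem_nhds hq
  refine not_tangent_contact hlam (S.contDiffAt_localRep q hq)
    (Filter.mem_of_superset hnhds fun w hw => S.injective_fderiv_localRep q hw) c d
    (Filter.mem_of_superset hnhds fun w hw n hn => ?_)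
  set p := localRep S.toFun q w
  have key : ∀ u, metric lam (rotLinear u n) (killingField a (φ u p))
      = metric lam n (killingField a p) := fun u =>
    metric_killingField_of_invariant hlam hS (hφ u)
      (hψ.comp (continuous_const.prodMk continuous_id)) (hψF u) q hw hn
  have hp0 := hp 0 p
  -- These are the coefficients of cos u, sin u and u in the difference of `key u` and `key 0`. The
  -- vanishing of the first two is a linear system for the two contact quantities, with determinant
  -- a₁² + a₂² up to sign.
  obtain ⟨hA, hB⟩ := eq_zero_of_affine_trigonometric
    (A := a.1 * (n.1 + lam * n.2.2 * (p.2.1 - d)) + a.2.1 * (n.2.1 - lam * n.2.2 * (p.1 - c)))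
    (B := -a.1 * (n.2.1 - lam * n.2.2 * (p.1 - c)) + a.2.1 * (n.1 + lam * n.2.2 * (p.2.1 - d)))
    (C := lam * n.2.2 * b) (fun u => by
      have k1 := key u
      have k2 := key 0
      have h1 := hp u p
      simp only [metric, killingField, rotLinear, rot, LinearMap.coe_mk, AddHom.coe_mk,
        Real.cos_zero, Real.sin_zero] at k1 k2 h1 hp0
      linear_combination k1 - k2 - lam * n.2.2 * h1 + lam * n.2.2 * hp0)
  have hpos : a.1 ^ 2 + a.2.1 ^ 2 ≠ 0 := by
    intro h0
    apply ha
    have h1 : a.1 = 0 := by nlinarith [sq_nonneg a.1, sq_nonneg a.2.1]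
    have h2 : a.2.1 = 0 := by nlinarith [sq_nonneg a.1, sq_nonneg a.2.1]
    rw [h1, h2]
  constructor <;> apply mul_left_cancel₀ hpos
  · linear_combination a.1 * hA + a.2.1 * hB
  · linear_combination a.2.1 * hA - a.1 * hB

theorem not_invariant_helicoidalMotion {lam : ℝ} (hlam : 0 < lam) {a : Nil}
    (ha : (a.1, a.2.1) ≠ (0, 0)) {S : ImmersedSurface} (hS : IsTranslator lam S.toFun a)
    (p : Nil) : ¬ InvariantUnder S.toFun (helicoidalMotion p) := by
  refine not_invariant_of_rotating hlam ha hS (fun u => ?_) (a.1 * p.2.1 - a.2.1 * p.1) 0 0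
    fun u q => ?_
  · simpa [helicoidalMotion] using (frameMap_leftTrans lam (u • p)).comp (frameMap_rot lam u)
  · simp [helicoidalMotion, leftTrans, mul, rot]
    ring

/-- Conjugation by `leftTrans q` moves the centre of the plane rotation to the projection of `q`.
The pitch plays no role, since the frame components of `V` do not depend on z; hence there is no
drift term. -/
theorem not_invariant_screwGroup {lam : ℝ} (hlam : 0 < lam) {a : Nil}
    (ha : (a.1, a.2.1) ≠ (0, 0)) {S : ImmersedSurface} (hS : IsTranslator lam S.toFun a)
    (q : Nil) (c : ℝ) : ¬ InvariantUnder S.toFun (screwGroup q c) := by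
  refine not_invariant_of_rotating hlam ha hS (fun u => ?_) 0 q.1 q.2.1 fun u p => ?_
  · simpa [screwGroup, helicoidalMotion] using (frameMap_leftTrans lam q).comp
      (((frameMap_leftTrans lam (u • ((0, 0, c) : Nil))).comp (frameMap_rot lam u)).comp
        (frameMap_leftTrans lam (inv q)))
  · simp [screwGroup, helicoidalMotion, leftTrans, mul, rot, inv]
    ring

theorem not_invariant_rot {lam : ℝ} (hlam : 0 < lam) {a : Nil}
    (ha : (a.1, a.2.1) ≠ (0, 0)) {S : ImmersedSurface} (hS : IsTranslator lam S.toFun a) :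
    ¬ InvariantUnder S.toFun rot := by
  refine not_invariant_of_rotating hlam ha hS (frameMap_rot lam) 0 0 0 fun u p => ?_
  simp [rot]

/-! ### Vertical surfaces -/

/-- If `∂z` is tangent to a surface, the projection to the plane has rank at most one. -/
theorem rank_le_one_of_vertical {f : Plane → Nil} {w ζ : Plane}
    (hζ : fderiv ℝ f w ζ = (0, 0, 1)) (X Y : Plane) :
    (fderiv ℝ f w X).1 * (fderiv ℝ f w Y).2.1 - (fderiv ℝ f w Y).1 * (fderiv ℝ f w X).2.1 = 0 := by
  have hζ0 : ζ ≠ 0 := by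
    rintro rfl
    rw [map_zero] at hζ
    exact zero_ne_one (congrArg (fun p : Nil => p.2.2) hζ)
  set e0 : Plane := EuclideanSpace.single 0 1 with he0
  set e1 : Plane := EuclideanSpace.single 1 1 with he1
  have hex : ∀ U : Plane, fderiv ℝ f w U = U 0 • fderiv ℝ f w e0 + U 1 • fderiv ℝ f w e1 := by
    intro U
    conv_lhs => rw [plane_eq U]
    rw [map_add, map_smul, map_smul]
  have h := hζ
  rw [hex] at h
  have h1 := congrArg (fun p : Nil => p.1) h
  have h2 := congrArg (fun p : Nil => p.2.1) h
  simp only [Prod.fst_add, Prod.snd_add, Prod.smul_fst, Prod.smul_snd, smul_eq_mul] at h1 h2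
  have hdet : (fderiv ℝ f w e0).1 * (fderiv ℝ f w e1).2.1
      - (fderiv ℝ f w e1).1 * (fderiv ℝ f w e0).2.1 = 0 := by
    by_contra hne
    apply hζ0
    rw [plane_eq ζ]
    have z0 : ζ 0 = 0 := by
      apply (mul_eq_zero.1 (_ : ζ 0 * _ = 0)).resolve_right hne
      linear_combination (fderiv ℝ f w e1).2.1 * h1 - (fderiv ℝ f w e1).1 * h2
    have z1 : ζ 1 = 0 := by
      apply (mul_eq_zero.1 (_ : ζ 1 * _ = 0)).resolve_right hne
      linear_combination (fderiv ℝ f w e0).1 * h2 - (fderiv ℝ f w e0).2.1 * h1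
    simp [z0, z1]
  rw [hex X, hex Y]
  simp only [Prod.fst_add, Prod.snd_add, Prod.smul_fst, Prod.smul_snd, smul_eq_mul]
  linear_combination (X 0 * Y 1 - X 1 * Y 0) * hdet

/-- Differentiate the rank condition for the constant vectors `ζ` and `Y`; the horizontal part of
the image of `ζ` vanishes at `v`. Mixed second derivatives with `ζ` are thus horizontally parallel
to the section and do not bend it. -/
theorem second_rank_of_vertical {f : Plane → Nil} {v ζ : Plane} (hf : ContDiffAt ℝ ∞ f v)
    (hvert : ∀ᶠ w in 𝓝 v, ∃ ζ, fderiv ℝ f w ζ = (0, 0, 1)) (hζ : fderiv ℝ f v ζ = (0, 0, 1))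
    (X Y : Plane) :
    (fderiv ℝ (fderiv ℝ f) v X ζ).1 * (fderiv ℝ f v Y).2.1
      - (fderiv ℝ f v Y).1 * (fderiv ℝ (fderiv ℝ f) v X ζ).2.1 = 0 := by
  have hG := hasFDerivAt_fderiv_apply hf ζ
  have hH := hasFDerivAt_fderiv_apply hf Y
  have h1 := (hG.fst.mul hH.snd.fst).sub (hH.fst.mul hG.snd.fst)
  have h2 := (hasFDerivAt_const (𝕜 := ℝ) (0 : ℝ) v).congr_of_eventuallyEq
    (f₁ := fun w => (fderiv ℝ f w ζ).1 * (fderiv ℝ f w Y).2.1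
      - (fderiv ℝ f w Y).1 * (fderiv ℝ f w ζ).2.1) (by
    filter_upwards [hvert] with w hw
    obtain ⟨ζ', hζ'⟩ := hw
    exact rank_le_one_of_vertical hζ' ζ Y)
  have := congrArg (fun L : Plane →L[ℝ] ℝ => L X) (h1.unique h2)
  simp [hζ] at this
  linarith

/-- In the orthogonal tangent basis formed by the horizontal part of `X` and by Z, the cross term is
absent, the symmetric connection vanishes on both diagonal entries, and the normal is horizontal.
Second derivatives involving `ζ` drop out, and `lam` remains as a common factor: this is why the
solutions do not depend on it. -/
theorem translatorAt_vertical_iff_of_ne {lam : ℝ} (hlam : 0 < lam) (a : Nil) {f : Plane → Nil}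
    {v : Plane} (hf : ContDiffAt ℝ ∞ f v)
    (hvert : ∀ᶠ w in 𝓝 v, ∃ ζ, fderiv ℝ f w ζ = (0, 0, 1)) {X : Plane}
    (hX : (fderiv ℝ f v X).1 ^ 2 + (fderiv ℝ f v X).2.1 ^ 2 ≠ 0) :
    TranslatorAt lam a f v ↔
      (fderiv ℝ f v X).1 * (fderiv ℝ (fderiv ℝ f) v X X).2.1
        - (fderiv ℝ f v X).2.1 * (fderiv ℝ (fderiv ℝ f) v X X).1
      = ((fderiv ℝ f v X).1 ^ 2 + (fderiv ℝ f v X).2.1 ^ 2)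
        * ((fderiv ℝ f v X).1 * a.2.1 - (fderiv ℝ f v X).2.1 * a.1) := by
  obtain ⟨ζ, hζ⟩ := hvert.self_of_nhds
  have hE1 := second_rank_of_vertical hf hvert hζ X X
  have hE2 := second_rank_of_vertical hf hvert hζ ζ X
  have hs := fderiv_fderiv_comm hf ζ X
  set α := (fderiv ℝ f v X).1 with hα
  set β := (fderiv ℝ f v X).2.1 with hβ
  set γ := (tangentAlong f v X).2.2 with hγ
  have hZ : tangentAlong f v ζ = (0, 0, 1) := by simp [tangentAlong, hζ, frameComp]
  have hA : tangentAlong f v (X - γ • ζ) = (α, β, 0) := by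
    rw [sub_eq_add_neg, ← neg_smul, tangentAlong_add, tangentAlong_smul, hZ]
    refine Prod.ext ?_ (Prod.ext ?_ ?_)
    · simp [tangentAlong, frameComp, hα]
    · simp [tangentAlong, frameComp, hβ]
    · simp [hγ]
  have hgram : gram lam (tangentAlong f v (X - γ • ζ)) (tangentAlong f v ζ)
      = (α ^ 2 + β ^ 2) * lam := by
    rw [hA, hZ]; simp only [gram, metric]; ring
  have hg0 : (α ^ 2 + β ^ 2) * lam ≠ 0 := mul_ne_zero hX hlam.ne'
  rw [translatorAt_iff_along hlam a hf (by rw [hgram]; exact hg0), hgram]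
  have hsec : ∀ m : ℝ × ℝ × ℝ, m.2.2 = 0 →
      secondAlong lam f v m (X - γ • ζ) (X - γ • ζ)
        = m.1 * ((fderiv ℝ (fderiv ℝ f) v X X).1 - 2 * γ * (fderiv ℝ (fderiv ℝ f) v X ζ).1
            + γ ^ 2 * (fderiv ℝ (fderiv ℝ f) v ζ ζ).1)
          + m.2.1 * ((fderiv ℝ (fderiv ℝ f) v X X).2.1
            - 2 * γ * (fderiv ℝ (fderiv ℝ f) v X ζ).2.1
            + γ ^ 2 * (fderiv ℝ (fderiv ℝ f) v ζ ζ).2.1) := by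
    intro m hm
    simp only [secondAlong, hA, map_sub, map_smul, sub_apply, smul_apply, hs, metric, symmConn,
      frameComp, hm, Prod.fst_add, Prod.snd_add, Prod.fst_sub, Prod.snd_sub, Prod.smul_fst,
      Prod.smul_snd, smul_eq_mul]
    ring
  have hsecζ : ∀ m : ℝ × ℝ × ℝ, m.2.2 = 0 → secondAlong lam f v m ζ ζ
      = m.1 * (fderiv ℝ (fderiv ℝ f) v ζ ζ).1 + m.2.1 * (fderiv ℝ (fderiv ℝ f) v ζ ζ).2.1 := by
    intro m hm
    simp only [secondAlong, hZ, metric, symmConn, frameComp, hm, Prod.fst_add, Prod.snd_add]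
    ring
  rw [hA, hZ]
  constructor
  · intro H
    have := H (-β, α, 0) (by simp [metric]; ring) (by simp [metric])
    rw [hsec _ rfl, hsecζ _ rfl] at this
    simp [metric, killingField] at this
    apply mul_left_cancel₀ hlam.ne'
    linear_combination this - 2 * γ * lam * hE1
      + (lam * γ ^ 2 + (α ^ 2 + β ^ 2)) * hE2
  · rintro H ⟨m1, m2, m3⟩ h1 h2
    have hm3 : m3 = 0 := by
      simp [metric] at h2
      exact h2.resolve_left hlam.ne'
    subst hm3
    simp [metric] at h1
    rw [hsec _ rfl, hsecζ _ rfl]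
    simp only [metric, killingField, mul_zero, zero_mul, add_zero, mul_one, zero_add]
    have e1 : (α ^ 2 + β ^ 2) * m1 = -β * (m2 * α - m1 * β) := by linear_combination α * h1
    have e2 : (α ^ 2 + β ^ 2) * m2 = α * (m2 * α - m1 * β) := by linear_combination β * h1
    apply mul_left_cancel₀ hX
    set x2 := (fderiv ℝ (fderiv ℝ f) v X X).1
    set y2 := (fderiv ℝ (fderiv ℝ f) v X X).2.1
    set xm := (fderiv ℝ (fderiv ℝ f) v X ζ).1
    set ym := (fderiv ℝ (fderiv ℝ f) v X ζ).2.1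
    set xz := (fderiv ℝ (fderiv ℝ f) v ζ ζ).1
    set yz := (fderiv ℝ (fderiv ℝ f) v ζ ζ).2.1
    linear_combination (lam * (x2 - 2 * γ * xm + γ ^ 2 * xz) + (α ^ 2 + β ^ 2) * xz
        - (α ^ 2 + β ^ 2) * lam * a.1) * e1
      + (lam * (y2 - 2 * γ * ym + γ ^ 2 * yz) + (α ^ 2 + β ^ 2) * yz
        - (α ^ 2 + β ^ 2) * lam * a.2.1) * e2
      + (m2 * α - m1 * β) * lam * H
      + (m2 * α - m1 * β) * (2 * γ * lam * hE1 - (lam * γ ^ 2 + (α ^ 2 + β ^ 2)) * hE2)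

/-- There are non-vertical tangent vectors. -/
theorem exists_not_vertical {f : Plane → Nil} {v : Plane}
    (hfi : Function.Injective (fderiv ℝ f v)) :
    (fderiv ℝ f v (EuclideanSpace.single 0 1)).1 ^ 2
        + (fderiv ℝ f v (EuclideanSpace.single 0 1)).2.1 ^ 2 ≠ 0 ∨
      (fderiv ℝ f v (EuclideanSpace.single 1 1)).1 ^ 2
        + (fderiv ℝ f v (EuclideanSpace.single 1 1)).2.1 ^ 2 ≠ 0 := by
  by_contra! h
  have hz : ∀ x y : ℝ, x ^ 2 + y ^ 2 = 0 → x = 0 ∧ y = 0 := by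
    intro x y h
    constructor <;> nlinarith [sq_nonneg x, sq_nonneg y]
  obtain ⟨h0, h1⟩ := h
  obtain ⟨h00, h01⟩ := hz _ _ h0
  obtain ⟨h10, h11⟩ := hz _ _ h1
  have hpos := (gram_tangentAlong_pos one_pos hfi single_independent).ne'
  rw [gram_eq] at hpos
  simp [tangentAlong, frameComp, h00, h01, h10, h11] at hpos

/-- The translator equation of a vertical surface is the one of its horizontal section. -/
theorem translatorAt_vertical_iff {lam : ℝ} (hlam : 0 < lam) (a : Nil) {f : Plane → Nil}
    {v : Plane} (hf : ContDiffAt ℝ ∞ f v) (hfi : Function.Injective (fderiv ℝ f v))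
    (hvert : ∀ᶠ w in 𝓝 v, ∃ ζ, fderiv ℝ f w ζ = (0, 0, 1)) :
    TranslatorAt lam a f v ↔ ∀ X,
      (fderiv ℝ f v X).1 * (fderiv ℝ (fderiv ℝ f) v X X).2.1
        - (fderiv ℝ f v X).2.1 * (fderiv ℝ (fderiv ℝ f) v X X).1
      = ((fderiv ℝ f v X).1 ^ 2 + (fderiv ℝ f v X).2.1 ^ 2)
        * ((fderiv ℝ f v X).1 * a.2.1 - (fderiv ℝ f v X).2.1 * a.1) := by
  constructor
  · intro H X
    by_cases hX : (fderiv ℝ f v X).1 ^ 2 + (fderiv ℝ f v X).2.1 ^ 2 = 0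
    · have h1 : (fderiv ℝ f v X).1 = 0 := by
        nlinarith [sq_nonneg (fderiv ℝ f v X).1, sq_nonneg (fderiv ℝ f v X).2.1]
      have h2 : (fderiv ℝ f v X).2.1 = 0 := by
        nlinarith [sq_nonneg (fderiv ℝ f v X).1, sq_nonneg (fderiv ℝ f v X).2.1]
      rw [h1, h2]; ring
    · exact (translatorAt_vertical_iff_of_ne hlam a hf hvert hX).1 H
  · intro H
    rcases exists_not_vertical hfi with h | h
    · exact (translatorAt_vertical_iff_of_ne hlam a hf hvert h).2 (H _)
    · exact (translatorAt_vertical_iff_of_ne hlam a hf hvert h).2 (H _)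

/-- A surface that is invariant under vertical translations is vertical. -/
theorem exists_fderiv_eq_vertical {S : ImmersedSurface}
    (hS : InvariantUnder S.toFun (transGroup (0, 0, 1))) (q : S.carrier) {v : Plane}
    (hv : v ∈ (chartAt Plane q).target) :
    ∃ ζ, fderiv ℝ (localRep S.toFun q) v ζ = (0, 0, 1) := by
  obtain ⟨ψ, hψ, hψ0, hψF⟩ := hS
  set q' := (chartAt Plane q).symm v
  have hg : ∀ u : ℝ, transGroup (0, 0, 1) u (S.toFun q')
      = S.toFun q' + u • ((0, 0, 1) : Nil) := by
    intro u
    refine Prod.ext ?_ (Prod.ext ?_ ?_) <;> simp [transGroup, leftTrans, mul, add_comm]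
  refine exists_fderiv_eq_of_lift q hv (ι := fun u => ψ u q')
    (g := fun u => S.toFun q' + u • ((0, 0, 1) : Nil)) (hψ0 q') ?_ ?_ ?_ ?_
  · exact (hψ.comp (continuous_id.prodMk continuous_const)).continuousAt
  · fun_prop
  · exact Filter.Eventually.of_forall fun u => by rw [hψF, hg]
  · simpa using ((hasDerivAt_id (0 : ℝ)).smul_const ((0, 0, 1) : Nil)).const_add (S.toFun q')

/-! ### Vertical translators are developed to planes by the complex exponential -/

/-- The complex coordinate `(a₁ x + a₂ y) + i (a₁ y - a₂ x)`. -/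
def planeCoord (a : Nil) : Nil →L[ℝ] ℂ :=
  LinearMap.toContinuousLinearMap
    { toFun := fun p => ⟨a.1 * p.1 + a.2.1 * p.2.1, a.1 * p.2.1 - a.2.1 * p.1⟩
      map_add' := fun p q => by
        apply Complex.ext <;> simp <;> ring
      map_smul' := fun r p => by
        apply Complex.ext <;> simp <;> ring }

theorem planeCoord_re (a p : Nil) : (planeCoord a p).re = a.1 * p.1 + a.2.1 * p.2.1 := rfl

theorem planeCoord_im (a p : Nil) : (planeCoord a p).im = a.1 * p.2.1 - a.2.1 * p.1 := rfl

theorem eventually_eq_of_hasFDerivAt_zero {g : Plane → ℂ} {v : Plane}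
    (h : ∀ᶠ w in 𝓝 v, HasFDerivAt g (0 : Plane →L[ℝ] ℂ) w) : ∀ᶠ w in 𝓝 v, g w = g v := by
  obtain ⟨ε, hε, hball⟩ := Metric.eventually_nhds_iff_ball.1 h
  filter_upwards [Metric.ball_mem_nhds v hε] with w hw
  exact Metric.isOpen_ball.is_const_of_fderiv_eq_zero (𝕜 := ℝ)
    (convex_ball v ε).isPreconnected
    (fun x hx => (hball x hx).differentiableAt.differentiableWithinAt)
    (fun x hx => (hball x hx).fderiv) hw (Metric.mem_ball_self hε)

/-- A function whose derivative is proportional to it has constant direction. -/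
theorem eventually_div_conj_eq {G : Plane → ℂ} {v : Plane} (hG0 : ∀ᶠ w in 𝓝 v, G w ≠ 0)
    (hG : ∀ᶠ w in 𝓝 v, ∃ G' : Plane →L[ℝ] ℂ, HasFDerivAt G G' w ∧
      ∀ Y, (G' Y * conj (G w)).im = 0) :
    ∀ᶠ w in 𝓝 v, G w / conj (G w) = G v / conj (G v) := by
  apply eventually_eq_of_hasFDerivAt_zero
  filter_upwards [hG0, hG] with w h0 ⟨G', hG', him⟩
  have hc0 : conj (G w) ≠ 0 := (map_ne_zero _).2 h0
  have hc : HasFDerivAt (fun w => conj (G w)) ((Complex.conjCLE : ℂ →L[ℝ] ℂ).comp G') w :=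
    (Complex.conjCLE : ℂ →L[ℝ] ℂ).hasFDerivAt.comp w hG'
  have hinv := (hasFDerivAt_inv' (𝕜 := ℝ) hc0).comp w hc
  have hq := hG'.mul hinv
  refine HasFDerivAt.congr_fderiv (f' := _) (hq.congr_of_eventuallyEq
    (Filter.Eventually.of_forall fun w => by simp [div_eq_mul_inv])) ?_
  ext1 Y
  have h1 : G' Y * conj (G w) = conj (G' Y) * G w := by
    have := Complex.conj_eq_iff_im.2 (him Y)
    rw [map_mul, Complex.conj_conj] at this
    exact this.symm
  simp
  field_simp
  linear_combination h1

theorem exists_eq_smul_add_smul {f : Plane → Nil} {w ζ e : Plane}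
    (hfi : Function.Injective (fderiv ℝ f w)) (hζ : fderiv ℝ f w ζ = (0, 0, 1))
    (he : (fderiv ℝ f w e).1 ^ 2 + (fderiv ℝ f w e).2.1 ^ 2 ≠ 0) (Y : Plane) :
    ∃ r t : ℝ, Y = r • e + t • ζ := by
  have hr := rank_le_one_of_vertical hζ Y e
  -- The coefficient of the orthogonal projection to the horizontal part of `e`; by the rank
  -- condition the remainder is vertical.
  set r := ((fderiv ℝ f w Y).1 * (fderiv ℝ f w e).1 + (fderiv ℝ f w Y).2.1 * (fderiv ℝ f w e).2.1)
    / ((fderiv ℝ f w e).1 ^ 2 + (fderiv ℝ f w e).2.1 ^ 2) with hrdef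
  refine ⟨r, (fderiv ℝ f w (Y - r • e)).2.2, hfi ?_⟩
  rw [map_add, map_smul, map_smul, hζ, map_sub, map_smul]
  refine Prod.ext ?_ (Prod.ext ?_ ?_)
  · simp [hrdef]
    field_simp
    linear_combination (fderiv ℝ f w e).2.1 * hr
  · simp [hrdef]
    field_simp
    linear_combination -(fderiv ℝ f w e).1 * hr
  · simp

/-- With T = exp ζ and G its derivative along `e`, the translator equation says that dG is a real
multiple of G. So Q = G / conj G is locally constant, and then so is T - Q conj T: the image of T
lies on a straight line. -/
theorem eventually_line {lam : ℝ} (hlam : 0 < lam) {a : Nil} (ha : a.1 ^ 2 + a.2.1 ^ 2 ≠ 0)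
    {f : Plane → Nil} {v : Plane} (hf : ∀ᶠ w in 𝓝 v, ContDiffAt ℝ ∞ f w)
    (hfi : ∀ᶠ w in 𝓝 v, Function.Injective (fderiv ℝ f w))
    (hvert : ∀ᶠ w in 𝓝 v, ∃ ζ, fderiv ℝ f w ζ = (0, 0, 1))
    (hT : ∀ᶠ w in 𝓝 v, TranslatorAt lam a f w) :
    ∃ Q K : ℂ, Q * conj Q = 1 ∧ ∀ᶠ w in 𝓝 v, Complex.exp (planeCoord a (f w))
      = Q * conj (Complex.exp (planeCoord a (f w))) + K := by
  obtain ⟨e, he⟩ : ∃ e, (fderiv ℝ f v e).1 ^ 2 + (fderiv ℝ f v e).2.1 ^ 2 ≠ 0 := by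
    rcases exists_not_vertical hfi.self_of_nhds with h | h
    exacts [⟨_, h⟩, ⟨_, h⟩]
  have he' : ∀ᶠ w in 𝓝 v, (fderiv ℝ f w e).1 ^ 2 + (fderiv ℝ f w e).2.1 ^ 2 ≠ 0 := by
    have hc := (hasFDerivAt_fderiv_apply hf.self_of_nhds e).continuousAt
    exact ContinuousAt.eventually_ne (by fun_prop) he
  set T : Plane → ℂ := fun w => Complex.exp (planeCoord a (f w)) with hTdef
  have hTd : ∀ᶠ w in 𝓝 v, HasFDerivAt T (T w • (planeCoord a).comp (fderiv ℝ f w)) w := by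
    filter_upwards [hf] with w hw
    exact ((planeCoord a).hasFDerivAt.comp w
      (hw.differentiableAt (by simp)).hasFDerivAt).cexp
  set G : Plane → ℂ := fun w => T w * planeCoord a (fderiv ℝ f w e) with hGdef
  have hnorm : ∀ w,
      ((planeCoord a (fderiv ℝ f w e)).re ^ 2 + (planeCoord a (fderiv ℝ f w e)).im ^ 2)
      = (a.1 ^ 2 + a.2.1 ^ 2) * ((fderiv ℝ f w e).1 ^ 2 + (fderiv ℝ f w e).2.1 ^ 2) := by
    intro w
    rw [planeCoord_re, planeCoord_im]; ring
  have hG0 : ∀ᶠ w in 𝓝 v, G w ≠ 0 := by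
    filter_upwards [he'] with w hw
    refine mul_ne_zero (Complex.exp_ne_zero _) fun h0 => ?_
    have := hnorm w
    rw [h0] at this
    simp at this
    rcases this with h | h
    exacts [ha h, hw h]
  have hG : ∀ᶠ w in 𝓝 v, ∃ G' : Plane →L[ℝ] ℂ, HasFDerivAt G G' w ∧
      ∀ Y, (G' Y * conj (G w)).im = 0 := by
    filter_upwards [hTd, hf, hfi, eventually_eventually_nhds.2 hvert, hT, he']
      with w hTw hfw hfiw hvw hTrw hew
    refine ⟨_, hTw.mul ((planeCoord a).hasFDerivAt.comp w (hasFDerivAt_fderiv_apply hfw e)),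
      fun Y => ?_⟩
    obtain ⟨ζ, hζ⟩ := hvw.self_of_nhds
    obtain ⟨r, t, rfl⟩ := exists_eq_smul_add_smul hfiw hζ hew Y
    have k1 := (translatorAt_vertical_iff hlam a hfw hfiw hvw).1 hTrw e
    have k2 := second_rank_of_vertical hfw hvw hζ e e
    have hz : planeCoord a ((0, 0, 1) : Nil) = 0 := by
      apply Complex.ext <;> simp [planeCoord_re, planeCoord_im]
    have hs := fderiv_fderiv_comm hfw ζ e
    simp only [hGdef, ContinuousLinearMap.comp_apply, add_apply, smul_apply,
      map_add, map_smul, hζ, hz, hs, ContinuousLinearMap.apply_apply, smul_eq_mul, map_mul,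
      Complex.real_smul, mul_zero, add_zero]
    set D := fderiv ℝ f w e
    set D2 := fderiv ℝ (fderiv ℝ f) w e e
    set Dζ := fderiv ℝ (fderiv ℝ f) w e ζ
    -- The planar translator equation in complex form: Im(ζ'' conj ζ') = -|ζ'|² Im ζ'. It cancels
    -- the contribution of (ζ')² to the second derivative of exp ζ.
    have e1 : (planeCoord a D2 * conj (planeCoord a D)).im
        = -(planeCoord a D).im * Complex.normSq (planeCoord a D) := by
      simp only [Complex.mul_im, Complex.conj_re, Complex.conj_im, Complex.normSq_apply,
        planeCoord_re, planeCoord_im]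
      linear_combination (a.1 ^ 2 + a.2.1 ^ 2) * k1
    have e2 : (planeCoord a Dζ * conj (planeCoord a D)).im = 0 := by
      simp only [Complex.mul_im, Complex.conj_re, Complex.conj_im,
        planeCoord_re, planeCoord_im]
      linear_combination -(a.1 ^ 2 + a.2.1 ^ 2) * k2
    have hn := Complex.mul_conj (planeCoord a D)
    have hnT := Complex.mul_conj (T w)
    have : (r * (T w * planeCoord a D2 + planeCoord a D * (T w * planeCoord a D))
        + t * (T w * planeCoord a Dζ))
        * (conj (T w) * conj (planeCoord a D))
        = (Complex.normSq (T w) : ℂ) * (r * (planeCoord a D2 * conj (planeCoord a D))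
          + t * (planeCoord a Dζ * conj (planeCoord a D))
          + r * Complex.normSq (planeCoord a D) * planeCoord a D) := by
      rw [← hn, ← hnT]; ring
    rw [this, Complex.im_ofReal_mul, Complex.add_im, Complex.add_im, Complex.im_ofReal_mul,
      Complex.im_ofReal_mul, mul_assoc (r : ℂ), Complex.im_ofReal_mul, Complex.im_ofReal_mul, e1,
      e2]
    ring
  have hQ := eventually_div_conj_eq hG0 hG
  have hQ1 : G v / conj (G v) * conj (G v / conj (G v)) = 1 := by
    have h0 := hG0.self_of_nhds
    have hc0 : conj (G v) ≠ 0 := (map_ne_zero _).2 h0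
    rw [map_div₀, Complex.conj_conj]
    field_simp
  set Q := G v / conj (G v)
  refine ⟨Q, T v - Q * conj (T v), hQ1, ?_⟩
  have hK := eventually_eq_of_hasFDerivAt_zero (g := fun w => T w - Q * conj (T w)) (v := v) (by
    filter_upwards [hTd, hfi, hvert, he', hQ, hG0] with w hTw hfiw ⟨ζ, hζ⟩ hew hQw hG0w
    have hc : HasFDerivAt (fun w => conj (T w)) ((Complex.conjCLE : ℂ →L[ℝ] ℂ).comp
        (T w • (planeCoord a).comp (fderiv ℝ f w))) w :=
      (Complex.conjCLE : ℂ →L[ℝ] ℂ).hasFDerivAt.comp w hTw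
    refine (hTw.sub (hc.const_mul Q)).congr_fderiv ?_
    ext1 Y
    obtain ⟨r, t, rfl⟩ := exists_eq_smul_add_smul hfiw hζ hew Y
    have hz : planeCoord a ((0, 0, t) : Nil) = 0 := by
      apply Complex.ext <;> simp [planeCoord_re, planeCoord_im]
    have hc0 : conj (G w) ≠ 0 := (map_ne_zero _).2 hG0w
    have hQG : G w = Q * conj (G w) := by rw [← hQw]; field_simp
    simp only [hGdef, map_mul] at hQG
    simp [hζ, hz]
    linear_combination (r : ℂ) * hQG)
  filter_upwards [hK] with w hw
  rw [← hw]
  ring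

/-- Differentiating along a non-vertical tangent vector gives G = Q conj G with G ≠ 0, which
determines `Q`, and then one point determines `K`. This uniqueness makes the locally chosen line a
locally constant function. -/
theorem line_unique {a : Nil} (ha : a.1 ^ 2 + a.2.1 ^ 2 ≠ 0) {S : ImmersedSurface} (q : S.carrier)
    {Q K Q' K' : ℂ}
    (h : ∀ᶠ p in 𝓝 q, Complex.exp (planeCoord a (S.toFun p))
      = Q * conj (Complex.exp (planeCoord a (S.toFun p))) + K)
    (h' : ∀ᶠ p in 𝓝 q, Complex.exp (planeCoord a (S.toFun p))
      = Q' * conj (Complex.exp (planeCoord a (S.toFun p))) + K') : Q = Q' ∧ K = K' := by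
  set c := chartAt Plane q
  have hq : c q ∈ c.target := c.map_source (mem_chart_source Plane q)
  have hf := S.contDiffAt_localRep q hq
  set f := localRep S.toFun q with hfdef
  obtain ⟨e, he⟩ : ∃ e, (fderiv ℝ f (c q) e).1 ^ 2 + (fderiv ℝ f (c q) e).2.1 ^ 2 ≠ 0 := by
    rcases exists_not_vertical (S.injective_fderiv_localRep q hq) with h | h
    exacts [⟨_, h⟩, ⟨_, h⟩]
  set T : Plane → ℂ := fun w => Complex.exp (planeCoord a (f w))
  have hT : HasFDerivAt T (T (c q) • (planeCoord a).comp (fderiv ℝ f (c q))) (c q) :=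
    ((planeCoord a).hasFDerivAt.comp _ (hf.differentiableAt (by simp)).hasFDerivAt).cexp
  have hc : HasFDerivAt (fun w => conj (T w)) ((Complex.conjCLE : ℂ →L[ℝ] ℂ).comp
      (T (c q) • (planeCoord a).comp (fderiv ℝ f (c q)))) (c q) :=
    (Complex.conjCLE : ℂ →L[ℝ] ℂ).hasFDerivAt.comp _ hT
  set G := T (c q) * planeCoord a (fderiv ℝ f (c q) e) with hG
  have hG0 : conj G ≠ 0 := by
    refine (map_ne_zero _).2 (mul_ne_zero (Complex.exp_ne_zero _) fun h0 => ?_)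
    have h1 := congrArg Complex.re h0
    have h2 := congrArg Complex.im h0
    rw [planeCoord_re] at h1
    rw [planeCoord_im] at h2
    simp only [Complex.zero_re, Complex.zero_im] at h1 h2
    refine mul_ne_zero ha he ?_
    linear_combination (a.1 * (fderiv ℝ f (c q) e).1 + a.2.1 * (fderiv ℝ f (c q) e).2.1) * h1
      + (a.1 * (fderiv ℝ f (c q) e).2.1 - a.2.1 * (fderiv ℝ f (c q) e).1) * h2
  have key : ∀ Q K : ℂ, (∀ᶠ p in 𝓝 q, Complex.exp (planeCoord a (S.toFun p))
      = Q * conj (Complex.exp (planeCoord a (S.toFun p))) + K) → G = Q * conj G := by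
    intro Q K h
    have h1 : ∀ᶠ w in 𝓝 (c q), T w = Q * conj (T w) + K := by
      have hcont := c.symm.continuousAt (x := c q) hq
      rw [ContinuousAt, c.left_inv (mem_chart_source Plane q)] at hcont
      exact hcont.eventually h
    have h2 := ((hc.const_mul Q).add_const K).congr_of_eventuallyEq h1
    have := congrArg (fun L : Plane →L[ℝ] ℂ => L e) (hT.unique h2)
    simp at this
    rw [hG, map_mul]
    exact this
  have hQ : Q = Q' := mul_right_cancel₀ hG0 ((key Q K h).symm.trans (key Q' K' h'))
  refine ⟨hQ, ?_⟩
  have e1 := h.self_of_nhds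
  have e2 := h'.self_of_nhds
  rw [← hQ] at e2
  linear_combination e2 - e1

theorem exists_global_line {lam : ℝ} (hlam : 0 < lam) {a : Nil} (ha : a.1 ^ 2 + a.2.1 ^ 2 ≠ 0)
    {S : ImmersedSurface} [ConnectedSpace S.carrier]
    (hinv : InvariantUnder S.toFun (transGroup (0, 0, 1))) (hS : IsTranslator lam S.toFun a) :
    ∃ Q K : ℂ, Q * conj Q = 1 ∧ ∀ p, Complex.exp (planeCoord a (S.toFun p))
      = Q * conj (Complex.exp (planeCoord a (S.toFun p))) + K := by
  have hloc : ∀ q : S.carrier, ∃ L : ℂ × ℂ, L.1 * conj L.1 = 1 ∧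
      ∀ᶠ p in 𝓝 q, Complex.exp (planeCoord a (S.toFun p))
        = L.1 * conj (Complex.exp (planeCoord a (S.toFun p))) + L.2 := by
    intro q
    set c := chartAt Plane q with hcdef
    have hqs := mem_chart_source Plane q
    have hq : c q ∈ c.target := c.map_source hqs
    have hn := c.open_target.mem_nhds hq
    obtain ⟨Q, K, hQ, h⟩ := eventually_line hlam ha (f := localRep S.toFun q) (v := c q)
      (Filter.mem_of_superset hn fun w hw => S.contDiffAt_localRep q hw)
      (Filter.mem_of_superset hn fun w hw => S.injective_fderiv_localRep q hw)
      (Filter.mem_of_superset hn fun w hw => exists_fderiv_eq_vertical hinv q hw)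
      (Filter.mem_of_superset hn fun w hw => hS.translatorAt_localRep hlam q hw)
    refine ⟨(Q, K), hQ, ?_⟩
    filter_upwards [(c.continuousAt hqs).eventually h, c.open_source.mem_nhds hqs] with p hp hps
    simp only [localRep, Function.comp, ← hcdef] at hp
    rwa [c.left_inv hps] at hp
  choose L hL1 hL using hloc
  have hLc : IsLocallyConstant L := by
    rw [IsLocallyConstant.iff_eventually_eq]
    intro q
    filter_upwards [eventually_eventually_nhds.2 (hL q)] with p hp
    obtain ⟨h1, h2⟩ := line_unique ha p (hL p) hp
    exact Prod.ext h1 h2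
  obtain ⟨q⟩ := S.nonempty
  refine ⟨(L q).1, (L q).2, hL1 q, fun p => ?_⟩
  have := (hL p).self_of_nhds
  rwa [hLc.apply_eq_of_preconnectedSpace p q] at this

/-- Rotating the plane by minus half the argument of `Q` makes the line parallel to the real axis,
on which the imaginary part is constant. -/
theorem exists_exp_mul_sin_eq {lam : ℝ} (hlam : 0 < lam) {a : Nil}
    (ha : a.1 ^ 2 + a.2.1 ^ 2 ≠ 0) {S : ImmersedSurface} [ConnectedSpace S.carrier]
    (hinv : InvariantUnder S.toFun (transGroup (0, 0, 1))) (hS : IsTranslator lam S.toFun a) :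
    ∃ β C : ℝ, ∀ p, Real.exp (planeCoord a (S.toFun p)).re
      * Real.sin ((planeCoord a (S.toFun p)).im - β) = C := by
  obtain ⟨Q, K, hQ, h⟩ := exists_global_line hlam ha hinv hS
  have hQn : ‖Q‖ = 1 := by
    rw [Complex.mul_conj, Complex.normSq_eq_norm_sq] at hQ
    have h2 : ‖Q‖ ^ 2 = 1 := by exact_mod_cast hQ
    exact (pow_eq_one_iff_of_nonneg (norm_nonneg Q) two_ne_zero).1 h2
  set β := Q.arg / 2 with hβ
  set E := Complex.exp ((-β : ℝ) * Complex.I) with hE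
  have hEc : conj E = Complex.exp ((β : ℝ) * Complex.I) := by
    rw [hE, ← Complex.exp_conj]
    simp
  have hQE : Q * E = conj E := by
    have h1 : Q = Complex.exp (Q.arg * Complex.I) := by
      have := Complex.norm_mul_exp_arg_mul_I Q
      rw [hQn] at this
      simpa using this.symm
    rw [hEc]
    nth_rewrite 1 [h1]
    rw [hE, ← Complex.exp_add]
    congr 1
    rw [hβ]
    push_cast
    ring
  refine ⟨β, (E * K).im / 2, fun p => ?_⟩
  set Z := planeCoord a (S.toFun p)
  have h1 : (E * Complex.exp Z).im = Real.exp Z.re * Real.sin (Z.im - β) := by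
    rw [hE, ← Complex.exp_add, Complex.exp_im]
    simp
    congr 1
    ring
  have h2 : E * Complex.exp Z = conj (E * Complex.exp Z) + E * K := by
    rw [map_mul, ← hQE]
    linear_combination E * h p
  have h3 := congrArg Complex.im h2
  rw [Complex.add_im, Complex.conj_im] at h3
  rw [← h1]
  linarith

theorem exists_vertex {a₁ a₂ : ℝ} (ha : a₁ ^ 2 + a₂ ^ 2 ≠ 0) (ξ η : ℝ) :
    ∃ w : ℝ × ℝ, a₁ * w.1 + a₂ * w.2 = ξ ∧ a₁ * w.2 - a₂ * w.1 = η := by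
  refine ⟨((a₁ * ξ - a₂ * η) / (a₁ ^ 2 + a₂ ^ 2), (a₂ * ξ + a₁ * η) / (a₁ ^ 2 + a₂ ^ 2)), ?_, ?_⟩
    <;> field_simp <;> ring

theorem exists_int_mem_Ioo_of_sin_pos {θ : ℝ} (h : 0 < Real.sin θ) :
    ∃ k : ℤ, 0 < θ - k * (2 * Real.pi) ∧ θ - k * (2 * Real.pi) < Real.pi := by
  have hπ := Real.pi_pos
  refine ⟨⌊θ / (2 * Real.pi)⌋, ?_⟩
  set k := ⌊θ / (2 * Real.pi)⌋
  have h1 : (k : ℝ) ≤ θ / (2 * Real.pi) := Int.floor_le _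
  have h2 : θ / (2 * Real.pi) < k + 1 := Int.lt_floor_add_one _
  rw [le_div_iff₀ (by positivity)] at h1
  rw [div_lt_iff₀ (by positivity)] at h2
  rw [← Real.sin_sub_int_mul_two_pi θ k] at h
  set t := θ - k * (2 * Real.pi) with ht
  have ht0 : 0 ≤ t := by linarith
  have ht1 : t < 2 * Real.pi := by linarith
  refine ⟨lt_of_le_of_ne ht0 fun h0 => ?_, ?_⟩
  · rw [← h0] at h; simp at h
  · by_contra! h3
    have := Real.sin_nonneg_of_nonneg_of_le_pi (x := t - Real.pi) (by linarith) (by linarith)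
    rw [Real.sin_sub_pi] at this
    linarith

/-- A connected, vertical translator is a piece of a grim reaper cylinder or of a plane. -/
theorem subset_cylinder_of_translator {lam : ℝ} (hlam : 0 < lam) {a₁ a₂ a₃ : ℝ}
    (ha : a₁ ^ 2 + a₂ ^ 2 ≠ 0) {S : ImmersedSurface} [ConnectedSpace S.carrier]
    (hinv : InvariantUnder S.toFun (transGroup (0, 0, 1)))
    (hS : IsTranslator lam S.toFun (a₁, a₂, a₃)) :
    ∃ w : ℝ × ℝ, Set.range S.toFun ⊆ cylinder (grimReaper a₁ a₂ w) ∨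
      Set.range S.toFun ⊆ cylinder (parallelLine a₁ a₂ w) := by
  obtain ⟨β, C, h⟩ := exists_exp_mul_sin_eq hlam (a := (a₁, a₂, a₃)) ha hinv hS
  have hcont : Continuous fun p => (planeCoord (a₁, a₂, a₃) (S.toFun p)).im :=
    Complex.continuous_im.comp ((planeCoord _).continuous.comp S.smooth.continuous)
  set ξ : S.carrier → ℝ := fun p => (planeCoord (a₁, a₂, a₃) (S.toFun p)).re with hξ
  set η : S.carrier → ℝ := fun p => (planeCoord (a₁, a₂, a₃) (S.toFun p)).im with hη
  obtain ⟨q⟩ := S.nonempty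
  by_cases hC : C = 0
  · refine ⟨((S.toFun q).1, (S.toFun q).2.1), Or.inr ?_⟩
    have hsin : ∀ p, Real.sin (η p - β) = 0 := fun p =>
      (mul_eq_zero.1 ((h p).trans hC)).resolve_left (Real.exp_pos _).ne'
    -- If η were not constant, it would take a value exceeding another one by some `δ` in (0, 1];
    -- zeros of the sine are never that close.
    have hle : ∀ p p', η p ≤ η p' := by
      intro p p'
      by_contra! hlt
      set δ := min 1 (η p - η p') with hδ
      have hδ0 : 0 < δ := lt_min one_pos (by linarith)
      have hδ1 : δ ≤ 1 := min_le_left _ _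
      have hδ2 : δ ≤ η p - η p' := min_le_right _ _
      obtain ⟨p'', hp''⟩ := mem_range_of_exists_le_of_exists_ge hcont (c := η p' + δ)
        ⟨p', by change η p' ≤ _; linarith⟩ ⟨p, by change _ ≤ η p; linarith⟩
      have hp2 : η p'' = η p' + δ := hp''
      have s1 := hsin p''
      have s2 := hsin p'
      rw [hp2, show η p' + δ - β = (η p' - β) + δ by ring, Real.sin_add, s2, zero_mul, zero_add]
        at s1
      have hs : 0 < Real.sin δ :=
        Real.sin_pos_of_pos_of_lt_pi hδ0 (by linarith [Real.pi_gt_three])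
      have hc := (mul_eq_zero.1 s1).resolve_right hs.ne'
      have := Real.sin_sq_add_cos_sq (η p' - β)
      rw [s2, hc] at this
      norm_num at this
    rintro _ ⟨p, rfl⟩
    have := le_antisymm (hle p q) (hle q p)
    simp only [hη, planeCoord_im] at this
    simp only [cylinder, parallelLine, Set.mem_ofPred_eq]
    linarith
  -- Shifting the phase by π changes the sign of the sine, so the constant may be taken positive.
  · obtain ⟨β', hβ'⟩ : ∃ β', ∀ p, Real.exp (ξ p) * Real.sin (η p - β') = |C| := by
      rcases lt_or_gt_of_ne hC with hneg | hpos
      · refine ⟨β + Real.pi, fun p => ?_⟩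
        rw [← sub_sub, Real.sin_sub_pi, abs_of_neg hneg, ← h p]
        ring
      · exact ⟨β, fun p => by rw [abs_of_pos hpos, ← h p]⟩
    have hC0 : 0 < |C| := abs_pos.2 hC
    have hsin : ∀ p, 0 < Real.sin (η p - β') := fun p =>
      pos_of_mul_pos_right ((hβ' p).symm ▸ hC0) (Real.exp_pos _).le
    obtain ⟨k, hk0, hk1⟩ := exists_int_mem_Ioo_of_sin_pos (hsin q)
    have hne : ∀ p, ∀ j : ℤ, η p ≠ β' + j * Real.pi := by
      intro p j hj
      have := hsin p
      rw [hj, add_sub_cancel_left, Real.sin_int_mul_pi] at this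
      exact lt_irrefl _ this
    -- By connectedness η cannot cross a zero of the sine, so it stays in the interval of length π
    -- that contains its value at `q`.
    have hbound : ∀ p, 0 < η p - β' - k * (2 * Real.pi) ∧
        η p - β' - k * (2 * Real.pi) < Real.pi := by
      intro p
      constructor
      · by_contra! hle
        obtain ⟨p', hp'⟩ := mem_range_of_exists_le_of_exists_ge hcont
          (c := β' + k * (2 * Real.pi)) ⟨p, by change η p ≤ _; linarith⟩
          ⟨q, by change _ ≤ η q; linarith⟩
        refine hne p' (2 * k) (Eq.trans hp' ?_)
        push_cast; ring
      · by_contra! hle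
        obtain ⟨p', hp'⟩ := mem_range_of_exists_le_of_exists_ge hcont
          (c := β' + k * (2 * Real.pi) + Real.pi) ⟨q, by change η q ≤ _; linarith⟩
          ⟨p, by change _ ≤ η p; linarith⟩
        refine hne p' (2 * k + 1) (Eq.trans hp' ?_)
        push_cast; ring
    -- The vertex lies at the midpoint of the interval for η, where the sine is 1 and hence ξ = log
    -- |C|.
    obtain ⟨w, hw1, hw2⟩ := exists_vertex ha (Real.log |C|)
      (β' + k * (2 * Real.pi) + Real.pi / 2)
    refine ⟨w, Or.inl ?_⟩
    rintro _ ⟨p, rfl⟩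
    have e1 : a₁ * ((S.toFun p).2.1 - w.2) - a₂ * ((S.toFun p).1 - w.1)
        = η p - β' - k * (2 * Real.pi) - Real.pi / 2 := by
      simp only [hη, planeCoord_im]; linarith
    have e2 : a₁ * ((S.toFun p).1 - w.1) + a₂ * ((S.toFun p).2.1 - w.2)
        = ξ p - Real.log |C| := by
      simp only [hξ, planeCoord_re]; linarith
    simp only [cylinder, grimReaper, Set.mem_ofPred_eq]
    rw [e1, e2]
    obtain ⟨b1, b2⟩ := hbound p
    refine ⟨abs_lt.2 ⟨by linarith, by linarith⟩, ?_⟩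
    rw [Real.cos_sub_pi_div_two, Real.sin_sub_int_mul_two_pi, ← hβ' p,
      Real.log_mul (Real.exp_pos _).ne' (hsin p).ne', Real.log_exp]
    ring

/-! ### Grim reaper cylinders are translators -/

/-- Two differentiations of the equation of the curve, for a surface that is only known to lie in
the cylinder. For the grim reaper the first derivative is kept in the form cos θ · ξ' - sin θ · η' =
0, free of quotients. -/
theorem translatorAt_of_mem_cylinder {lam : ℝ} (hlam : 0 < lam) {a₁ a₂ : ℝ} (a₃ : ℝ)
    (ha : a₁ ^ 2 + a₂ ^ 2 ≠ 0) {f : Plane → Nil} {v : Plane}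
    (hf : ∀ᶠ w in 𝓝 v, ContDiffAt ℝ ∞ f w) (hfi : Function.Injective (fderiv ℝ f v))
    (hvert : ∀ᶠ w in 𝓝 v, ∃ ζ, fderiv ℝ f w ζ = (0, 0, 1)) (P : ℝ × ℝ)
    (h : (∀ᶠ w in 𝓝 v, f w ∈ cylinder (grimReaper a₁ a₂ P)) ∨
      ∀ᶠ w in 𝓝 v, f w ∈ cylinder (parallelLine a₁ a₂ P)) :
    TranslatorAt lam (a₁, a₂, a₃) f v := by
  have hfv := hf.self_of_nhds
  rw [translatorAt_vertical_iff hlam _ hfv hfi hvert]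
  intro X
  have hD2 := hasFDerivAt_fderiv_apply hfv X
  have hD1 := (hfv.differentiableAt (by simp)).hasFDerivAt
  set D := fderiv ℝ f v X with hD
  set D2 := fderiv ℝ (fderiv ℝ f) v X X
  -- The factor |a|² allows the planar equation to be rewritten in the coordinates along and across
  -- (a₁, a₂).
  apply mul_left_cancel₀ ha
  rcases h with h | h
  · set θ : Plane → ℝ := fun w => a₁ * ((f w).2.1 - P.2) - a₂ * ((f w).1 - P.1) with hθ
    have hθd : ∀ w, DifferentiableAt ℝ f w → HasFDerivAt θ
        (a₁ • ((ContinuousLinearMap.fst ℝ ℝ ℝ).comp ((ContinuousLinearMap.snd ℝ ℝ (ℝ × ℝ)).comp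
          (fderiv ℝ f w))) - a₂ • ((ContinuousLinearMap.fst ℝ ℝ (ℝ × ℝ)).comp (fderiv ℝ f w)))
        w := fun w hw =>
      ((hw.hasFDerivAt.snd.fst.sub_const P.2).const_mul a₁).sub
        ((hw.hasFDerivAt.fst.sub_const P.1).const_mul a₂)
    have hcos : ∀ᶠ w in 𝓝 v, 0 < Real.cos (θ w) := by
      filter_upwards [h] with w hw
      exact Real.cos_pos_of_mem_Ioo ⟨(abs_lt.1 hw.1).1, (abs_lt.1 hw.1).2⟩
    have h1 : ∀ᶠ w in 𝓝 v, Real.cos (θ w) * (a₁ * (fderiv ℝ f w X).1 + a₂ * (fderiv ℝ f w X).2.1)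
        - Real.sin (θ w) * (a₁ * (fderiv ℝ f w X).2.1 - a₂ * (fderiv ℝ f w X).1) = 0 := by
      filter_upwards [hf, eventually_eventually_nhds.2 h, hcos] with w hfw hw hcw
      have hd := hfw.differentiableAt (by simp)
      have hl := ((hd.hasFDerivAt.fst.sub_const P.1).const_mul a₁).add
        ((hd.hasFDerivAt.snd.fst.sub_const P.2).const_mul a₂)
      have hr := ((hθd w hd).cos.log hcw.ne').neg
      have he : (fun w => a₁ * ((f w).1 - P.1) + a₂ * ((f w).2.1 - P.2))
          =ᶠ[𝓝 w] fun w => -Real.log (Real.cos (θ w)) := by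
        filter_upwards [hw] with w' hw' using hw'.2
      have := congrArg (fun L : Plane →L[ℝ] ℝ => L X) (hl.unique (hr.congr_of_eventuallyEq he))
      simp at this
      field_simp at this
      linear_combination this
    have h2 := ((hθd v (hfv.differentiableAt (by simp))).cos.mul
      ((hD2.fst.const_mul a₁).add (hD2.snd.fst.const_mul a₂))).sub
      ((hθd v (hfv.differentiableAt (by simp))).sin.mul
      ((hD2.snd.fst.const_mul a₁).sub (hD2.fst.const_mul a₂)))
    have h3 := (hasFDerivAt_const (𝕜 := ℝ) (0 : ℝ) v).congr_of_eventuallyEq h1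
    have h4 := congrArg (fun L : Plane →L[ℝ] ℝ => L X) (h2.unique h3)
    have h5 := h1.self_of_nhds
    simp at h4
    rw [← hD] at h5
    apply mul_left_cancel₀ hcos.self_of_nhds.ne'
    linear_combination ((a₁ * D2.2.1 - a₂ * D2.1) + (a₁ * D.2.1 - a₂ * D.1)
      * (a₁ * D.1 + a₂ * D.2.1)) * h5 - (a₁ * D.2.1 - a₂ * D.1) * h4
  · have h1 : ∀ᶠ w in 𝓝 v, a₁ * (fderiv ℝ f w X).2.1 - a₂ * (fderiv ℝ f w X).1 = 0 := by
      filter_upwards [hf, eventually_eventually_nhds.2 h] with w hfw hw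
      have hd := hfw.differentiableAt (by simp)
      have hl := ((hd.hasFDerivAt.snd.fst.sub_const P.2).const_mul a₁).sub
        ((hd.hasFDerivAt.fst.sub_const P.1).const_mul a₂)
      have h3 := (hasFDerivAt_const (𝕜 := ℝ) (0 : ℝ) w).congr_of_eventuallyEq hw
      simpa using congrArg (fun L : Plane →L[ℝ] ℝ => L X) (hl.unique h3)
    have h2 := (hD2.snd.fst.const_mul a₁).sub (hD2.fst.const_mul a₂)
    have h3 := (hasFDerivAt_const (𝕜 := ℝ) (0 : ℝ) v).congr_of_eventuallyEq h1
    have h4 := congrArg (fun L : Plane →L[ℝ] ℝ => L X) (h2.unique h3)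
    have h5 := h1.self_of_nhds
    simp at h4
    rw [← hD] at h5
    linear_combination (a₁ * D.1 + a₂ * D.2.1) * h4 + ((a₁ ^ 2 + a₂ ^ 2)
      * (D.1 ^ 2 + D.2.1 ^ 2) - (a₁ * D2.1 + a₂ * D2.2.1)) * h5

theorem isTranslator_of_subset_cylinder {lam : ℝ} (hlam : 0 < lam) {a₁ a₂ : ℝ} (a₃ : ℝ)
    (ha : a₁ ^ 2 + a₂ ^ 2 ≠ 0) {S : ImmersedSurface}
    (hinv : InvariantUnder S.toFun (transGroup (0, 0, 1))) (w : ℝ × ℝ)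
    (h : Set.range S.toFun ⊆ cylinder (grimReaper a₁ a₂ w) ∨
      Set.range S.toFun ⊆ cylinder (parallelLine a₁ a₂ w)) :
    IsTranslator lam S.toFun (a₁, a₂, a₃) := by
  rw [isTranslator_iff hlam]
  intro q
  have hq : chartAt Plane q q ∈ (chartAt Plane q).target :=
    (chartAt Plane q).map_source (mem_chart_source Plane q)
  have hn := (chartAt Plane q).open_target.mem_nhds hq
  refine translatorAt_of_mem_cylinder hlam a₃ ha
    (Filter.mem_of_superset hn fun w hw => S.contDiffAt_localRep q hw)
    (S.injective_fderiv_localRep q hq)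
    (Filter.mem_of_superset hn fun w hw => exists_fderiv_eq_vertical hinv q hw) w ?_
  exact h.imp (fun h => Filter.Eventually.of_forall fun _ => h ⟨_, rfl⟩)
    (fun h => Filter.Eventually.of_forall fun _ => h ⟨_, rfl⟩)

/-! ### Completeness of properly embedded surfaces -/

/-- A `C¹` function whose derivative has finite integral has a limit at the right end. -/
theorem exists_tendsto_of_abs_deriv_le {x sp : ℝ → ℝ} {a C : ℝ} (ha : a < 1)
    (hx : ContDiffOn ℝ 1 x (Set.Ioo a 1)) (hC : 0 ≤ C)
    (hle : ∀ t ∈ Set.Ioo a 1, |deriv x t| ≤ C * sp t)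
    (hsp : (∫⁻ t in Set.Ioo a 1, ENNReal.ofReal (sp t)) < ⊤) :
    ∃ l, Filter.Tendsto x (𝓝[<] 1) (𝓝 l) := by
  have hcont : ContinuousOn (deriv x) (Set.Ioo a 1) :=
    hx.continuousOn_deriv_of_isOpen isOpen_Ioo le_rfl
  have hint : IntegrableOn (deriv x) (Set.Ioo a 1) := by
    refine ⟨hcont.aestronglyMeasurable measurableSet_Ioo, ?_⟩
    rw [hasFiniteIntegral_iff_norm]
    calc ∫⁻ t in Set.Ioo a 1, ENNReal.ofReal ‖deriv x t‖
        ≤ ∫⁻ t in Set.Ioo a 1, ENNReal.ofReal C * ENNReal.ofReal (sp t) := by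
          refine setLIntegral_mono' measurableSet_Ioo fun t ht => ?_
          rw [← ENNReal.ofReal_mul hC]
          exact ENNReal.ofReal_le_ofReal (hle t ht)
      _ = ENNReal.ofReal C * ∫⁻ t in Set.Ioo a 1, ENNReal.ofReal (sp t) :=
          lintegral_const_mul' _ _ ENNReal.ofReal_ne_top
      _ < ⊤ := ENNReal.mul_lt_top ENNReal.ofReal_lt_top hsp
  set b := (a + 1) / 2 with hb
  have hab : a < b := by linarith
  have hb1 : b < 1 := by linarith
  have hint' : IntegrableOn (deriv x) (Set.uIcc b 1) := by
    rw [Set.uIcc_of_le hb1.le, integrableOn_Icc_iff_integrableOn_Ioo]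
    exact hint.mono_set (Set.Ioo_subset_Ioo_left hab.le)
  have hprim := intervalIntegral.continuousOn_primitive_interval hint'
  have h1 : Filter.Tendsto (fun t => x b + ∫ s in b..t, deriv x s) (𝓝[<] 1)
      (𝓝 (x b + ∫ s in b..1, deriv x s)) := by
    refine Filter.Tendsto.const_add _ ?_
    have := hprim 1 Set.right_mem_uIcc
    rw [Set.uIcc_of_le hb1.le] at this
    refine this.mono_left ?_
    rw [← nhdsWithin_Ioo_eq_nhdsLT hb1]
    exact nhdsWithin_mono _ Set.Ioo_subset_Icc_self
  refine ⟨_, h1.congr' ?_⟩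
  filter_upwards [Ioo_mem_nhdsLT hb1] with t ht
  have hsub : Set.uIcc b t ⊆ Set.Ioo a 1 := by
    rw [Set.uIcc_of_le ht.1.le]
    exact fun s hs => ⟨hab.trans_le hs.1, hs.2.trans_lt ht.2⟩
  rw [intervalIntegral.integral_deriv_eq_sub
    (fun s hs => (hx.contDiffAt (isOpen_Ioo.mem_nhds (hsub hs))).differentiableAt (by simp))
    ((hcont.mono hsub).intervalIntegrable)]
  ring

/-- The speed dominates |x'| and |y'|, so x and y converge along a curve of finite length. They are
then bounded near the end, which turns the bound on the Z-component into one on |z'|. The limit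
point lies in the closed image, and the embedding pulls the convergence back. -/
theorem isCompleteSurface_of_isClosedEmbedding {lam : ℝ} (hlam : 0 < lam) (S : ImmersedSurface)
    (hS : Topology.IsClosedEmbedding S.toFun) : IsCompleteSurface lam S.toFun := by
  intro c hc hlen
  set g := S.toFun ∘ c with hg
  have hgs : ContDiffOn ℝ 1 g (Set.Ico 0 1) := by
    rw [← contMDiffOn_iff_contDiffOn]
    exact (S.smooth.of_le (by simp)).comp_contMDiffOn hc
  have hgo : ContDiffOn ℝ 1 g (Set.Ioo 0 1) := hgs.mono Set.Ioo_subset_Ico_self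
  set sp : ℝ → ℝ := fun t => √(metric lam (frameComp (g t) (deriv g t))
    (frameComp (g t) (deriv g t))) with hsp
  have hlen' : (∫⁻ t in Set.Ioo (0 : ℝ) 1, ENNReal.ofReal (sp t)) < ⊤ := hlen
  have hd : ∀ t ∈ Set.Ioo (0 : ℝ) 1, HasDerivAt g (deriv g t) t := fun t ht =>
    ((hgo.contDiffAt (isOpen_Ioo.mem_nhds ht)).differentiableAt (by simp)).hasDerivAt
  have hx' : ∀ t ∈ Set.Ioo (0 : ℝ) 1, deriv (fun t => (g t).1) t = (deriv g t).1 :=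
    fun t ht => by simpa using (hd t ht).hasFDerivAt.fst.hasDerivAt.deriv
  have hy' : ∀ t ∈ Set.Ioo (0 : ℝ) 1, deriv (fun t => (g t).2.1) t = (deriv g t).2.1 :=
    fun t ht => by simpa using (hd t ht).hasFDerivAt.snd.fst.hasDerivAt.deriv
  have hz' : ∀ t ∈ Set.Ioo (0 : ℝ) 1, deriv (fun t => (g t).2.2) t = (deriv g t).2.2 :=
    fun t ht => by simpa using (hd t ht).hasFDerivAt.snd.snd.hasDerivAt.deriv
  have bx : ∀ t, |(deriv g t).1| ≤ sp t := fun t => by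
    apply Real.abs_le_sqrt
    simp only [metric, frameComp]
    nlinarith [sq_nonneg (deriv g t).2.1, mul_nonneg hlam.le
      (sq_nonneg ((deriv g t).2.2 + ((g t).2.1 * (deriv g t).1 - (g t).1 * (deriv g t).2.1) / 2))]
  have by' : ∀ t, |(deriv g t).2.1| ≤ sp t := fun t => by
    apply Real.abs_le_sqrt
    simp only [metric, frameComp]
    nlinarith [sq_nonneg (deriv g t).1, mul_nonneg hlam.le
      (sq_nonneg ((deriv g t).2.2 + ((g t).2.1 * (deriv g t).1 - (g t).1 * (deriv g t).2.1) / 2))]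
  have bz : ∀ t, √lam * |(deriv g t).2.2 + ((g t).2.1 * (deriv g t).1
      - (g t).1 * (deriv g t).2.1) / 2| ≤ sp t := fun t => by
    rw [← abs_of_pos (Real.sqrt_pos.2 hlam), ← abs_mul]
    apply Real.abs_le_sqrt
    rw [mul_pow, Real.sq_sqrt hlam.le]
    simp only [metric, frameComp]
    nlinarith [sq_nonneg (deriv g t).1, sq_nonneg (deriv g t).2.1]
  obtain ⟨lx, hlx⟩ := exists_tendsto_of_abs_deriv_le (x := fun t => (g t).1) (sp := sp) one_pos
    hgo.fst zero_le_one (fun t ht => by rw [hx' t ht, one_mul]; exact bx t) hlen'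
  obtain ⟨ly, hly⟩ := exists_tendsto_of_abs_deriv_le (x := fun t => (g t).2.1) (sp := sp) one_pos
    hgo.snd.fst zero_le_one (fun t ht => by rw [hy' t ht, one_mul]; exact by' t) hlen'
  set B := max (|lx| + 1) (|ly| + 1) with hB
  have hbd : ∀ᶠ t in 𝓝[<] (1 : ℝ), |(g t).1| ≤ B ∧ |(g t).2.1| ≤ B := by
    filter_upwards [hlx.abs.eventually (gt_mem_nhds (lt_add_one |lx|)),
      hly.abs.eventually (gt_mem_nhds (lt_add_one |ly|))] with t h1 h2
    exact ⟨h1.le.trans (le_max_left _ _), h2.le.trans (le_max_right _ _)⟩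
  have hB0 : 0 ≤ B := le_max_of_le_left (by positivity)
  obtain ⟨δ, hδ1, hδ⟩ := (mem_nhdsLT_iff_exists_Ioo_subset' (a := (1 : ℝ)) zero_lt_one).1 hbd
  set a := max 0 δ with ha
  have ha1 : a < 1 := max_lt one_pos hδ1
  have hsub : Set.Ioo a 1 ⊆ Set.Ioo 0 1 := Set.Ioo_subset_Ioo_left (le_max_left _ _)
  obtain ⟨lz, hlz⟩ := exists_tendsto_of_abs_deriv_le (x := fun t => (g t).2.2) (sp := sp)
    -- The term (√lam)⁻¹ bounds the Z-component of the velocity; `B` bounds its difference from z',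
    -- which is (y x' - x y')/2.
    (C := (√lam)⁻¹ + B) ha1 (hgo.snd.snd.mono hsub) (by positivity) (fun t ht => by
      rw [hz' t (hsub ht)]
      obtain ⟨b1, b2⟩ := hδ ⟨(le_max_right _ _).trans_lt ht.1, ht.2⟩
      have hz := bz t
      rw [← le_div_iff₀' (Real.sqrt_pos.2 hlam), div_eq_inv_mul (sp t)] at hz
      have k1 : |(g t).2.1 * (deriv g t).1| ≤ B * sp t := by
        rw [abs_mul]; exact mul_le_mul b2 (bx t) (abs_nonneg _) hB0
      have k2 : |(g t).1 * (deriv g t).2.1| ≤ B * sp t := by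
        rw [abs_mul]; exact mul_le_mul b1 (by' t) (abs_nonneg _) hB0
      rw [abs_le] at *
      constructor <;> linarith [hz.1, hz.2, k1.1, k1.2, k2.1, k2.2])
    ((lintegral_mono_set hsub).trans_lt hlen')
  have hlim : Filter.Tendsto g (𝓝[<] 1) (𝓝 (lx, ly, lz)) :=
    hlx.prodMk_nhds (hly.prodMk_nhds hlz)
  have hmem : ((lx, ly, lz) : Nil) ∈ Set.range S.toFun :=
    hS.isClosed_range.mem_of_tendsto hlim (Filter.Eventually.of_forall fun t => ⟨c t, rfl⟩)
  obtain ⟨q, hq⟩ := hmem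
  refine ⟨q, ?_⟩
  rw [hS.isInducing.tendsto_nhds_iff, hq]
  exact hlim

/-! ### Surfaces parametrized by the plane -/

/-- The immersed surface given by a global parametrization. -/
def planeSurface (f : Plane → Nil) (hf : ContDiff ℝ ∞ f)
    (hfi : ∀ v, Function.Injective (fderiv ℝ f v)) : ImmersedSurface where
  carrier := Plane
  toFun := f
  smooth := hf.contMDiff
  immersion v := by rw [mfderiv_eq_fderiv]; exact hfi v

theorem isTranslator_planeSurface {lam : ℝ} (hlam : 0 < lam) {f : Plane → Nil}
    (hf : ContDiff ℝ ∞ f) (hfi : ∀ v, Function.Injective (fderiv ℝ f v)) (a : Nil)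
    (h : ∀ v, TranslatorAt lam a f v) : IsTranslator lam (planeSurface f hf hfi).toFun a :=
  (isTranslator_iff hlam (planeSurface f hf hfi) a).2 fun v => h v

/-- The bound says that preimages of bounded sets are bounded, so the map is proper and therefore
closed. -/
theorem isClosedEmbedding_of_bound {f : Plane → Nil} (hf : Continuous f)
    (hinj : Function.Injective f)
    (h : ∀ R, ∃ R', ∀ v, ‖f v‖ ≤ R → |v 0| ≤ R' ∧ |v 1| ≤ R') :
    Topology.IsClosedEmbedding f := by
  refine .of_continuous_injective_isClosedMap hf hinj (IsProperMap.isClosedMap ?_)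
  rw [isProperMap_iff_isCompact_preimage]
  refine ⟨hf, fun K hK => ?_⟩
  refine Metric.isCompact_of_isClosed_isBounded (hK.isClosed.preimage hf) ?_
  obtain ⟨R, hR⟩ := hK.isBounded.exists_norm_le
  obtain ⟨R', hR'⟩ := h R
  refine (Metric.isBounded_iff_subset_closedBall 0).2 ⟨R' + R', fun v hv => ?_⟩
  obtain ⟨h0, h1⟩ := hR' v (hR _ hv)
  rw [mem_closedBall_zero_iff, plane_eq v]
  refine (norm_add_le _ _).trans ?_
  simp only [norm_smul, PiLp.norm_single, norm_one, mul_one, Real.norm_eq_abs]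
  linarith

/-- The vertical cylinder over a plane curve. -/
def curveCylinder (γ₁ γ₂ : ℝ → ℝ) : Plane → Nil := fun v => (γ₁ (v 0), γ₂ (v 0), v 1)

theorem hasFDerivAt_coord (i : Fin 2) (v : Plane) :
    HasFDerivAt (fun v : Plane => v i) (EuclideanSpace.proj i : Plane →L[ℝ] ℝ) v :=
  (EuclideanSpace.proj i : Plane →L[ℝ] ℝ).hasFDerivAt

theorem contDiff_coord (i : Fin 2) : ContDiff ℝ ∞ fun v : Plane => v i :=
  (EuclideanSpace.proj i : Plane →L[ℝ] ℝ).contDiff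

theorem contDiff_curveCylinder {γ₁ γ₂ : ℝ → ℝ} (h₁ : ContDiff ℝ ∞ γ₁) (h₂ : ContDiff ℝ ∞ γ₂) :
    ContDiff ℝ ∞ (curveCylinder γ₁ γ₂) :=
  (h₁.comp (contDiff_coord 0)).prodMk ((h₂.comp (contDiff_coord 0)).prodMk (contDiff_coord 1))

theorem injective_fderiv_curveCylinder {γ₁ γ₂ : ℝ → ℝ} (h₁ : ContDiff ℝ ∞ γ₁)
    (h₂ : ContDiff ℝ ∞ γ₂) (h : ∀ t, deriv γ₁ t ≠ 0 ∨ deriv γ₂ t ≠ 0) (v : Plane) :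
    Function.Injective (fderiv ℝ (curveCylinder γ₁ γ₂) v) := by
  have e1 := ((h₁.differentiable (by simp)) (v 0)).hasDerivAt.comp_hasFDerivAt v
    (hasFDerivAt_coord 0 v)
  have e2 := ((h₂.differentiable (by simp)) (v 0)).hasDerivAt.comp_hasFDerivAt v
    (hasFDerivAt_coord 0 v)
  have e : HasFDerivAt (curveCylinder γ₁ γ₂) _ v :=
    e1.prodMk (e2.prodMk (hasFDerivAt_coord 1 v))
  rw [e.fderiv]
  refine (injective_iff_map_eq_zero _).2 fun X hX => ?_
  simp at hX
  obtain ⟨k1, k2, k3⟩ := hX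
  have k0 : X 0 = 0 := by
    rcases h (v 0) with h | h
    · exact k1.resolve_left h
    · exact k2.resolve_left h
  rw [plane_eq X, k0, k3]
  simp

theorem invariantUnder_curveCylinder (γ₁ γ₂ : ℝ → ℝ) :
    InvariantUnder (curveCylinder γ₁ γ₂) (transGroup (0, 0, 1)) := by
  refine ⟨fun u v => v + u • EuclideanSpace.single 1 1, by fun_prop, fun q => by simp,
    fun u v => ?_⟩
  refine Prod.ext ?_ (Prod.ext ?_ ?_) <;>
    simp [curveCylinder, transGroup, leftTrans, mul, add_comm]

/-- The parameter t = tan η opens the interval |η| < π/2 to the whole line. The height ξ = -log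
cos(arctan t) tends to infinity at both ends, so the parametrization is proper and the cylinder is
complete for every metric at once. -/
theorem exists_grimReaper_cylinder {a₁ a₂ : ℝ} (a₃ : ℝ) (ha : a₁ ^ 2 + a₂ ^ 2 ≠ 0)
    (w : ℝ × ℝ) : ∃ S : ImmersedSurface, ConnectedSpace S.carrier ∧
      Function.Injective S.toFun ∧ Set.range S.toFun = cylinder (grimReaper a₁ a₂ w) ∧
      InvariantUnder S.toFun (transGroup (0, 0, 1)) ∧
      ∀ l : ℝ, 0 < l → IsCompleteSurface l S.toFun ∧
        IsTranslator l S.toFun (a₁, a₂, a₃) := by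
  set N := a₁ ^ 2 + a₂ ^ 2 with hN
  set ξ : ℝ → ℝ := fun t => -Real.log (Real.cos (Real.arctan t)) with hξ
  have hξs : ContDiff ℝ ∞ ξ :=
    ((Real.contDiff_cos.comp Real.contDiff_arctan).log
      fun t => (Real.cos_arctan_pos t).ne').neg
  set γ₁ : ℝ → ℝ := fun t => w.1 + (a₁ * ξ t - a₂ * Real.arctan t) / N with hγ₁
  set γ₂ : ℝ → ℝ := fun t => w.2 + (a₂ * ξ t + a₁ * Real.arctan t) / N with hγ₂
  have h₁ : ContDiff ℝ ∞ γ₁ := contDiff_const.add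
    (((contDiff_const.mul hξs).sub (contDiff_const.mul Real.contDiff_arctan)).div_const N)
  have h₂ : ContDiff ℝ ∞ γ₂ := contDiff_const.add
    (((contDiff_const.mul hξs).add (contDiff_const.mul Real.contDiff_arctan)).div_const N)
  have eη : ∀ t, a₁ * (γ₂ t - w.2) - a₂ * (γ₁ t - w.1) = Real.arctan t := by
    intro t; simp only [hγ₁, hγ₂]; field_simp; rw [hN]; ring
  have eξ : ∀ t, a₁ * (γ₁ t - w.1) + a₂ * (γ₂ t - w.2) = ξ t := by
    intro t; simp only [hγ₁, hγ₂]; field_simp; rw [hN]; ring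
  have hreg : ∀ t, deriv γ₁ t ≠ 0 ∨ deriv γ₂ t ≠ 0 := by
    intro t
    by_contra! h0
    have d1 := ((h₁.differentiable (by simp)) t).hasDerivAt
    have d2 := ((h₂.differentiable (by simp)) t).hasDerivAt
    rw [h0.1] at d1
    rw [h0.2] at d2
    have d := ((d2.sub_const w.2).const_mul a₁).sub ((d1.sub_const w.1).const_mul a₂)
    have d' := (Real.hasDerivAt_arctan t).congr_of_eventuallyEq (Filter.Eventually.of_forall eη)
    have := d.unique d'
    have hp : 0 < 1 / (1 + t ^ 2) := by positivity
    simp at this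
    nlinarith [sq_nonneg t]
  have hrange : Set.range (curveCylinder γ₁ γ₂) = cylinder (grimReaper a₁ a₂ w) := by
    apply Set.Subset.antisymm
    · rintro _ ⟨v, rfl⟩
      change _ ∧ _
      simp only [curveCylinder]
      rw [eη, eξ]
      exact ⟨abs_lt.2 ⟨Real.neg_pi_div_two_lt_arctan _, Real.arctan_lt_pi_div_two _⟩, rfl⟩
    · rintro p ⟨hp1, hp2⟩
      simp only at hp1 hp2
      set η := a₁ * (p.2.1 - w.2) - a₂ * (p.1 - w.1) with hη
      have harc : Real.arctan (Real.tan η) = η := Real.arctan_tan (abs_lt.1 hp1).1 (abs_lt.1 hp1).2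
      refine ⟨Real.tan η • EuclideanSpace.single 0 1 + p.2.2 • EuclideanSpace.single 1 1, ?_⟩
      have e0 : (Real.tan η • EuclideanSpace.single 0 (1 : ℝ)
        + p.2.2 • EuclideanSpace.single 1 1 : Plane) 0 = Real.tan η := by simp
      have e1 : (Real.tan η • EuclideanSpace.single 0 (1 : ℝ)
        + p.2.2 • EuclideanSpace.single 1 1 : Plane) 1 = p.2.2 := by simp
      simp only [curveCylinder, e0, e1, hγ₁, hγ₂, hξ, harc]
      rw [← hp2]
      refine Prod.ext ?_ (Prod.ext ?_ rfl) <;> (simp only [hη]; field_simp; rw [hN]; ring)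
  have hinj : Function.Injective (curveCylinder γ₁ γ₂) := by
    intro v v' h
    simp only [curveCylinder, Prod.mk.injEq] at h
    obtain ⟨k1, k2, k3⟩ := h
    have : Real.arctan (v 0) = Real.arctan (v' 0) := by rw [← eη, ← eη, k1, k2]
    rw [plane_eq v, plane_eq v', k3, Real.arctan_injective this]
  have hcl : Topology.IsClosedEmbedding (curveCylinder γ₁ γ₂) := by
    refine isClosedEmbedding_of_bound (contDiff_curveCylinder h₁ h₂).continuous hinj fun R => ?_
    -- `B` bounds ξ on the ball of radius `R`; then √(1 + t²) = 1 / cos(arctan t) ≤ exp B bounds the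
    -- parameter.
    set B := |a₁| * (R + |w.1|) + |a₂| * (R + |w.2|) with hB
    refine ⟨max R (Real.exp B), fun v hv => ⟨?_, ?_⟩⟩
    · have n1 : |γ₁ (v 0)| ≤ R := (norm_fst_le (curveCylinder γ₁ γ₂ v)).trans hv
      have n2 : |γ₂ (v 0)| ≤ R := (norm_fst_le (curveCylinder γ₁ γ₂ v).2).trans
        ((norm_snd_le (curveCylinder γ₁ γ₂ v)).trans hv)
      have hb : ξ (v 0) ≤ B := by
        rw [← eξ, hB]
        refine add_le_add ?_ ?_
        · refine (le_abs_self _).trans ?_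
          rw [abs_mul]
          exact mul_le_mul_of_nonneg_left ((abs_sub _ _).trans (by linarith)) (abs_nonneg _)
        · refine (le_abs_self _).trans ?_
          rw [abs_mul]
          exact mul_le_mul_of_nonneg_left ((abs_sub _ _).trans (by linarith)) (abs_nonneg _)
      refine le_max_of_le_right ?_
      have hc := Real.cos_arctan_pos (v 0)
      have e1 : (Real.cos (Real.arctan (v 0)))⁻¹ ≤ Real.exp B := by
        rw [← Real.exp_log (inv_pos.2 hc), Real.log_inv]
        exact Real.exp_le_exp.2 hb
      refine le_trans ?_ e1
      rw [Real.cos_arctan, one_div, inv_inv]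
      apply Real.abs_le_sqrt
      linarith
    · have n3 : |v 1| ≤ R := (norm_snd_le (curveCylinder γ₁ γ₂ v).2).trans
        ((norm_snd_le (curveCylinder γ₁ γ₂ v)).trans hv)
      exact le_max_of_le_left n3
  refine ⟨planeSurface (curveCylinder γ₁ γ₂) (contDiff_curveCylinder h₁ h₂)
    (injective_fderiv_curveCylinder h₁ h₂ hreg), inferInstanceAs (ConnectedSpace Plane), hinj,
    hrange, invariantUnder_curveCylinder γ₁ γ₂, fun l hl => ⟨?_, ?_⟩⟩
  · exact isCompleteSurface_of_isClosedEmbedding hl _ hcl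
  · exact isTranslator_of_subset_cylinder hl a₃ ha (invariantUnder_curveCylinder γ₁ γ₂) w
      (Or.inl hrange.subset)

/-! ### Complete pieces of a cylinder are the whole cylinder -/

/-- Paths lift along a local homeomorphism as soon as partial lifts converge. -/
theorem exists_eq_of_lifts_converge {M Y : Type*} [TopologicalSpace M] [T2Space M]
    [TopologicalSpace Y] [T2Space Y] {φ : M → Y} (hφ : IsLocalHomeomorph φ) {p : ℝ → Y}
    (hp : Continuous p) {q₀ : M} (h₀ : φ q₀ = p 0)
    (hlim : ∀ T ∈ Set.Ioc (0 : ℝ) 1, ∀ c : ℝ → M, ContinuousOn c (Set.Ico 0 T) →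
      (∀ t ∈ Set.Ico 0 T, φ (c t) = p t) → ∃ q, Filter.Tendsto c (𝓝[<] T) (𝓝 q)) :
    ∃ q, φ q = p 1 := by
  set A : Set ℝ := {T | T ∈ Set.Icc (0 : ℝ) 1 ∧ ∃ c : ℝ → M, ContinuousOn c (Set.Icc 0 T) ∧
    c 0 = q₀ ∧ ∀ t ∈ Set.Icc 0 T, φ (c t) = p t} with hA
  have hA0 : (0 : ℝ) ∈ A := by
    refine ⟨⟨le_rfl, zero_le_one⟩, fun _ => q₀, continuousOn_const, rfl, fun t ht => ?_⟩
    rw [le_antisymm ht.2 ht.1, h₀]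
  have hbdd : BddAbove A := ⟨1, fun T hT => hT.1.2⟩
  have huniq : ∀ {T T' : ℝ} {c c' : ℝ → M}, T ≤ T' → 0 ≤ T → ContinuousOn c (Set.Icc 0 T) →
      c 0 = q₀ → (∀ t ∈ Set.Icc 0 T, φ (c t) = p t) → ContinuousOn c' (Set.Icc 0 T') →
      c' 0 = q₀ → (∀ t ∈ Set.Icc 0 T', φ (c' t) = p t) → Set.EqOn c c' (Set.Icc 0 T) := by
    intro T T' c c' hTT hT hc hc0 hcp hc' hc0' hcp'
    have hsub : Set.Icc 0 T ⊆ Set.Icc 0 T' := Set.Icc_subset_Icc_right hTT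
    exact (T2Space.isSeparatedMap φ).eqOn_of_comp_eqOn hφ.isLocallyInjective
      isPreconnected_Icc hc (hc'.mono hsub)
      (fun t ht => (hcp t ht).trans (hcp' t (hsub ht)).symm) (Set.left_mem_Icc.2 hT)
      (hc0.trans hc0'.symm)
  -- A lift on a closed interval is prolonged by a local inverse at its endpoint.
  have hext : ∀ T ∈ A, T < 1 → ∃ T' ∈ A, T < T' := by
    rintro T ⟨hT, c, hc, hc0, hcp⟩ hT1
    obtain ⟨e, hce, rfl⟩ := hφ (c T)
    have hpT : e (c T) = p T := hcp T (Set.right_mem_Icc.2 hT.1)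
    have hev : ∀ᶠ t in 𝓝 T, p t ∈ e.target :=
      hp.continuousAt.eventually (e.open_target.mem_nhds (hpT ▸ e.map_source hce))
    obtain ⟨ε, hε, hball⟩ := Metric.eventually_nhds_iff_ball.1 hev
    set T' := min 1 (T + ε / 2) with hT'
    have hTT' : T < T' := lt_min hT1 (by linarith)
    have htar : ∀ t ∈ Set.Icc T T', p t ∈ e.target := by
      intro t ht
      apply hball
      rw [Metric.mem_ball, Real.dist_eq, abs_of_nonneg (by linarith [ht.1])]
      linarith [ht.2, min_le_right 1 (T + ε / 2)]
    set c' : ℝ → M := fun t => if t ≤ T then c t else e.symm (p t) with hc'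
    have hglue : e.symm (p T) = c T := by rw [← hpT, e.left_inv hce]
    have h1 : Set.EqOn c' c (Set.Icc 0 T) := fun t ht => if_pos ht.2
    have h2 : Set.EqOn c' (fun t => e.symm (p t)) (Set.Icc T T') := by
      intro t ht
      rcases ht.1.eq_or_lt with h | h
      · simp only [hc', ← h, le_refl, if_true, hglue]
      · exact if_neg (not_le.2 h)
    have hun : Set.Icc 0 T' = Set.Icc 0 T ∪ Set.Icc T T' :=
      (Set.Icc_union_Icc_eq_Icc hT.1 hTT'.le).symm
    refine ⟨T', ⟨⟨hT.1.trans hTT'.le, min_le_left _ _⟩, c', ?_, ?_, ?_⟩, hTT'⟩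
    · rw [hun]
      refine ContinuousOn.union_of_isClosed (hc.congr h1) ?_ isClosed_Icc isClosed_Icc
      refine ContinuousOn.congr ?_ h2
      exact e.continuousOn_symm.comp hp.continuousOn htar
    · rw [h1 (Set.left_mem_Icc.2 hT.1), hc0]
    · intro t ht
      rw [hun] at ht
      rcases ht with ht | ht
      · rw [h1 ht, hcp t ht]
      · rw [h2 ht]; exact e.right_inv (htar t ht)
  set T := sSup A with hT
  have hT0 : 0 ≤ T := le_csSup hbdd hA0
  have hT1 : T ≤ 1 := csSup_le ⟨0, hA0⟩ fun t ht => ht.1.2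
  have hTA : T ∈ A := by
    rcases hT0.eq_or_lt with h | hpos
    · rw [← h]; exact hA0
    have hex : ∀ t : ℝ, ∃ T', t < T → T' ∈ A ∧ t < T' := by
      intro t
      by_cases ht : t < T
      · obtain ⟨T', h1, h2⟩ := exists_lt_of_lt_csSup ⟨0, hA0⟩ ht
        exact ⟨T', fun _ => ⟨h1, h2⟩⟩
      · exact ⟨0, fun h => absurd h ht⟩
    choose τ hτ using hex
    have hex2 : ∀ t : ℝ, ∃ c : ℝ → M, t < T → ContinuousOn c (Set.Icc 0 (τ t)) ∧
        c 0 = q₀ ∧ ∀ s ∈ Set.Icc 0 (τ t), φ (c s) = p s := by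
      intro t
      by_cases ht : t < T
      · obtain ⟨c, hc⟩ := (hτ t ht).1.2
        exact ⟨c, fun _ => hc⟩
      · exact ⟨fun _ => q₀, fun h => absurd h ht⟩
    choose γ hγ using hex2
    -- Each t below the supremum has a lift `γ t` that reaches beyond t. By uniqueness of lifts the
    -- diagonal choice agrees with all of them and is continuous; `hlim` then supplies its value at
    -- the supremum.
    set c : ℝ → M := fun t => γ t t with hc
    have heq : ∀ t ∈ Set.Ico 0 T, ∀ s ∈ Set.Ico 0 (τ t), s < T → c s = γ t s := by
      intro t ht s hs hsT
      obtain ⟨a1, a2, a3⟩ := hγ t ht.2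
      obtain ⟨b1, b2, b3⟩ := hγ s hsT
      have hst := (hτ s hsT).2
      have hsub1 : Set.Icc 0 s ⊆ Set.Icc 0 (τ s) := Set.Icc_subset_Icc_right hst.le
      exact huniq (T := s) (T' := τ t) hs.2.le hs.1 (b1.mono hsub1) b2
        (fun u hu => b3 u (hsub1 hu)) a1 a2 a3 (Set.right_mem_Icc.2 hs.1)
    have hcφ : ∀ t ∈ Set.Ico 0 T, φ (c t) = p t := fun t ht =>
      (hγ t ht.2).2.2 t ⟨ht.1, (hτ t ht.2).2.le⟩
    have hcc : ContinuousOn c (Set.Ico 0 T) := by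
      intro t ht
      have hlt := (hτ t ht.2).2
      have h1 : ContinuousWithinAt (γ t) (Set.Ico 0 T) t := by
        refine ((hγ t ht.2).1 t ⟨ht.1, hlt.le⟩).mono_of_mem_nhdsWithin ?_
        filter_upwards [self_mem_nhdsWithin, mem_nhdsWithin_of_mem_nhds (Iio_mem_nhds hlt)]
          with s hs hs' using ⟨hs.1, le_of_lt hs'⟩
      refine h1.congr_of_eventuallyEq ?_ rfl
      filter_upwards [self_mem_nhdsWithin, mem_nhdsWithin_of_mem_nhds (Iio_mem_nhds hlt)]
        with s hs hs' using heq t ht s ⟨hs.1, hs'⟩ hs.2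
    obtain ⟨q, hq⟩ := hlim T ⟨hpos, hT1⟩ c hcc hcφ
    have hqφ : φ q = p T := by
      have l1 := hφ.continuous.continuousAt.tendsto.comp hq
      have l2 : Filter.Tendsto p (𝓝[<] T) (𝓝 (p T)) :=
        hp.continuousAt.tendsto.mono_left nhdsWithin_le_nhds
      refine tendsto_nhds_unique l1 (l2.congr' ?_)
      filter_upwards [Ioo_mem_nhdsLT hpos] with t ht using (hcφ t ⟨ht.1.le, ht.2⟩).symm
    refine ⟨⟨hT0, hT1⟩, fun t => if t < T then c t else q, ?_, ?_, ?_⟩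
    · intro t ht
      rcases ht.2.lt_or_eq with hlt | rfl
      · have h1 : ContinuousWithinAt c (Set.Icc 0 T) t := by
          refine (hcc t ⟨ht.1, hlt⟩).mono_of_mem_nhdsWithin ?_
          filter_upwards [self_mem_nhdsWithin, mem_nhdsWithin_of_mem_nhds (Iio_mem_nhds hlt)]
            with s hs hs' using ⟨hs.1, hs'⟩
        refine h1.congr_of_eventuallyEq ?_ (if_pos hlt)
        filter_upwards [mem_nhdsWithin_of_mem_nhds (Iio_mem_nhds hlt)] with s hs using if_pos hs
      · rw [ContinuousWithinAt, if_neg (lt_irrefl _)]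
        have : Set.Icc 0 T ⊆ Set.Iio T ∪ {T} := fun s hs => hs.2.lt_or_eq
        refine Filter.Tendsto.mono_left ?_ (nhdsWithin_mono _ this)
        rw [nhdsWithin_union, nhdsWithin_singleton, Filter.tendsto_sup]
        constructor
        · refine hq.congr' ?_
          filter_upwards [self_mem_nhdsWithin] with s hs using (if_pos hs).symm
        · rw [Filter.tendsto_pure_left]
          intro s hs
          simpa using mem_of_mem_nhds hs
    · simp only [hpos, if_true]
      exact (hγ 0 hpos).2.1
    · intro t ht
      rcases ht.2.lt_or_eq with hlt | rfl
      · simp only [hlt, if_true]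
        exact hcφ t ⟨ht.1, hlt⟩
      · simp only [lt_irrefl, if_false, hqφ]
  have hT1' : T = 1 := by
    by_contra hne
    obtain ⟨T', hT'A, hlt⟩ := hext T hTA (lt_of_le_of_ne hT1 hne)
    exact absurd (le_csSup hbdd hT'A) (not_le.2 hlt)
  rw [hT1'] at hTA
  obtain ⟨-, c, -, -, hcp⟩ := hTA
  exact ⟨c 1, hcp 1 ⟨zero_le_one, le_rfl⟩⟩

/-- The immersion factors as `π ∘ (Φ ∘ S.toFun)`, so the derivative of `Φ ∘ S.toFun` is injective
between spaces of dimension two, and the inverse function theorem applies. -/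
theorem isLocalHomeomorph_of_factor (S : ImmersedSurface) {Φ : Nil → ℝ × ℝ}
    {π : ℝ × ℝ → Nil} {J : Set (ℝ × ℝ)} (hJ : IsOpen J) (hΦ : ContDiff ℝ ∞ Φ)
    (hπ : ContDiffOn ℝ ∞ π J) (h : ∀ q, Φ (S.toFun q) ∈ J ∧ π (Φ (S.toFun q)) = S.toFun q) :
    IsLocalHomeomorph (Φ ∘ S.toFun) := by
  refine IsLocalHomeomorph.mk _ fun q => ?_
  set c := chartAt Plane q with hcdef
  have hqs : q ∈ c.source := mem_chart_source Plane q
  have hq : c q ∈ c.target := c.map_source hqs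
  have hf := S.contDiffAt_localRep q hq
  have hi := S.injective_fderiv_localRep q hq
  set f := localRep S.toFun q with hfdef
  have hv : f (c q) = S.toFun q := S.localRep_chartAt q
  have hg : ContDiffAt ℝ ∞ (Φ ∘ f) (c q) := hΦ.contDiffAt.comp _ hf
  have hπd : DifferentiableAt ℝ π ((Φ ∘ f) (c q)) := by
    rw [Function.comp, hv]
    exact (hπ.contDiffAt (hJ.mem_nhds (h q).1)).differentiableAt (by simp)
  have hgi : Function.Injective (fderiv ℝ (Φ ∘ f) (c q)) := by
    have h1 : f = π ∘ (Φ ∘ f) := funext fun w => ((h _).2).symm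
    rw [h1, fderiv_comp _ hπd (hg.differentiableAt (by simp))] at hi
    exact Function.Injective.of_comp hi
  let L : Plane ≃L[ℝ] ℝ × ℝ :=
    ((fderiv ℝ (Φ ∘ f) (c q)).toLinearMap.linearEquivOfInjective hgi
      (by simp)).toContinuousLinearEquiv
  have hd : HasFDerivAt (Φ ∘ f) (L : Plane →L[ℝ] ℝ × ℝ) (c q) := by
    refine (hg.differentiableAt (by simp)).hasFDerivAt.congr_fderiv ?_
    ext1 w
    rfl
  let e := hg.toOpenPartialHomeomorph (Φ ∘ f) hd (by simp)
  refine ⟨c.trans e, ?_, ?_⟩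
  · rw [OpenPartialHomeomorph.trans_source]
    exact ⟨hqs, hg.mem_toOpenPartialHomeomorph_source hd (by simp)⟩
  · intro q' hq'
    rw [OpenPartialHomeomorph.trans_source] at hq'
    change Φ (S.toFun q') = Φ (S.toFun (c.symm (c q')))
    rw [c.left_inv hq'.1]

/-- `Φ` and `π` are global coordinates of `E` with values in a convex set. A segment from a point of
the surface to a given target maps to a smooth curve on a compact interval; partial lifts thus have
finite length, and they converge by completeness. The whole segment lifts, so the target is
attained. -/
theorem range_eq_of_isCompleteSurface {lam : ℝ} (S : ImmersedSurface)
    (hS : IsCompleteSurface lam S.toFun) {E : Set Nil} {Φ : Nil → ℝ × ℝ} {π : ℝ × ℝ → Nil}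
    {J : Set (ℝ × ℝ)} (hJ : IsOpen J) (hJc : Convex ℝ J) (hΦ : ContDiff ℝ ∞ Φ)
    (hπ : ContDiffOn ℝ ∞ π J) (hE : ∀ p ∈ E, Φ p ∈ J ∧ π (Φ p) = p)
    (hsub : Set.range S.toFun ⊆ E) : Set.range S.toFun = E := by
  have hfac : ∀ q, Φ (S.toFun q) ∈ J ∧ π (Φ (S.toFun q)) = S.toFun q :=
    fun q => hE _ (hsub ⟨q, rfl⟩)
  refine hsub.antisymm fun x hx => ?_
  obtain ⟨q₀⟩ := S.nonempty
  set s₀ := Φ (S.toFun q₀) with hs₀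
  set s₁ := Φ x with hs₁
  set p : ℝ → ℝ × ℝ := fun t => s₀ + t • (s₁ - s₀) with hp
  have hps : ContDiff ℝ ∞ p := by fun_prop
  have hpJ : ∀ t ∈ Set.Icc (0 : ℝ) 1, p t ∈ J := fun t ht =>
    hJc.add_smul_sub_mem (hfac q₀).1 (hE x hx).1 ht
  obtain ⟨q, hq⟩ := exists_eq_of_lifts_converge
    (isLocalHomeomorph_of_factor S hJ hΦ hπ hfac) hps.continuous (q₀ := q₀)
    (by simp [hp, hs₀]) (fun T hT c hc hcp => by
      -- The partial lift on [0, T) is rescaled to [0, 1), the interval on which completeness is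
      -- stated.
      set g : ℝ → Nil := fun t => π (p (T * t)) with hg
      set U : Set ℝ := {t | p (T * t) ∈ J} with hU
      have hpT : ContDiff ℝ ∞ fun t : ℝ => p (T * t) :=
        hps.comp (contDiff_const.mul contDiff_id)
      have hUo : IsOpen U := hJ.preimage hpT.continuous
      have hIU : Set.Icc (0 : ℝ) 1 ⊆ U := fun t ht =>
        hpJ _ ⟨mul_nonneg hT.1.le ht.1, mul_le_one₀ hT.2 ht.1 ht.2⟩
      have hgU : ContDiffOn ℝ ∞ g U := hπ.comp hpT.contDiffOn fun t ht => ht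
      have hmem : ∀ t ∈ Set.Ico (0 : ℝ) 1, T * t ∈ Set.Ico 0 T := fun t ht =>
        ⟨mul_nonneg hT.1.le ht.1, mul_lt_of_lt_one_right hT.1 ht.2⟩
      have hFg : ∀ t ∈ Set.Ico (0 : ℝ) 1, S.toFun (c (T * t)) = g t := by
        intro t ht
        rw [hg]
        simp only
        rw [← hcp _ (hmem t ht)]
        exact (hfac _).2.symm
      have hcont : ContinuousOn (fun t => c (T * t)) (Set.Ico 0 1) :=
        hc.comp (by fun_prop) hmem
      have hsm : ContMDiffOn 𝓘(ℝ, ℝ) (𝓡 2) 1 (fun t => c (T * t)) (Set.Ico 0 1) := by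
        intro t ht
        rw [contMDiffWithinAt_iff_target]
        refine ⟨hcont t ht, ?_⟩
        rw [contMDiffWithinAt_iff_contDiffWithinAt]
        have := S.contDiffWithinAt_lift ht (hcont t ht)
          ((hgU.contDiffAt (hUo.mem_nhds (hIU ⟨ht.1, ht.2.le⟩))).contDiffWithinAt)
          (Filter.mem_of_superset self_mem_nhdsWithin hFg)
        simpa [extChartAt] using this.of_le (by simp)
      have hcd : ContinuousOn (fun t => √(metric lam (frameComp (g t) (deriv g t))
          (frameComp (g t) (deriv g t)))) (Set.Icc 0 1) := by
        have h1 : ContinuousOn (deriv g) (Set.Icc 0 1) :=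
          (hgU.continuousOn_deriv_of_isOpen hUo (by simp)).mono hIU
        have h2 : ContinuousOn g (Set.Icc 0 1) := hgU.continuousOn.mono hIU
        unfold metric frameComp
        fun_prop
      obtain ⟨B, hB⟩ := isCompact_Icc.exists_bound_of_continuousOn hcd
      have hlen : (∫⁻ t in Set.Ioo (0 : ℝ) 1, ENNReal.ofReal
          (√(metric lam (frameComp (S.toFun (c (T * t))) (deriv (S.toFun ∘ fun t => c (T * t)) t))
            (frameComp (S.toFun (c (T * t))) (deriv (S.toFun ∘ fun t => c (T * t)) t))))) < ⊤ := by
        refine lt_of_le_of_lt (setLIntegral_mono' (g := fun _ => ENNReal.ofReal B)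
          measurableSet_Ioo fun t ht => ?_) ?_
        · apply ENNReal.ofReal_le_ofReal
          have hev : (S.toFun ∘ fun t => c (T * t)) =ᶠ[𝓝 t] g :=
            Filter.mem_of_superset (isOpen_Ioo.mem_nhds ht) fun s hs => hFg s ⟨hs.1.le, hs.2⟩
          rw [hev.deriv_eq, hFg t ⟨ht.1.le, ht.2⟩]
          exact (le_abs_self _).trans (hB t ⟨ht.1.le, ht.2.le⟩)
        · simp
      obtain ⟨q, hq⟩ := hS _ hsm hlen
      refine ⟨q, ?_⟩
      have hsc : Filter.Tendsto (fun t : ℝ => t / T) (𝓝[<] T) (𝓝[<] 1) := by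
        rw [← div_self hT.1.ne']
        refine tendsto_nhdsWithin_of_tendsto_nhds_of_eventually_within _
          ((continuous_id.div_const T).continuousAt.tendsto.mono_left nhdsWithin_le_nhds) ?_
        filter_upwards [self_mem_nhdsWithin] with t ht
        exact div_lt_div_of_pos_right ht hT.1
      refine (hq.comp hsc).congr fun t => ?_
      simp only [Function.comp]
      rw [mul_div_cancel₀ _ hT.1.ne'])
  refine ⟨q, ?_⟩
  have h1 : p 1 = s₁ := by simp [hp]
  rw [← (hfac q).2, ← (hE x hx).2]
  exact congrArg π (hq.trans h1)

theorem range_eq_cylinder_grimReaper {lam a₁ a₂ : ℝ} (ha : a₁ ^ 2 + a₂ ^ 2 ≠ 0)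
    {S : ImmersedSurface} (hS : IsCompleteSurface lam S.toFun) {w : ℝ × ℝ}
    (hsub : Set.range S.toFun ⊆ cylinder (grimReaper a₁ a₂ w)) :
    Set.range S.toFun = cylinder (grimReaper a₁ a₂ w) := by
  have hcos : ∀ s ∈ Set.Ioo (-(Real.pi / 2)) (Real.pi / 2) ×ˢ (Set.univ : Set ℝ),
      Real.cos s.1 ≠ 0 := fun s hs => (Real.cos_pos_of_mem_Ioo hs.1).ne'
  refine range_eq_of_isCompleteSurface S hS
    (J := Set.Ioo (-(Real.pi / 2)) (Real.pi / 2) ×ˢ (Set.univ : Set ℝ))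
    (Φ := fun p => (a₁ * (p.2.1 - w.2) - a₂ * (p.1 - w.1), p.2.2))
    (π := fun s => (w.1 + (a₁ * -Real.log (Real.cos s.1) - a₂ * s.1) / (a₁ ^ 2 + a₂ ^ 2),
      w.2 + (a₂ * -Real.log (Real.cos s.1) + a₁ * s.1) / (a₁ ^ 2 + a₂ ^ 2), s.2))
    (isOpen_Ioo.prod isOpen_univ) ((convex_Ioo _ _).prod convex_univ) (by fun_prop) ?_ ?_ hsub
  · have h1 : ContDiffOn ℝ ∞ (fun s : ℝ × ℝ => Real.log (Real.cos s.1))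
        (Set.Ioo (-(Real.pi / 2)) (Real.pi / 2) ×ˢ (Set.univ : Set ℝ)) :=
      ContDiffOn.log (Real.contDiff_cos.comp contDiff_fst).contDiffOn hcos
    fun_prop
  · rintro p ⟨hp1, hp2⟩
    simp only at hp1 hp2
    refine ⟨⟨⟨(abs_lt.1 hp1).1, (abs_lt.1 hp1).2⟩, trivial⟩, ?_⟩
    simp only
    rw [← hp2]
    refine Prod.ext ?_ (Prod.ext ?_ rfl) <;> (simp only; field_simp; ring)

theorem range_eq_cylinder_parallelLine {lam a₁ a₂ : ℝ} (ha : a₁ ^ 2 + a₂ ^ 2 ≠ 0)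
    {S : ImmersedSurface} (hS : IsCompleteSurface lam S.toFun) {w : ℝ × ℝ}
    (hsub : Set.range S.toFun ⊆ cylinder (parallelLine a₁ a₂ w)) :
    Set.range S.toFun = cylinder (parallelLine a₁ a₂ w) := by
  refine range_eq_of_isCompleteSurface S hS
    (Φ := fun p => (a₁ * (p.1 - w.1) + a₂ * (p.2.1 - w.2), p.2.2))
    (π := fun s => (w.1 + a₁ * s.1 / (a₁ ^ 2 + a₂ ^ 2), w.2 + a₂ * s.1 / (a₁ ^ 2 + a₂ ^ 2), s.2))
    isOpen_univ convex_univ (by fun_prop) (by fun_prop) ?_ hsub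
  intro p hp
  change a₁ * (p.2.1 - w.2) - a₂ * (p.1 - w.1) = 0 at hp
  refine ⟨trivial, Prod.ext ?_ (Prod.ext ?_ rfl)⟩ <;> simp only <;> field_simp
  · linear_combination a₂ * hp
  · linear_combination -a₁ * hp

/-! ### Invariance under non-vertical translations -/

theorem killingField_add_smul (p q : Nil) (c : ℝ) (x : Nil) :
    killingField (p + c • q) x = killingField p x + c • killingField q x := by
  refine Prod.ext ?_ (Prod.ext ?_ ?_) <;> simp [killingField]
  ring

/-- The Killing field of a group of left translations is tangent to the invariant surfaces. -/
theorem exists_tangentAlong_eq_killingField {S : ImmersedSurface} {p : Nil}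
    (hS : InvariantUnder S.toFun (transGroup p)) (q : S.carrier) {v : Plane}
    (hv : v ∈ (chartAt Plane q).target) :
    ∃ K, tangentAlong (localRep S.toFun q) v K = killingField p (localRep S.toFun q v) := by
  obtain ⟨ψ, hψ, hψ0, hψF⟩ := hS
  set q' := (chartAt Plane q).symm v with hq'
  have h0 : leftTrans ((0 : ℝ) • p) (S.toFun q') = S.toFun q' := by
    refine Prod.ext ?_ (Prod.ext ?_ ?_) <;> simp [leftTrans, mul]
  have hd := hasDerivAt_leftTrans p (S.toFun q') 0
  rw [h0] at hd
  obtain ⟨K, hK⟩ := exists_fderiv_eq_of_lift q hv (ι := fun u => ψ u q')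
    (g := fun u : ℝ => leftTrans (u • p) (S.toFun q')) (hψ0 q')
    (hψ.comp (continuous_id.prodMk continuous_const)).continuousAt
    (by unfold leftTrans mul; fun_prop) (Filter.Eventually.of_forall fun u => hψF u q') hd
  refine ⟨K, ?_⟩
  rw [tangentAlong, hK]
  exact frameComp_ofFrame _ _

/-- A horizontal normal annihilates the horizontal parts of all tangent vectors, so the projection
to the plane has rank at most one, and its kernel consists of vertical vectors. -/
theorem exists_vertical_of_normal_horizontal {lam : ℝ} (hlam : 0 < lam) {f : Plane → Nil}
    {v : Plane} (hfi : Function.Injective (fderiv ℝ f v))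
    (h : ∀ n, IsUnitNormal lam f v n → n.2.2 = 0) : ∃ ζ, fderiv ℝ f v ζ = (0, 0, 1) := by
  obtain ⟨n, hn⟩ := exists_unitNormal hlam hfi
  have hn3 := h n hn
  set e0 : Plane := EuclideanSpace.single 0 1 with he0
  set e1 : Plane := EuclideanSpace.single 1 1 with he1
  have h0 := hn.metric_tangentAlong e0
  have h1 := hn.metric_tangentAlong e1
  have h2 := hn.2
  simp only [metric, tangentAlong, frameComp, hn3, zero_mul, mul_zero, add_zero] at h0 h1 h2
  have hdet : (fderiv ℝ f v e0).1 * (fderiv ℝ f v e1).2.1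
      - (fderiv ℝ f v e0).2.1 * (fderiv ℝ f v e1).1 = 0 := by
    set x0 := (fderiv ℝ f v e0).1
    set y0 := (fderiv ℝ f v e0).2.1
    set x1 := (fderiv ℝ f v e1).1
    set y1 := (fderiv ℝ f v e1).2.1
    linear_combination (n.1 * y1 - n.2.1 * x1) * h0 + (n.2.1 * x0 - n.1 * y0) * h1
      - (x0 * y1 - y0 * x1) * h2
  have key : ∀ U : Plane, U ≠ 0 → (fderiv ℝ f v U).1 = 0 → (fderiv ℝ f v U).2.1 = 0 →
      ∃ ζ, fderiv ℝ f v ζ = (0, 0, 1) := by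
    intro U hU hx hy
    have ht : (fderiv ℝ f v U).2.2 ≠ 0 := by
      intro hz
      apply hU
      apply hfi
      rw [map_zero]
      exact Prod.ext hx (Prod.ext hy hz)
    refine ⟨(fderiv ℝ f v U).2.2⁻¹ • U, ?_⟩
    rw [map_smul]
    refine Prod.ext ?_ (Prod.ext ?_ ?_) <;> simp [hx, hy, ht]
  have hne : ∀ r t : ℝ, r • e0 + t • e1 = 0 → r = 0 ∧ t = 0 := single_independent
  by_cases hy : (fderiv ℝ f v e1).2.1 • e0 + (-(fderiv ℝ f v e0).2.1) • e1 = 0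
  · by_cases hx : (fderiv ℝ f v e1).1 • e0 + (-(fderiv ℝ f v e0).1) • e1 = 0
    · exfalso
      obtain ⟨k1, k2⟩ := hne _ _ hy
      obtain ⟨k3, k4⟩ := hne _ _ hx
      rw [neg_eq_zero] at k2 k4
      rcases exists_not_vertical hfi with h | h
      · apply h; rw [← he0, k2, k4]; ring
      · apply h; rw [← he1, k1, k3]; ring
    · refine key _ hx ?_ ?_ <;> simp
      · ring
      · linear_combination -hdet
  · refine key _ hy ?_ ?_ <;> simp
    · linear_combination hdet
    · ring

/-- Translation by `p` changes g(n, V) by a multiple of (p₁ a₂ - p₂ a₁) n₃. If that determinant is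
nonzero, the surface is vertical and its section is straight in the direction (p₁, p₂). The planar
equation then has zero curvature on one side and a nonzero normal component of (a₁, a₂) on the
other. -/
theorem parallel_of_invariant {lam : ℝ} (hlam : 0 < lam) {a p : Nil}
    (hp : p.1 ^ 2 + p.2.1 ^ 2 ≠ 0) {S : ImmersedSurface}
    (hinv : InvariantUnder S.toFun (transGroup p)) (hS : IsTranslator lam S.toFun a) :
    p.1 * a.2.1 - p.2.1 * a.1 = 0 := by
  by_contra hne
  obtain ⟨q⟩ := S.nonempty
  set c := chartAt Plane q with hc
  have hq : c q ∈ c.target := c.map_source (mem_chart_source Plane q)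
  have hnhds := c.open_target.mem_nhds hq
  set f := localRep S.toFun q
  have hvert : ∀ w ∈ c.target, ∃ ζ, fderiv ℝ f w ζ = (0, 0, 1) := by
    intro w hw
    refine exists_vertical_of_normal_horizontal hlam (S.injective_fderiv_localRep q hw)
      fun n hn => ?_
    obtain ⟨ψ, hψ, -, hψF⟩ := hinv
    have h := metric_killingField_of_invariant hlam hS (frameMap_leftTrans lam ((1 : ℝ) • p))
      (ψ := ψ 1) (hψ.comp (continuous_const.prodMk continuous_id)) (hψF 1) q hw hn
    simp only [metric, killingField, leftTrans, mul, LinearMap.id_apply, one_smul] at h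
    have h2 : lam * (p.1 * a.2.1 - p.2.1 * a.1) * n.2.2 = 0 := by linear_combination -h
    exact (mul_eq_zero.1 h2).resolve_left (mul_ne_zero hlam.ne' hne)
  have hpar : ∀ e, ∀ w ∈ c.target,
      (fderiv ℝ f w e).1 * p.2.1 - p.1 * (fderiv ℝ f w e).2.1 = 0 := by
    intro e w hw
    obtain ⟨ζ, hζ⟩ := hvert w hw
    obtain ⟨K, hK⟩ := exists_tangentAlong_eq_killingField hinv q hw
    have h1 := rank_le_one_of_vertical hζ e K
    have k1 : (fderiv ℝ f w K).1 = p.1 := (Prod.ext_iff.1 hK).1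
    have k2 : (fderiv ℝ f w K).2.1 = p.2.1 := (Prod.ext_iff.1 (Prod.ext_iff.1 hK).2).1
    rw [k1, k2] at h1
    exact h1
  have hf := S.contDiffAt_localRep q hq
  have hfi := S.injective_fderiv_localRep q hq
  obtain ⟨e, he⟩ : ∃ e, (fderiv ℝ f (c q) e).1 ^ 2 + (fderiv ℝ f (c q) e).2.1 ^ 2 ≠ 0 := by
    rcases exists_not_vertical hfi with h | h
    exacts [⟨_, h⟩, ⟨_, h⟩]
  have h1 := (translatorAt_vertical_iff hlam a hf hfi
    (Filter.mem_of_superset hnhds hvert)).1 (hS.translatorAt_localRep hlam q hq) e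
  have hG := hasFDerivAt_fderiv_apply hf e
  have hd := (hG.fst.mul_const p.2.1).sub (hG.snd.fst.const_mul p.1)
  have h3 := (hasFDerivAt_const (𝕜 := ℝ) (0 : ℝ) (c q)).congr_of_eventuallyEq
    (Filter.mem_of_superset hnhds (hpar e))
  have h4 := congrArg (fun L : Plane →L[ℝ] ℝ => L e) (hd.unique h3)
  simp at h4
  have h5 := hpar e (c q) hq
  set D := fderiv ℝ f (c q) e
  set D2 := fderiv ℝ (fderiv ℝ f) (c q) e e
  have hρ : (D.1 * p.1 + D.2.1 * p.2.1) ^ 2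
      = (p.1 ^ 2 + p.2.1 ^ 2) * (D.1 ^ 2 + D.2.1 ^ 2) := by
    linear_combination (-(D.1 * p.2.1 - p.1 * D.2.1)) * h5
  have hρ0 : D.1 * p.1 + D.2.1 * p.2.1 ≠ 0 := by
    intro h0
    rw [h0] at hρ
    exact mul_ne_zero hp he (by rw [← hρ]; ring)
  refine mul_ne_zero (mul_ne_zero he hρ0) hne ?_
  have e1 : (p.1 ^ 2 + p.2.1 ^ 2) * D.1 = (D.1 * p.1 + D.2.1 * p.2.1) * p.1 := by
    linear_combination p.2.1 * h5
  have e2 : (p.1 ^ 2 + p.2.1 ^ 2) * D.2.1 = (D.1 * p.1 + D.2.1 * p.2.1) * p.2.1 := by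
    linear_combination -p.1 * h5
  linear_combination (-(p.1 ^ 2 + p.2.1 ^ 2)) * h1 + (D2.2.1 - (D.1 ^ 2 + D.2.1 ^ 2) * a.2.1) * e1
    + ((D.1 ^ 2 + D.2.1 ^ 2) * a.1 - D2.1) * e2 - (D.1 * p.1 + D.2.1 * p.2.1) * h4

/-- The Killing field of `p` is tangent to the invariant surface, so adding a multiple of it to V
leaves g(n, V) unchanged. -/
theorem isTranslator_add_smul_iff {lam : ℝ} (hlam : 0 < lam) {a p : Nil} (c : ℝ)
    {S : ImmersedSurface} (hinv : InvariantUnder S.toFun (transGroup p)) :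
    IsTranslator lam S.toFun (a + c • p) ↔ IsTranslator lam S.toFun a := by
  rw [isTranslator_iff hlam, isTranslator_iff hlam]
  refine forall_congr' fun q => forall_congr' fun n => imp_congr_right fun hn => ?_
  obtain ⟨K, hK⟩ := exists_tangentAlong_eq_killingField hinv q
    ((chartAt Plane q).map_source (mem_chart_source Plane q))
  rw [killingField_add_smul, metric_add_right, metric_smul_right, ← hK, hn.metric_tangentAlong K,
    mul_zero, add_zero]

theorem isTranslator_iff_isVerticalTranslator {lam : ℝ} (hlam : 0 < lam)
    {a₁ a₂ a₃ x₀ y₀ z₀ c s : ℝ} (hc : (a₁, a₂) = (c * x₀, c * y₀))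
    (hs : s = (a₃ - c * z₀) * √lam) {S : ImmersedSurface}
    (hinv : InvariantUnder S.toFun (transGroup (x₀, y₀, z₀))) :
    IsTranslator lam S.toFun (a₁, a₂, a₃) ↔ IsVerticalTranslator lam S.toFun s := by
  simp only [Prod.mk.injEq] at hc
  have h : ((a₁, a₂, a₃) : Nil) = (0, 0, s / √lam) + c • (x₀, y₀, z₀) := by
    have := (Real.sqrt_pos.2 hlam).ne'
    rw [hs, mul_div_cancel_right₀ _ this, hc.1, hc.2]
    refine Prod.ext ?_ (Prod.ext ?_ ?_) <;> simp
  rw [h, isTranslator_add_smul_iff hlam c hinv]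
  rfl

/-- A vertical plane is a translator. -/
theorem exists_invariant_translator {lam : ℝ} (hlam : 0 < lam) {a₁ a₂ : ℝ} (a₃ : ℝ)
    (ha : a₁ ^ 2 + a₂ ^ 2 ≠ 0) {x₀ y₀ : ℝ} (z₀ c : ℝ) (hc : (a₁, a₂) = (c * x₀, c * y₀)) :
    ∃ S : ImmersedSurface, InvariantUnder S.toFun (transGroup (x₀, y₀, z₀)) ∧
      IsTranslator lam S.toFun (a₁, a₂, a₃) := by
  simp only [Prod.mk.injEq] at hc
  obtain ⟨rfl, rfl⟩ := hc
  have hxy : x₀ ≠ 0 ∨ y₀ ≠ 0 := by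
    by_contra! h
    apply ha
    rw [h.1, h.2]
    ring
  have hlin : ∀ r : ℝ, ContDiff ℝ ∞ fun t : ℝ => t * r := fun r => by fun_prop
  have hreg : ∀ t : ℝ, deriv (fun t : ℝ => t * x₀) t ≠ 0 ∨ deriv (fun t : ℝ => t * y₀) t ≠ 0 := by
    intro t
    simpa using hxy
  have hinv : InvariantUnder (curveCylinder (fun t => t * x₀) fun t => t * y₀)
      (transGroup (x₀, y₀, z₀)) := by
    refine ⟨fun u v => v + (u • EuclideanSpace.single 0 1
      + (u * z₀) • EuclideanSpace.single 1 1 : Plane), by fun_prop, fun q => by simp,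
      fun u v => ?_⟩
    refine Prod.ext ?_ (Prod.ext ?_ ?_) <;> simp [curveCylinder, transGroup, leftTrans, mul] <;>
      ring
  refine ⟨planeSurface (curveCylinder (fun t => t * x₀) fun t => t * y₀)
    (contDiff_curveCylinder (hlin x₀) (hlin y₀))
    (injective_fderiv_curveCylinder (hlin x₀) (hlin y₀) hreg), hinv,
    isTranslator_of_subset_cylinder hlam a₃ ha
      (invariantUnder_curveCylinder (fun t => t * x₀) fun t => t * y₀) (0, 0) (Or.inr ?_)⟩
  rintro _ ⟨v, rfl⟩
  change _ = _
  simp only [planeSurface, curveCylinder]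
  ring

/-! ### Rescaling -/

theorem exists_rot_angle (A B : ℝ) : ∃ θ : ℝ,
    A * Real.cos θ - B * Real.sin θ = √(A ^ 2 + B ^ 2) ∧
      A * Real.sin θ + B * Real.cos θ = 0 := by
  by_cases h : (⟨A, B⟩ : ℂ) = 0
  · have hA : A = 0 := congrArg Complex.re h
    have hB : B = 0 := congrArg Complex.im h
    exact ⟨0, by simp [hA, hB], by simp [hA, hB]⟩
  · have hn : ‖(⟨A, B⟩ : ℂ)‖ = √(A ^ 2 + B ^ 2) := by
      rw [Complex.norm_def, Complex.normSq_mk]; ring_nf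
    have h0 : 0 < ‖(⟨A, B⟩ : ℂ)‖ := norm_pos_iff.2 h
    have hsq : √(A ^ 2 + B ^ 2) ^ 2 = A ^ 2 + B ^ 2 := Real.sq_sqrt (by positivity)
    refine ⟨-Complex.arg ⟨A, B⟩, ?_, ?_⟩ <;>
      rw [Real.cos_neg, Real.sin_neg, Complex.cos_arg h, Complex.sin_arg, hn] <;> rw [hn] at h0 <;>
      field_simp
    · rw [hsq]; ring
    · ring

theorem rescale_mul (s : ℝ) (p q : Nil) :
    rescale s (mul p q) = mul (rescale s p) (rescale s q) := by
  refine Prod.ext ?_ (Prod.ext ?_ ?_) <;> simp only [rescale, mul] <;> ring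

theorem invariantUnder_image_iff {S : ImmersedSurface} {Φ : Nil → Nil}
    (hΦ : Function.Injective Φ) {p p' : Nil} {κ : ℝ} (hκ : κ ≠ 0)
    (h : ∀ u x, Φ (leftTrans (u • p) x) = leftTrans ((κ * u) • p') (Φ x)) :
    InvariantUnder S.toFun (transGroup p) ↔ InvariantUnder (Φ ∘ S.toFun) (transGroup p') := by
  constructor
  · rintro ⟨ψ, h1, h2, h3⟩
    refine ⟨fun u => ψ (κ⁻¹ * u), h1.comp (by fun_prop : Continuous fun x : ℝ × S.carrier =>
      (κ⁻¹ * x.1, x.2)), by simpa using h2, fun u q => ?_⟩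
    simp only [Function.comp, h3, transGroup, h]
    rw [mul_inv_cancel_left₀ hκ]
  · rintro ⟨ψ, h1, h2, h3⟩
    refine ⟨fun u => ψ (κ * u), h1.comp (by fun_prop : Continuous fun x : ℝ × S.carrier =>
      (κ * x.1, x.2)), by simpa using h2, fun u q => hΦ ?_⟩
    have := h3 (κ * u) q
    simp only [Function.comp, transGroup] at this ⊢
    rw [this, h]

/-- The homothety divides curvatures by |s|, and its vertical component ±s² carries the sign of s.
Pairing the transported normal with the unit vertical vector of the new metric gives the old pairing
with speed s. The rotation `rot θ` has no effect on it. -/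
theorem isVerticalTranslator_rescale_iff {lam s : ℝ} (hlam : 0 < lam) (hs : s ≠ 0) (θ : ℝ)
    (S : ImmersedSurface) : IsVerticalTranslator lam S.toFun s ↔
      IsVerticalTranslator (lam / s ^ 2) (rot θ ∘ rescale s ∘ S.toFun) 1 := by
  have hΦ := (frameMap_rot (lam / s ^ 2) θ).comp (frameMap_rescale lam hs)
  have hlam' : 0 < lam / s ^ 2 := by positivity
  change IsTranslator _ _ _ ↔ IsTranslator (lam / s ^ 2) (S.image hΦ).toFun _
  rw [isTranslator_iff hlam, isTranslator_iff hlam']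
  refine forall_congr' fun q => ?_
  have hq : chartAt Plane q q ∈ (chartAt Plane q).target :=
    (chartAt Plane q).map_source (mem_chart_source Plane q)
  have h := hΦ.translatorAt_comp_iff hlam (0, 0, 1 / √(lam / s ^ 2))
    (S.contDiffAt_localRep q hq) (S.injective_fderiv_localRep q hq)
  refine Iff.trans ?_ h.symm
  refine forall_congr' fun n => imp_congr_right fun hn => ?_
  have hsq : √(lam / s ^ 2) = √lam / |s| := by
    rw [Real.sqrt_div hlam.le, Real.sqrt_sq_eq_abs]
  have hl := (Real.sqrt_pos.2 hlam).ne'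
  have ha := abs_ne_zero.2 hs
  have e : metric lam n (killingField (0, 0, s / √lam) (localRep S.toFun q (chartAt Plane q q)))
      = metric (lam / s ^ 2) ((rotLinear θ ∘ₗ rescaleLinear s) n)
        (killingField (0, 0, 1 / √(lam / s ^ 2))
          ((rot θ ∘ rescale s) (localRep S.toFun q (chartAt Plane q q)))) := by
    rw [hsq]
    have hab := sq_abs s
    simp only [metric, killingField, rotLinear, rescaleLinear, rot, rescale, LinearMap.comp_apply,
      LinearMap.coe_mk, AddHom.coe_mk]
    field_simp
    simp only [zero_mul, add_zero, sub_zero, zero_add]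
    linear_combination -(lam * n.2.2) * hab
  rw [e]

theorem exists_rescaling {lam : ℝ} (hlam : 0 < lam) {a₁ a₂ a₃ x₀ y₀ z₀ c s : ℝ}
    (hxy : x₀ ^ 2 + y₀ ^ 2 ≠ 0) (hc : (a₁, a₂) = (c * x₀, c * y₀))
    (hs : s = (a₃ - c * z₀) * √lam) (hs0 : s ≠ 0) :
    ∃ θ : ℝ, ∀ S : ImmersedSurface,
      ((InvariantUnder S.toFun (transGroup (x₀, y₀, z₀)) ∧
          IsTranslator lam S.toFun (a₁, a₂, a₃)) ↔
        (InvariantUnder (rot θ ∘ rescale s ∘ S.toFun)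
            (transGroup (1, 0, |s| * |z₀| / √(x₀ ^ 2 + y₀ ^ 2))) ∧
          IsVerticalTranslator (lam / s ^ 2) (rot θ ∘ rescale s ∘ S.toFun) 1)) := by
  set r := √(x₀ ^ 2 + y₀ ^ 2) with hr
  have hr0 : 0 < r := Real.sqrt_pos.2 (lt_of_le_of_ne (by positivity) hxy.symm)
  -- The sign `σ` reverses the parameter of the group when needed, to make the slope `k`
  -- nonnegative.
  obtain ⟨σ, hσ, hσz⟩ : ∃ σ : ℝ, σ ^ 2 = 1 ∧ σ * (|s| * |z₀|) = s * z₀ := by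
    rw [← abs_mul]
    rcases abs_choice (s * z₀) with h | h
    · exact ⟨1, by norm_num, by rw [h]; ring⟩
    · exact ⟨-1, by norm_num, by rw [h]; ring⟩
  have hσ0 : σ ≠ 0 := by rintro rfl; norm_num at hσ
  -- The rotation takes the rescaled direction, with sign `σ`, to the positive x-axis.
  obtain ⟨θ, h1, h2⟩ := exists_rot_angle (σ * (|s| * x₀)) (σ * (s * y₀))
  have hnorm : √((σ * (|s| * x₀)) ^ 2 + (σ * (s * y₀)) ^ 2) = |s| * r := by
    rw [show (σ * (|s| * x₀)) ^ 2 + (σ * (s * y₀)) ^ 2 = |s| ^ 2 * (x₀ ^ 2 + y₀ ^ 2) by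
      rw [mul_pow, mul_pow σ, hσ, mul_pow, mul_pow, sq_abs]; ring, Real.sqrt_mul (sq_nonneg _),
      Real.sqrt_sq (abs_nonneg s)]
  rw [hnorm] at h1
  have ha := abs_pos.2 hs0
  refine ⟨θ, fun S => ?_⟩
  have hκ : σ * (|s| * r) ≠ 0 := mul_ne_zero hσ0 (mul_pos ha hr0).ne'
  have hinj : Function.Injective (rot θ ∘ rescale s) := by
    refine Function.Injective.comp (fun x y h => ?_) (fun x y h => ?_)
    · have := congrArg (rot (-θ)) h
      simpa only [rot_rot, neg_add_cancel, rot_zero] using this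
    · simp only [rescale, Prod.mk.injEq] at h
      obtain ⟨k1, k2, k3⟩ := h
      exact Prod.ext (mul_left_cancel₀ ha.ne' k1) (Prod.ext (mul_left_cancel₀ hs0 k2)
        (mul_left_cancel₀ (mul_ne_zero ha.ne' hs0) k3))
  have hmor : ∀ u x, (rot θ ∘ rescale s) (leftTrans (u • ((x₀, y₀, z₀) : Nil)) x)
      = leftTrans ((σ * (|s| * r) * u) • ((1, 0, |s| * |z₀| / r) : Nil))
        ((rot θ ∘ rescale s) x) := by
    intro u x
    simp only [Function.comp, leftTrans, rescale_mul, rot_mul]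
    congr 1
    refine Prod.ext ?_ (Prod.ext ?_ ?_) <;>
      simp only [rot, rescale, Prod.smul_mk, smul_eq_mul, mul_one, mul_zero]
    · linear_combination σ * u * h1
        - (|s| * (u * x₀) * Real.cos θ - s * (u * y₀) * Real.sin θ) * hσ
    · linear_combination σ * u * h2
        - (|s| * (u * x₀) * Real.sin θ + s * (u * y₀) * Real.cos θ) * hσ
    · field_simp
      linear_combination (-u) * hσz
  have hI : InvariantUnder S.toFun (transGroup (x₀, y₀, z₀)) ↔
      InvariantUnder (rot θ ∘ rescale s ∘ S.toFun) (transGroup (1, 0, |s| * |z₀| / r)) :=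
    invariantUnder_image_iff hinj hκ hmor
  rw [← hI, ← isVerticalTranslator_rescale_iff hlam hs0 θ S]
  exact and_congr_right fun hinv => isTranslator_iff_isVerticalTranslator hlam hc hs hinv

/-! ### Translators that are graphs over a strip -/

/-- The surface swept by the left translates of the curve `(-e₂ y, e₁ y, g)` in the direction
`(e₁, e₂, k)`. -/
def ruledGraph (e₁ e₂ k : ℝ) (y g : ℝ → ℝ) : Plane → Nil := fun v =>
  (e₁ * v 0 - e₂ * y (v 1), e₂ * v 0 + e₁ * y (v 1), k * v 0 + v 0 * y (v 1) / 2 + g (v 1))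

theorem contDiff_ruledGraph (e₁ e₂ k : ℝ) {y g : ℝ → ℝ} (hy : ContDiff ℝ ∞ y)
    (hg : ContDiff ℝ ∞ g) : ContDiff ℝ ∞ (ruledGraph e₁ e₂ k y g) := by
  have h0 := contDiff_coord 0
  have hy1 := hy.comp (contDiff_coord 1)
  have hg1 := hg.comp (contDiff_coord 1)
  exact ((contDiff_const.mul h0).sub (contDiff_const.mul hy1)).prodMk
    (((contDiff_const.mul h0).add (contDiff_const.mul hy1)).prodMk
      (((contDiff_const.mul h0).add ((h0.mul hy1).div_const 2)).add hg1))

theorem fderiv_ruledGraph (e₁ e₂ k : ℝ) {y g : ℝ → ℝ} {y' g' : ℝ} {v : Plane}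
    (hy : HasDerivAt y y' (v 1)) (hg : HasDerivAt g g' (v 1)) (X : Plane) :
    fderiv ℝ (ruledGraph e₁ e₂ k y g) v X
      = (e₁ * X 0 - e₂ * (y' * X 1), e₂ * X 0 + e₁ * (y' * X 1),
        k * X 0 + (v 0 * (y' * X 1) + y (v 1) * X 0) / 2 + g' * X 1) := by
  have h0 := hasFDerivAt_coord 0 v
  have hy1 := hy.comp_hasFDerivAt v (hasFDerivAt_coord 1 v)
  have hg1 := hg.comp_hasFDerivAt v (hasFDerivAt_coord 1 v)
  have h : HasFDerivAt (ruledGraph e₁ e₂ k y g) _ v :=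
    ((h0.const_mul e₁).sub (hy1.const_mul e₂)).prodMk
      (((h0.const_mul e₂).add (hy1.const_mul e₁)).prodMk
        (((h0.const_mul k).add ((h0.mul hy1).mul_const (2 : ℝ)⁻¹)).add hg1))
  rw [h.fderiv]
  refine Prod.ext ?_ (Prod.ext ?_ ?_) <;> simp
  ring

theorem injective_fderiv_ruledGraph {e₁ e₂ : ℝ} (he : e₁ ^ 2 + e₂ ^ 2 = 1) (k : ℝ)
    {y g : ℝ → ℝ} {y' g' : ℝ} {v : Plane} (hy : HasDerivAt y y' (v 1))
    (hg : HasDerivAt g g' (v 1)) (h0 : y' ≠ 0) :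
    Function.Injective (fderiv ℝ (ruledGraph e₁ e₂ k y g) v) := by
  refine (injective_iff_map_eq_zero _).2 fun X hX => ?_
  rw [fderiv_ruledGraph e₁ e₂ k hy hg] at hX
  simp only [Prod.mk_eq_zero] at hX
  obtain ⟨k1, k2, -⟩ := hX
  have k0 : X 0 = 0 := by linear_combination e₁ * k1 + e₂ * k2 - X 0 * he
  have k3 : y' * X 1 = 0 := by linear_combination e₁ * k2 - e₂ * k1 - y' * X 1 * he
  rw [plane_eq X, k0, (mul_eq_zero.1 k3).resolve_left h0]
  simp

/-- The translator equation for a ruled graph whose profile has slope `G = dg/dy`. -/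
theorem translatorAt_ruledGraph {lam : ℝ} (hlam : 0 < lam) {e₁ e₂ : ℝ}
    (he : e₁ ^ 2 + e₂ ^ 2 = 1) {k σ : ℝ} {y y' y'' g G G' : ℝ → ℝ}
    (hy : ∀ t, HasDerivAt y (y' t) t) (hy' : ∀ t, HasDerivAt y' (y'' t) t)
    (hG : ∀ t, HasDerivAt G (G' t) t) (hg : ∀ t, HasDerivAt g (y' t * G t) t)
    (h0 : ∀ t, y' t ≠ 0)
    (h : ∀ t, (1 + lam * (k + y t) ^ 2) * G' t - lam * (k + y t) * G t * y' t
      = σ * y' t * (1 + lam * (k + y t) ^ 2 + lam * G t ^ 2)) (v : Plane) :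
    TranslatorAt lam (0, 0, σ) (ruledGraph e₁ e₂ k y g) v := by
  have hT0 : tangentVec (ruledGraph e₁ e₂ k y g) 0 = fun v => (e₁, e₂, k + y (v 1)) := by
    funext v
    rw [tangentVec, fderiv_ruledGraph e₁ e₂ k (hy _) (hg _)]
    refine Prod.ext ?_ (Prod.ext ?_ ?_) <;> simp [frameComp, ruledGraph]
    linear_combination (y (v 1) / 2) * he
  have hT1 : tangentVec (ruledGraph e₁ e₂ k y g) 1
      = fun v => (-e₂ * y' (v 1), e₁ * y' (v 1), y' (v 1) * G (v 1)) := by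
    funext v
    rw [tangentVec, fderiv_ruledGraph e₁ e₂ k (hy _) (hg _)]
    refine Prod.ext ?_ (Prod.ext ?_ ?_) <;> simp [frameComp, ruledGraph]
    linear_combination (-(v 0 * y' (v 1)) / 2) * he
  have hd0 : ∀ X : Plane, fderiv ℝ (fun v : Plane => (e₁, e₂, k + y (v 1))) v X
      = (0, 0, y' (v 1) * X 1) := by
    intro X
    have hF : HasFDerivAt (fun v : Plane => (e₁, e₂, k + y (v 1))) _ v :=
      (hasFDerivAt_const e₁ v).prodMk ((hasFDerivAt_const e₂ v).prodMk
        (((hy (v 1)).comp_hasFDerivAt v (hasFDerivAt_coord 1 v)).const_add k))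
    rw [hF.fderiv]
    refine Prod.ext ?_ (Prod.ext ?_ ?_) <;> simp
  have hd1 : ∀ X : Plane, fderiv ℝ (fun v : Plane =>
      (-e₂ * y' (v 1), e₁ * y' (v 1), y' (v 1) * G (v 1))) v X
      = (-e₂ * (y'' (v 1) * X 1), e₁ * (y'' (v 1) * X 1),
        (y'' (v 1) * G (v 1) + y' (v 1) * G' (v 1)) * X 1) := by
    intro X
    have hy1 := (hy' (v 1)).comp_hasFDerivAt v (hasFDerivAt_coord 1 v)
    have hF : HasFDerivAt (fun v : Plane =>
        (-e₂ * y' (v 1), e₁ * y' (v 1), y' (v 1) * G (v 1))) _ v :=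
      (hy1.const_mul (-e₂)).prodMk ((hy1.const_mul e₁).prodMk
        (hy1.mul ((hG (v 1)).comp_hasFDerivAt v (hasFDerivAt_coord 1 v))))
    rw [hF.fderiv]
    refine Prod.ext ?_ (Prod.ext ?_ ?_) <;> simp
    ring
  have hfi := injective_fderiv_ruledGraph he k (hy (v 1)) (hg (v 1)) (h0 (v 1))
  rw [translatorAt_iff_forall_normal hlam _ (gram_tangentVec_pos hlam hfi).ne']
  intro m h1 h2
  simp only [secondForm, covDeriv, Matrix.of_apply, hT0, hT1, hd0, hd1] at h1 h2 ⊢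
  have h := h (v 1)
  have h0 := h0 (v 1)
  generalize y (v 1) = Y at *
  generalize y' (v 1) = Y1 at *
  generalize y'' (v 1) = Y2 at *
  generalize G (v 1) = g0 at *
  generalize G' (v 1) = g1 at *
  rw [gram]
  generalize hW : k + Y = W at *
  -- In the basis (e₁, e₂), (-e₂, e₁) the two orthogonality relations express the horizontal part of
  -- `m` by its third component, so every term becomes a multiple of `m.2.2`.
  have k1 : m.1 * e₁ + m.2.1 * e₂ = -(lam * W * m.2.2) := by
    simp only [metric] at h1
    linear_combination h1
  have k2 : -m.1 * e₂ + m.2.1 * e₁ = -(lam * g0 * m.2.2) := by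
    simp only [metric] at h2
    apply mul_left_cancel₀ h0
    linear_combination h2
  have E00 : metric lam (e₁, e₂, W) (e₁, e₂, W) = 1 + lam * W ^ 2 := by
    simp only [metric]; linear_combination he
  have E01 : metric lam (e₁, e₂, W) (-e₂ * Y1, e₁ * Y1, Y1 * g0) = lam * W * Y1 * g0 := by
    simp only [metric]; ring
  have E11 : metric lam (-e₂ * Y1, e₁ * Y1, Y1 * g0) (-e₂ * Y1, e₁ * Y1, Y1 * g0)
      = Y1 ^ 2 * (1 + lam * g0 ^ 2) := by
    simp only [metric]; linear_combination Y1 ^ 2 * he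
  have F00 : metric lam ((0, 0, Y1 * (EuclideanSpace.single 0 1 : Plane) 1)
      + conn lam (e₁, e₂, W) (e₁, e₂, W)) m = lam ^ 2 * W * g0 * m.2.2 := by
    simp [metric, conn]; linear_combination -(lam * W) * k2
  have F01 : metric lam ((-e₂ * (Y2 * (EuclideanSpace.single 0 1 : Plane) 1),
      e₁ * (Y2 * (EuclideanSpace.single 0 1 : Plane) 1),
      (Y2 * g0 + Y1 * g1) * (EuclideanSpace.single 0 1 : Plane) 1)
      + conn lam (e₁, e₂, W) (-e₂ * Y1, e₁ * Y1, Y1 * g0)) m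
      = lam * Y1 / 2 * (1 - lam * W ^ 2 + lam * g0 ^ 2) * m.2.2 := by
    simp [metric, conn]
    linear_combination lam / 2 * Y1 * W * k1 - lam / 2 * Y1 * g0 * k2 + lam * m.2.2 * Y1 / 2 * he
  have F10 : metric lam ((0, 0, Y1 * (EuclideanSpace.single 1 1 : Plane) 1)
      + conn lam (-e₂ * Y1, e₁ * Y1, Y1 * g0) (e₁, e₂, W)) m
      = lam * Y1 / 2 * (1 - lam * W ^ 2 + lam * g0 ^ 2) * m.2.2 := by
    simp [metric, conn]
    linear_combination lam / 2 * Y1 * W * k1 - lam / 2 * Y1 * g0 * k2 - lam * m.2.2 * Y1 / 2 * he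
  have F11 : metric lam ((-e₂ * (Y2 * (EuclideanSpace.single 1 1 : Plane) 1),
      e₁ * (Y2 * (EuclideanSpace.single 1 1 : Plane) 1),
      (Y2 * g0 + Y1 * g1) * (EuclideanSpace.single 1 1 : Plane) 1)
      + conn lam (-e₂ * Y1, e₁ * Y1, Y1 * g0) (-e₂ * Y1, e₁ * Y1, Y1 * g0)) m
      = lam * Y1 * (g1 - lam * Y1 * g0 * W) * m.2.2 := by
    simp [metric, conn]
    linear_combination Y2 * k2 + lam * Y1 ^ 2 * g0 * k1
  have FV : metric lam m (killingField (0, 0, σ) (ruledGraph e₁ e₂ k y g v))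
      = lam * m.2.2 * σ := by
    simp [metric, killingField]; ring
  rw [E00, E01, E11, F00, F01, F10, F11, FV]
  linear_combination lam * m.2.2 * Y1 * h

/-! ### The complete solution -/

/-- The inclination of the solution at the parameter `t`. -/
def stripAngle (lam s C t : ℝ) : ℝ := C + √lam / s * Real.arctan t

/-- The distance of the ruling at the parameter `t` from the axis. -/
def stripProfile (lam s k C t : ℝ) : ℝ := Real.sinh (stripAngle lam s C t) / √lam - k

/-- The derivative of `stripProfile`. -/
def stripProfileDeriv (lam s C t : ℝ) : ℝ :=
  Real.cosh (stripAngle lam s C t) / (s * (1 + t ^ 2))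

/-- The slope of the solution across the rulings. -/
def stripSlope (lam s C t : ℝ) : ℝ := Real.cosh (stripAngle lam s C t) * t / √lam

/-- The height of the solution. -/
def stripHeight (lam s C t : ℝ) : ℝ :=
  ∫ τ in (0 : ℝ)..t, stripProfileDeriv lam s C τ * stripSlope lam s C τ

theorem one_add_sq_ne_zero (t : ℝ) : 1 + t ^ 2 ≠ 0 := by positivity

theorem contDiff_stripAngle (lam s C : ℝ) : ContDiff ℝ ∞ (stripAngle lam s C) :=
  contDiff_const.add (contDiff_const.mul Real.contDiff_arctan)

theorem contDiff_stripProfile (lam s k C : ℝ) : ContDiff ℝ ∞ (stripProfile lam s k C) :=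
  ((Real.contDiff_sinh.comp (contDiff_stripAngle lam s C)).div_const _).sub contDiff_const

theorem contDiff_stripProfileDeriv {lam s : ℝ} (hs : s ≠ 0) (C : ℝ) :
    ContDiff ℝ ∞ (stripProfileDeriv lam s C) :=
  (Real.contDiff_cosh.comp (contDiff_stripAngle lam s C)).div
    (contDiff_const.mul (contDiff_const.add (contDiff_id.pow 2)))
    fun t => mul_ne_zero hs (one_add_sq_ne_zero t)

theorem contDiff_stripSlope (lam s C : ℝ) : ContDiff ℝ ∞ (stripSlope lam s C) :=
  ((Real.contDiff_cosh.comp (contDiff_stripAngle lam s C)).mul contDiff_id).div_const _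

theorem hasDerivAt_stripAngle (lam s C t : ℝ) :
    HasDerivAt (stripAngle lam s C) (√lam / s * (1 / (1 + t ^ 2))) t :=
  ((Real.hasDerivAt_arctan t).const_mul _).const_add C

theorem hasDerivAt_stripProfile {lam : ℝ} (hlam : 0 < lam) (s k C t : ℝ) :
    HasDerivAt (stripProfile lam s k C) (stripProfileDeriv lam s C t) t := by
  have := (((hasDerivAt_stripAngle lam s C t).sinh).div_const √lam).sub_const k
  refine this.congr_deriv ?_
  have hl := (Real.sqrt_pos.2 hlam).ne'
  rw [stripProfileDeriv]
  field_simp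

theorem hasDerivAt_stripSlope (lam s C t : ℝ) : HasDerivAt (stripSlope lam s C)
    ((Real.sinh (stripAngle lam s C t) * (√lam / s * (1 / (1 + t ^ 2))) * t
      + Real.cosh (stripAngle lam s C t)) / √lam) t := by
  have := (((hasDerivAt_stripAngle lam s C t).cosh).mul (hasDerivAt_id t)).div_const √lam
  rw [mul_one] at this
  exact this

theorem hasDerivAt_stripHeight {lam s : ℝ} (hs : s ≠ 0) (C t : ℝ) :
    HasDerivAt (stripHeight lam s C) (stripProfileDeriv lam s C t * stripSlope lam s C t) t := by
  have hc : Continuous fun τ => stripProfileDeriv lam s C τ * stripSlope lam s C τ :=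
    (contDiff_stripProfileDeriv hs C).continuous.mul (contDiff_stripSlope lam s C).continuous
  exact intervalIntegral.integral_hasDerivAt_right (hc.intervalIntegrable _ _)
    (hc.stronglyMeasurableAtFilter _ _) hc.continuousAt

theorem contDiff_stripHeight {lam s : ℝ} (hs : s ≠ 0) (C : ℝ) :
    ContDiff ℝ ∞ (stripHeight lam s C) := by
  rw [contDiff_infty_iff_deriv]
  refine ⟨fun t => (hasDerivAt_stripHeight hs C t).differentiableAt, ?_⟩
  rw [show deriv (stripHeight lam s C) = _ from
    funext fun t => (hasDerivAt_stripHeight hs C t).deriv]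
  exact (contDiff_stripProfileDeriv hs C).mul (contDiff_stripSlope lam s C)

theorem stripProfileDeriv_ne_zero {lam s : ℝ} (hs : s ≠ 0) (C t : ℝ) :
    stripProfileDeriv lam s C t ≠ 0 :=
  div_ne_zero (Real.cosh_pos _).ne' (mul_ne_zero hs (one_add_sq_ne_zero t))

/-- With √lam (k + y) = sinh φ and G = t cosh φ / √lam, the left side collapses to cosh³ φ / √lam
and the right side to (s/√lam) φ' (1 + t²) cosh³ φ / √lam. The equation is therefore φ' = √lam / (s
(1 + t²)). -/
theorem strip_equation {lam s : ℝ} (hlam : 0 < lam) (hs : s ≠ 0) (k C t : ℝ) :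
    (1 + lam * (k + stripProfile lam s k C t) ^ 2)
        * ((Real.sinh (stripAngle lam s C t) * (√lam / s * (1 / (1 + t ^ 2))) * t
          + Real.cosh (stripAngle lam s C t)) / √lam)
      - lam * (k + stripProfile lam s k C t) * stripSlope lam s C t * stripProfileDeriv lam s C t
      = s / √lam * stripProfileDeriv lam s C t * (1 + lam * (k + stripProfile lam s k C t) ^ 2
        + lam * stripSlope lam s C t ^ 2) := by
  have hl := (Real.sqrt_pos.2 hlam).ne'
  have hl2 := Real.sq_sqrt hlam.le
  have ht := one_add_sq_ne_zero t
  have hc := Real.cosh_sq (stripAngle lam s C t)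
  simp only [stripProfile, stripSlope, stripProfileDeriv, add_sub_cancel]
  generalize √lam = l at *
  generalize Real.sinh (stripAngle lam s C t) = S at *
  generalize Real.cosh (stripAngle lam s C t) = K at *
  subst hl2
  have hS : S ^ 2 = K ^ 2 - 1 := by rw [hc]; ring
  field_simp
  rw [hS]
  ring

/-- The height is at least logarithmic in the parameter. -/
theorem log_le_stripHeight {lam s : ℝ} (hlam : 0 < lam) (hs : s ≠ 0) (C t : ℝ) :
    Real.log (1 + t ^ 2) / (2 * √lam) ≤ s * stripHeight lam s C t := by
  have hl := Real.sqrt_pos.2 hlam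
  set F : ℝ → ℝ := fun t => s * stripHeight lam s C t - Real.log (1 + t ^ 2) / (2 * √lam) with hF
  -- Writing cosh² = 1 + sinh², the 1 accounts for the logarithm; the surplus has the sign of t, so
  -- `F` has its minimum at 0.
  have hd : ∀ t, HasDerivAt F
      (Real.sinh (stripAngle lam s C t) ^ 2 / (√lam * (1 + t ^ 2)) * t) t := by
    intro t
    have h1 := (hasDerivAt_stripHeight (lam := lam) hs C t).const_mul s
    have h2 : HasDerivAt (fun t : ℝ => Real.log (1 + t ^ 2) / (2 * √lam))
        (2 * t / (1 + t ^ 2) / (2 * √lam)) t := by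
      have := ((hasDerivAt_pow 2 t).const_add 1).log (one_add_sq_ne_zero t)
      simpa using this.div_const (2 * √lam)
    refine (h1.sub h2).congr_deriv ?_
    have ht := one_add_sq_ne_zero t
    simp only [stripProfileDeriv, stripSlope]
    field_simp
    rw [Real.cosh_sq]
    ring
  have hF0 : F 0 = 0 := by simp [hF, stripHeight]
  have hdiff : Differentiable ℝ F := fun t => (hd t).differentiableAt
  have hFt : 0 ≤ F t := by
    rw [← hF0]
    rcases le_total 0 t with ht | ht
    · refine monotoneOn_of_deriv_nonneg (convex_Ici (0 : ℝ)) hdiff.continuous.continuousOn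
        hdiff.differentiableOn (fun x hx => ?_) Set.self_mem_Ici ht ht
      rw [interior_Ici] at hx
      rw [(hd x).deriv]
      exact mul_nonneg (by positivity) (le_of_lt hx)
    · refine antitoneOn_of_deriv_nonpos (convex_Iic (0 : ℝ)) hdiff.continuous.continuousOn
        hdiff.differentiableOn (fun x hx => ?_) ht Set.self_mem_Iic ht
      rw [interior_Iic] at hx
      rw [(hd x).deriv]
      exact mul_nonpos_of_nonneg_of_nonpos (by positivity) (le_of_lt hx)
  simp only [hF] at hFt
  linarith

theorem abs_le_of_stripHeight_le {lam s : ℝ} (hlam : 0 < lam) (hs : s ≠ 0) {C t B : ℝ}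
    (h : |stripHeight lam s C t| ≤ B) : |t| ≤ Real.exp (2 * √lam * (|s| * B)) := by
  have hl := Real.sqrt_pos.2 hlam
  have h1 : s * stripHeight lam s C t ≤ |s| * B :=
    (le_abs_self _).trans (by rw [abs_mul]; exact mul_le_mul_of_nonneg_left h (abs_nonneg s))
  have h2 := (log_le_stripHeight hlam hs C t).trans h1
  rw [div_le_iff₀ (by positivity), Real.log_le_iff_le_exp (by positivity)] at h2
  rw [mul_comm (2 * √lam)]
  nlinarith [sq_nonneg (|t| - 1), sq_abs t, abs_nonneg t]

theorem abs_arctan_lt (t : ℝ) : |Real.arctan t| < Real.pi / 2 :=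
  abs_lt.2 ⟨Real.neg_pi_div_two_lt_arctan t, Real.arctan_lt_pi_div_two t⟩

theorem stripProfile_mem {lam s : ℝ} (hlam : 0 < lam) (hs : s ≠ 0) (k C t : ℝ) :
    Real.sinh (C - Real.pi * √lam / (2 * |s|)) / √lam - k < stripProfile lam s k C t ∧
      stripProfile lam s k C t < Real.sinh (C + Real.pi * √lam / (2 * |s|)) / √lam - k := by
  have hl := Real.sqrt_pos.2 hlam
  have hA : |√lam / s * Real.arctan t| < Real.pi * √lam / (2 * |s|) := by
    rw [abs_mul, abs_div, abs_of_pos hl]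
    have hs' := abs_pos.2 hs
    calc √lam / |s| * |Real.arctan t| < √lam / |s| * (Real.pi / 2) :=
          mul_lt_mul_of_pos_left (abs_arctan_lt t) (by positivity)
      _ = _ := by field_simp
  rw [abs_lt] at hA
  simp only [stripProfile, stripAngle]
  constructor
  · have : Real.sinh (C - Real.pi * √lam / (2 * |s|)) < Real.sinh (C + √lam / s * Real.arctan t) :=
      Real.sinh_lt_sinh.2 (by linarith [hA.1])
    gcongr
  · have : Real.sinh (C + √lam / s * Real.arctan t) < Real.sinh (C + Real.pi * √lam / (2 * |s|)) :=
      Real.sinh_lt_sinh.2 (by linarith [hA.2])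
    gcongr

/-- The parameter of the ruling at distance `Y` from the axis. -/
def stripParam (lam s k C Y : ℝ) : ℝ :=
  Real.tan (s / √lam * (Real.arsinh (√lam * (Y + k)) - C))

theorem stripParam_stripProfile {lam s : ℝ} (hlam : 0 < lam) (hs : s ≠ 0) (k C t : ℝ) :
    stripParam lam s k C (stripProfile lam s k C t) = t := by
  have hl := (Real.sqrt_pos.2 hlam).ne'
  rw [stripParam, stripProfile, sub_add_cancel, mul_div_cancel₀ _ hl, Real.arsinh_sinh,
    stripAngle, add_sub_cancel_left, ← mul_assoc, div_mul_div_cancel₀ hl, div_self hs, one_mul,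
    Real.tan_arctan]

theorem stripProfile_stripParam {lam s : ℝ} (hlam : 0 < lam) (hs : s ≠ 0) {k C Y : ℝ}
    (h1 : Real.sinh (C - Real.pi * √lam / (2 * |s|)) / √lam - k < Y)
    (h2 : Y < Real.sinh (C + Real.pi * √lam / (2 * |s|)) / √lam - k) :
    stripProfile lam s k C (stripParam lam s k C Y) = Y := by
  have hl := Real.sqrt_pos.2 hlam
  have hs' := abs_pos.2 hs
  rw [sub_lt_iff_lt_add, div_lt_iff₀' hl, ← Real.sinh_arsinh (√lam * (Y + k)),
    Real.sinh_lt_sinh] at h1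
  rw [lt_sub_iff_add_lt, lt_div_iff₀' hl, ← Real.sinh_arsinh (√lam * (Y + k)),
    Real.sinh_lt_sinh] at h2
  set D := Real.arsinh (√lam * (Y + k)) - C with hD
  have hb : |s / √lam * D| < Real.pi / 2 := by
    have hDa : |D| < Real.pi * √lam / (2 * |s|) := abs_lt.2 ⟨by linarith, by linarith⟩
    rw [abs_mul, abs_div, abs_of_pos hl]
    calc |s| / √lam * |D| < |s| / √lam * (Real.pi * √lam / (2 * |s|)) :=
          mul_lt_mul_of_pos_left hDa (by positivity)
      _ = _ := by field_simp
  rw [stripProfile, stripAngle, stripParam, ← hD,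
    Real.arctan_tan (abs_lt.1 hb).1 (abs_lt.1 hb).2,
    show √lam / s * (s / √lam * D) = D by field_simp, hD, add_sub_cancel, Real.sinh_arsinh]
  field_simp
  ring

/-- The solution is swept by the orbits of a profile curve. Two rotated coordinates recover the
orbit parameter and the profile distance, which gives injectivity and the graph property; the
logarithmic growth of the height gives properness. -/
theorem exists_complete_graph {lam : ℝ} (hlam : 0 < lam) {a₁ a₂ a₃ x₀ y₀ z₀ c s : ℝ}
    (hxy : x₀ ^ 2 + y₀ ^ 2 ≠ 0) (hc : (a₁, a₂) = (c * x₀, c * y₀))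
    (hs : s = (a₃ - c * z₀) * √lam) (hs0 : s ≠ 0) :
    ∃ (S : ImmersedSurface) (α β : ℝ) (h : ℝ × ℝ → ℝ), ConnectedSpace S.carrier ∧
      Function.Injective S.toFun ∧ IsCompleteSurface lam S.toFun ∧
      InvariantUnder S.toFun (transGroup (x₀, y₀, z₀)) ∧
      IsTranslator lam S.toFun (a₁, a₂, a₃) ∧
      Set.range S.toFun = horizontalGraph (strip x₀ y₀ α β) h ∧
      β - α = 2 / √lam * √(1 + lam * z₀ ^ 2 / (x₀ ^ 2 + y₀ ^ 2))
        * Real.sinh (Real.pi * √lam / (2 * |s|)) := by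
  have hl := Real.sqrt_pos.2 hlam
  have hpos : 0 < x₀ ^ 2 + y₀ ^ 2 := lt_of_le_of_ne (by positivity) hxy.symm
  set r := √(x₀ ^ 2 + y₀ ^ 2) with hr
  have hr0 : 0 < r := Real.sqrt_pos.2 hpos
  have hr2 : r ^ 2 = x₀ ^ 2 + y₀ ^ 2 := Real.sq_sqrt hpos.le
  obtain ⟨e₁, he₁⟩ : ∃ e₁, x₀ = r * e₁ := ⟨x₀ / r, by field_simp⟩
  obtain ⟨e₂, he₂⟩ : ∃ e₂, y₀ = r * e₂ := ⟨y₀ / r, by field_simp⟩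
  obtain ⟨k, hk⟩ : ∃ k, z₀ = r * k := ⟨z₀ / r, by field_simp⟩
  have he : e₁ ^ 2 + e₂ ^ 2 = 1 := by
    have : r ^ 2 * (e₁ ^ 2 + e₂ ^ 2 - 1) = 0 := by
      rw [he₁, he₂] at hr2
      linear_combination -hr2
    linarith [(mul_eq_zero.1 this).resolve_left (by positivity)]
  -- Every integration constant gives a solution; this one makes y(0) = 0 and cosh C = √(1 + lam
  -- k²), which yields the stated width.
  set C := Real.arsinh (√lam * k) with hC
  set y := stripProfile lam s k C with hy
  set g := stripHeight lam s C with hg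
  set f := ruledGraph e₁ e₂ k y g with hf
  have hys := contDiff_stripProfile lam s k C
  have hgs := contDiff_stripHeight (lam := lam) hs0 C
  have hfs : ContDiff ℝ ∞ f := contDiff_ruledGraph e₁ e₂ k hys hgs
  have hdy := hasDerivAt_stripProfile hlam s k C
  have hdg := hasDerivAt_stripHeight (lam := lam) hs0 C
  have hfi : ∀ v, Function.Injective (fderiv ℝ f v) := fun v =>
    injective_fderiv_ruledGraph he k (hdy _) (hdg _) (stripProfileDeriv_ne_zero hs0 C _)
  have hu : ∀ v, e₁ * (f v).1 + e₂ * (f v).2.1 = v 0 := fun v => by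
    simp only [hf, ruledGraph]; linear_combination v 0 * he
  have hY : ∀ v, e₁ * (f v).2.1 - e₂ * (f v).1 = y (v 1) := fun v => by
    simp only [hf, ruledGraph]; linear_combination y (v 1) * he
  have hinj : Function.Injective f := by
    intro v v' h
    have h0 : v 0 = v' 0 := by rw [← hu, ← hu, h]
    have h1 : v 1 = v' 1 := by
      rw [← stripParam_stripProfile hlam hs0 k C (v 1),
        ← stripParam_stripProfile hlam hs0 k C (v' 1), ← hy, ← hY, ← hY, h]
    rw [plane_eq v, plane_eq v', h0, h1]
  have habs : |e₁| ≤ 1 ∧ |e₂| ≤ 1 :=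
    ⟨abs_le_one_iff_mul_self_le_one.2 (by nlinarith [sq_nonneg e₂]),
      abs_le_one_iff_mul_self_le_one.2 (by nlinarith [sq_nonneg e₁])⟩
  have hcl : Topology.IsClosedEmbedding f := by
    refine isClosedEmbedding_of_bound hfs.continuous hinj fun R => ?_
    -- A bound for the profile height, obtained from z after subtracting k v₀ and v₀ y / 2 with |v₀|
    -- and |y| at most 2R.
    set B := R + |k| * (2 * R) + 2 * R * (2 * R) / 2 with hB
    refine ⟨max (2 * R) (Real.exp (2 * √lam * (|s| * B))), fun v hv => ?_⟩
    have n1 : |(f v).1| ≤ R := (norm_fst_le (f v)).trans hv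
    have n2 : |(f v).2.1| ≤ R := (norm_fst_le (f v).2).trans ((norm_snd_le (f v)).trans hv)
    have n3 : |(f v).2.2| ≤ R := (norm_snd_le (f v).2).trans ((norm_snd_le (f v)).trans hv)
    have hmul : ∀ e x : ℝ, |e| ≤ 1 → |x| ≤ R → |e * x| ≤ R := fun e x h1 h2 => by
      rw [abs_mul]
      exact (mul_le_of_le_one_left (abs_nonneg x) h1).trans h2
    have hR : 0 ≤ R := (abs_nonneg _).trans n1
    have b0 : |v 0| ≤ 2 * R := by
      rw [← hu v]
      exact (abs_add_le _ _).trans (by linarith [hmul _ _ habs.1 n1, hmul _ _ habs.2 n2])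
    have b1 : |y (v 1)| ≤ 2 * R := by
      rw [← hY v]
      exact (abs_sub _ _).trans (by linarith [hmul _ _ habs.1 n2, hmul _ _ habs.2 n1])
    have bg : |g (v 1)| ≤ B := by
      have e : g (v 1) = (f v).2.2 - k * v 0 - v 0 * y (v 1) / 2 := by
        simp only [hf, ruledGraph]; ring
      rw [e]
      refine (abs_sub _ _).trans (add_le_add ((abs_sub _ _).trans (add_le_add n3 ?_)) ?_)
      · rw [abs_mul]; exact mul_le_mul_of_nonneg_left b0 (abs_nonneg k)
      · rw [abs_div, abs_mul, abs_two]
        exact div_le_div_of_nonneg_right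
          (mul_le_mul b0 b1 (abs_nonneg _) (by positivity)) zero_le_two
    exact ⟨le_max_of_le_left b0, le_max_of_le_right (abs_le_of_stripHeight_le hlam hs0 bg)⟩
  have hinv : InvariantUnder f (transGroup (x₀, y₀, z₀)) := by
    refine ⟨fun u v => v + (u * r) • EuclideanSpace.single 0 1, by fun_prop, fun q => by simp,
      fun u v => ?_⟩
    have c0 : (v + (u * r) • EuclideanSpace.single 0 1 : Plane) 0 = v 0 + u * r := by simp
    have c1 : (v + (u * r) • EuclideanSpace.single 0 1 : Plane) 1 = v 1 := by simp
    simp only [hf, ruledGraph, transGroup, leftTrans, mul, c0, c1, he₁, he₂, hk, Prod.smul_mk,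
      smul_eq_mul]
    refine Prod.ext ?_ (Prod.ext ?_ ?_) <;> simp only
    · ring
    · ring
    · linear_combination (-(u * r * y (v 1)) / 2) * he
  have hT : IsVerticalTranslator lam (planeSurface f hfs hfi).toFun s :=
    isTranslator_planeSurface hlam hfs hfi _ fun v =>
      translatorAt_ruledGraph hlam he hdy
        (fun t => ((contDiff_stripProfileDeriv hs0 C).differentiable (by simp) t).hasDerivAt)
        (hasDerivAt_stripSlope lam s C) hdg (stripProfileDeriv_ne_zero hs0 C)
        (strip_equation hlam hs0 k C) v
  set A := Real.pi * √lam / (2 * |s|) with hA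
  refine ⟨planeSurface f hfs hfi, Real.sinh (C - A) / √lam - k, Real.sinh (C + A) / √lam - k,
    fun P => k * (e₁ * P.1 + e₂ * P.2)
      + (e₁ * P.1 + e₂ * P.2) * (e₁ * P.2 - e₂ * P.1) / 2
      + g (stripParam lam s k C (e₁ * P.2 - e₂ * P.1)), inferInstanceAs (ConnectedSpace Plane),
    hinj, isCompleteSurface_of_isClosedEmbedding hlam _ hcl, hinv,
    (isTranslator_iff_isVerticalTranslator hlam hc hs hinv).2 hT, ?_, ?_⟩
  · have hdist : ∀ x y : ℝ, (x₀ * y - y₀ * x) / √(x₀ ^ 2 + y₀ ^ 2) = e₁ * y - e₂ * x := by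
      intro x y
      rw [← hr, div_eq_iff hr0.ne']
      nth_rewrite 1 [he₁]
      nth_rewrite 1 [he₂]
      ring
    change Set.range f = _
    ext p
    simp only [horizontalGraph, strip, Set.mem_ofPred_eq, hdist]
    constructor
    · rintro ⟨v, rfl⟩
      rw [hu, hY, stripParam_stripProfile hlam hs0]
      exact ⟨stripProfile_mem hlam hs0 k C (v 1), rfl⟩
    · rintro ⟨⟨h1, h2⟩, h3⟩
      have hP := stripProfile_stripParam hlam hs0 h1 h2
      set t := stripParam lam s k C (e₁ * p.2.1 - e₂ * p.1)
      refine ⟨(e₁ * p.1 + e₂ * p.2.1) • EuclideanSpace.single 0 1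
        + t • EuclideanSpace.single 1 1, ?_⟩
      have c0 : ((e₁ * p.1 + e₂ * p.2.1) • EuclideanSpace.single 0 (1 : ℝ)
        + t • EuclideanSpace.single 1 1 : Plane) 0 = e₁ * p.1 + e₂ * p.2.1 := by simp
      have c1 : ((e₁ * p.1 + e₂ * p.2.1) • EuclideanSpace.single 0 (1 : ℝ)
        + t • EuclideanSpace.single 1 1 : Plane) 1 = t := by simp
      simp only [hf, ruledGraph, c0, c1, hy, hP]
      refine Prod.ext ?_ (Prod.ext ?_ h3.symm)
      · simp only; linear_combination p.1 * he
      · simp only; linear_combination p.2.1 * he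
  · have hch : Real.cosh C = √(1 + lam * z₀ ^ 2 / (x₀ ^ 2 + y₀ ^ 2)) := by
      rw [hC, Real.cosh_arsinh, mul_pow, Real.sq_sqrt hlam.le, ← hr2, hk]
      congr 2
      field_simp
    -- The width is the difference of the two end values of the profile: sinh(C + A) - sinh(C - A) =
    -- 2 cosh C sinh A.
    rw [← hch, Real.sinh_add, Real.sinh_sub]
    ring

end

end Nil3

/-! ### The theorem assembled -/

theorem theorem3 (lam : ℝ) (hlam : 0 < lam) (a₁ a₂ a₃ : ℝ) (ha : (a₁, a₂) ≠ (0, 0)) :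
    -- (1) invariance under vertical translations
    ((∀ S : ImmersedSurface, ConnectedSpace S.carrier →
        InvariantUnder S.toFun (transGroup (0, 0, 1)) →
        (IsTranslator lam S.toFun (a₁, a₂, a₃) ↔
          ∃ w : ℝ × ℝ, Set.range S.toFun ⊆ cylinder (grimReaper a₁ a₂ w) ∨
            Set.range S.toFun ⊆ cylinder (parallelLine a₁ a₂ w)) ∧
        (IsTranslator lam S.toFun (a₁, a₂, a₃) → IsCompleteSurface lam S.toFun →
          ∃ w : ℝ × ℝ, Set.range S.toFun = cylinder (grimReaper a₁ a₂ w) ∨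
            Set.range S.toFun = cylinder (parallelLine a₁ a₂ w))) ∧
      (∀ w : ℝ × ℝ, ∃ S : ImmersedSurface, ConnectedSpace S.carrier ∧
        Function.Injective S.toFun ∧ Set.range S.toFun = cylinder (grimReaper a₁ a₂ w) ∧
        InvariantUnder S.toFun (transGroup (0, 0, 1)) ∧
        ∀ l : ℝ, 0 < l → IsCompleteSurface l S.toFun ∧
          IsTranslator l S.toFun (a₁, a₂, a₃))) ∧
    -- (2) invariance under a one-parameter group of non-vertical left translations
    (∀ x₀ y₀ z₀ : ℝ, (x₀, y₀) ≠ (0, 0) →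
      ((∃ S : ImmersedSurface, InvariantUnder S.toFun (transGroup (x₀, y₀, z₀)) ∧
          IsTranslator lam S.toFun (a₁, a₂, a₃)) ↔
        ∃ c : ℝ, (a₁, a₂) = (c * x₀, c * y₀)) ∧
      ∀ c : ℝ, (a₁, a₂) = (c * x₀, c * y₀) →
        ∀ s : ℝ, s = (a₃ - c * z₀) * √lam →
          -- such a surface is the same thing as an invariant vertical translator of speed `s`
          (∀ S : ImmersedSurface, InvariantUnder S.toFun (transGroup (x₀, y₀, z₀)) →
            (IsTranslator lam S.toFun (a₁, a₂, a₃) ↔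
              IsVerticalTranslator lam S.toFun s)) ∧
          -- up to a rescaling it has unit speed and is invariant under `L_{(u,0,ku)}`, `k ≥ 0`
          (s ≠ 0 → ∃ θ : ℝ, ∀ S : ImmersedSurface,
            ((InvariantUnder S.toFun (transGroup (x₀, y₀, z₀)) ∧
                IsTranslator lam S.toFun (a₁, a₂, a₃)) ↔
              (InvariantUnder (rot θ ∘ rescale s ∘ S.toFun)
                  (transGroup (1, 0, |s| * |z₀| / √(x₀ ^ 2 + y₀ ^ 2))) ∧
                IsVerticalTranslator (lam / s ^ 2) (rot θ ∘ rescale s ∘ S.toFun) 1))) ∧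
          -- there is a complete solution that is a horizontal graph over a strip
          (s ≠ 0 → ∃ (S : ImmersedSurface) (α β : ℝ) (h : ℝ × ℝ → ℝ),
            ConnectedSpace S.carrier ∧ Function.Injective S.toFun ∧
            IsCompleteSurface lam S.toFun ∧
            InvariantUnder S.toFun (transGroup (x₀, y₀, z₀)) ∧
            IsTranslator lam S.toFun (a₁, a₂, a₃) ∧
            Set.range S.toFun = horizontalGraph (strip x₀ y₀ α β) h ∧
            β - α = 2 / √lam * √(1 + lam * z₀ ^ 2 / (x₀ ^ 2 + y₀ ^ 2))
              * Real.sinh (Real.pi * √lam / (2 * |s|)))) ∧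
    -- (3) invariance under horizontal rotations
    (¬ ∃ S : ImmersedSurface, InvariantUnder S.toFun rot ∧
        IsTranslator lam S.toFun (a₁, a₂, a₃)) ∧
    -- (4) helicoidal surfaces
    ((∀ p : Nil, ¬ ∃ S : ImmersedSurface, InvariantUnder S.toFun (helicoidalMotion p) ∧
        IsTranslator lam S.toFun (a₁, a₂, a₃)) ∧
      (∀ (q : Nil) (c : ℝ), ¬ ∃ S : ImmersedSurface, InvariantUnder S.toFun (screwGroup q c) ∧
        IsTranslator lam S.toFun (a₁, a₂, a₃))) := by
  have hsq : ∀ {x y : ℝ}, (x, y) ≠ (0, 0) → x ^ 2 + y ^ 2 ≠ 0 := fun {x y} h h0 =>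
    h (Prod.ext (by nlinarith [sq_nonneg x, sq_nonneg y]) (by nlinarith [sq_nonneg x, sq_nonneg y]))
  have ha' := hsq ha
  refine ⟨⟨fun S hconn hinv => ⟨⟨subset_cylinder_of_translator hlam ha' hinv, ?_⟩, ?_⟩,
    exists_grimReaper_cylinder a₃ ha'⟩, fun x₀ y₀ z₀ hxy => ⟨⟨?_, ?_⟩, fun c hc s hs =>
      ⟨fun S => isTranslator_iff_isVerticalTranslator hlam hc hs,
        exists_rescaling hlam (hsq hxy) hc hs, exists_complete_graph hlam (hsq hxy) hc hs⟩⟩,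
    ?_, fun p => ?_, fun q c => ?_⟩
  · rintro ⟨w, h⟩
    exact isTranslator_of_subset_cylinder hlam a₃ ha' hinv w h
  · intro hT hcomplete
    obtain ⟨w, h | h⟩ := subset_cylinder_of_translator hlam ha' hinv hT
    · exact ⟨w, Or.inl (range_eq_cylinder_grimReaper ha' hcomplete h)⟩
    · exact ⟨w, Or.inr (range_eq_cylinder_parallelLine ha' hcomplete h)⟩
  · rintro ⟨S, hinv, hT⟩
    have h := parallel_of_invariant hlam (p := (x₀, y₀, z₀)) (hsq hxy) hinv hT
    have h0 := hsq hxy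
    simp only at h
    -- The coefficient of the projection of (a₁, a₂) to (x₀, y₀), which is exact because the vectors
    -- are parallel.
    refine ⟨(a₁ * x₀ + a₂ * y₀) / (x₀ ^ 2 + y₀ ^ 2), Prod.ext ?_ ?_⟩ <;> simp only <;> field_simp
    · linear_combination -y₀ * h
    · linear_combination x₀ * h
  · rintro ⟨c, hc⟩
    exact exists_invariant_translator hlam a₃ ha' z₀ c hc
  · rintro ⟨S, hinv, hT⟩
    exact not_invariant_rot hlam ha hT hinv
  · rintro ⟨S, hinv, hT⟩
    exact not_invariant_helicoidalMotion hlam ha hT p hinv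
  · rintro ⟨S, hinv, hT⟩
    exact not_invariant_screwGroup hlam ha hT q c hinv
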